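/- Let $M>0$ and let $l\ge 1$ be an integer. For $u\in\mathbb{R}$ let $r=r(u)\in(2M,\infty)$ be the unique solution of $u=r+2M\log\left(\frac{r}{2M}-1\right)$, and put $$V_l(u)=\left(1-\frac{2M}{r}\right)\left(\frac{2M}{r^3}+\frac{l(l+1)}{r^2}\right).$$ For $\omega\in\mathbb{C}\setminus\{0\}$ with $\operatorname{Im}\omega\le 0$, the Jost solution $\grave\phi_\omega$ is the $C^2$ solution $\phi:\mathbb{R}\to\mathbb{C}$ of $$-\phi''(u)+\left(-\omega^2+V_l(u)\right)\phi(u)=0,\qquad \lim_{u\to+\infty}e^{i\omega u}\phi(u)=1,\qquad \lim_{u\to+\infty}\left(e^{i\omega u}\phi(u)\right)'=0 .$$ It exists and is unique, and for every $u\in\mathbb{R}$ and every real $\omega\ne0$ the value $\omega^l\grave\phi_\omega(u)$ is the limit of $z^l\grave\phi_z(u)$ as $z\to\omega$ with $\operatorname{Im}z<0$. For real $\omega\neq0$ and $u>0$ let $$\phi^{(0)}_\omega(u)=\omega^l e^{-i\omega u}\sum_{k=0}^{l}\frac{(l+k)!}{k!\,(l-k)!}\,\frac{1}{(2i\omega u)^k}$$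 (that is, $\omega^l e^{-i(l+1)\pi/2}\sqrt{\pi\omega u/2}\;H^{(2)}_{l+1/2}(\omega u)$ with the second Hankel function $H^{(2)}_{l+1/2}$). Then there are complex-valued functions $g_3,g_4,g_5,g_6$ of $(\omega,u)\in\mathbb{R}\times(0,\infty)$ such that for each fixed $u>0$ the functions $\omega\mapsto g_j(\omega,u)$, $j=3,\dots,6$, belong to $C^1(\mathbb{R})$, and for all $u>0$ and all $\omega\in\mathbb{R}\setminus\{0\}$ $$\omega^l\grave\phi_\omega(u)=\phi^{(0)}_\omega(u)+g_3(\omega,u)+2i\omega\log^2(2i\omega)\,g_4(\omega,u)+2i\omega\log(2i\omega)\,g_5(\omega,u)+2i\omega\,g_6(\omega,u),$$ where $\log$ is the principal branch of the logarithm. -/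

import Mathlib

open Set Filter Topology

noncomputable section

/-- The Regge-Wheeler coordinate `u(r) = r + 2M log (r / (2M) - 1)` for `r > 2M`. -/
def reggeWheelerCoord (M r : ℝ) : ℝ :=
  r + 2 * M * Real.log (r / (2 * M) - 1)

/-- The Regge-Wheeler coordinate maps the exterior `(2M, ∞)` bijectively onto the real line. -/
theorem reggeWheelerCoord_bijOn {M : ℝ} (hM : 0 < M) :
    BijOn (reggeWheelerCoord M) (Ioi (2 * M)) univ := by
  have h2 : 0 < 2 * M := by positivity
  have key : ∀ r : ℝ, 2 * M < r → 0 < r / (2 * M) - 1 := fun r hr => by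
    have := (one_lt_div h2).2 hr
    linarith
  have hmono : StrictMonoOn (reggeWheelerCoord M) (Ioi (2 * M)) := by
    intro a ha b hb hab
    have hlog : Real.log (a / (2 * M) - 1) < Real.log (b / (2 * M) - 1) := by
      apply Real.log_lt_log (key a ha)
      have := div_lt_div_of_pos_right hab h2
      linarith
    have := mul_lt_mul_of_pos_left hlog h2
    unfold reggeWheelerCoord
    linarith
  have hcont : ContinuousOn (reggeWheelerCoord M) (Ioi (2 * M)) := by
    unfold reggeWheelerCoord
    refine continuousOn_id.add (continuousOn_const.mul (ContinuousOn.log ?_ ?_))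
    · fun_prop
    · intro r hr
      exact (key r hr).ne'
  refine ⟨fun _ _ => mem_univ _, hmono.injOn, ?_⟩
  intro y _
  -- the point `2M (1 + e^s)` has coordinate `2M (1 + e^s) + 2M s`
  have hval : ∀ s : ℝ, reggeWheelerCoord M (2 * M * (1 + Real.exp s))
      = 2 * M * (1 + Real.exp s) + 2 * M * s := by
    intro s
    unfold reggeWheelerCoord
    have : 2 * M * (1 + Real.exp s) / (2 * M) - 1 = Real.exp s := by
      field_simp
      ring
    rw [this, Real.log_exp]
  have hmem : ∀ s : ℝ, 2 * M * (1 + Real.exp s) ∈ Ioi (2 * M) := by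
    intro s
    have := mul_pos h2 (Real.exp_pos s)
    simp only [mem_Ioi]
    linarith
  set s₁ : ℝ := min 0 ((y - 4 * M) / (2 * M)) with hs₁
  set s₂ : ℝ := y / (2 * M) with hs₂
  have hlo : reggeWheelerCoord M (2 * M * (1 + Real.exp s₁)) ≤ y := by
    rw [hval]
    have h1 : Real.exp s₁ ≤ 1 := Real.exp_le_one_iff.2 (min_le_left _ _)
    have h3 : 2 * M * s₁ ≤ y - 4 * M := by
      calc 2 * M * s₁ ≤ 2 * M * ((y - 4 * M) / (2 * M)) :=
            mul_le_mul_of_nonneg_left (min_le_right _ _) h2.le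
        _ = y - 4 * M := by field_simp
    nlinarith
  have hhi : y ≤ reggeWheelerCoord M (2 * M * (1 + Real.exp s₂)) := by
    rw [hval]
    have h1 : 2 * M * s₂ = y := by
      rw [hs₂]
      field_simp
    have := mul_pos h2 (Real.exp_pos s₂)
    linarith
  exact isPreconnected_Ioi.intermediate_value (hmem s₁) (hmem s₂) hcont ⟨hlo, hhi⟩

/-- The Schwarzschild radius `r(u) ∈ (2M, ∞)` as a function of the Regge-Wheeler coordinate `u`:
the inverse of `reggeWheelerCoord M` on `(2M, ∞)`. -/
def schwarzschildRadius (M u : ℝ) : ℝ :=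
  Function.invFunOn (reggeWheelerCoord M) (Ioi (2 * M)) u

theorem schwarzschildRadius_gt {M : ℝ} (hM : 0 < M) (u : ℝ) :
    2 * M < schwarzschildRadius M u :=
  Function.invFunOn_mem ((reggeWheelerCoord_bijOn hM).surjOn (mem_univ u))

theorem reggeWheelerCoord_schwarzschildRadius {M : ℝ} (hM : 0 < M) (u : ℝ) :
    reggeWheelerCoord M (schwarzschildRadius M u) = u :=
  Function.invFunOn_eq ((reggeWheelerCoord_bijOn hM).surjOn (mem_univ u))

/-- The potential `V_l(u) = (1 - 2M/r) (2M/r³ + l(l+1)/r²)`, with `r = r(u)`. -/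
def potential (M : ℝ) (l : ℕ) (u : ℝ) : ℝ :=
  (1 - 2 * M / schwarzschildRadius M u) *
    (2 * M / schwarzschildRadius M u ^ 3 + (l : ℝ) * ((l : ℝ) + 1) / schwarzschildRadius M u ^ 2)

/-- `φ` is the Jost solution at `+∞` for the frequency `ω`: a `C²` solution of
`-φ'' + (-ω² + V_l) φ = 0` on the real line with
`e^{iωu} φ(u) → 1` and `(e^{iωu} φ(u))' → 0` as `u → +∞`. -/
structure IsJostSolution (M : ℝ) (l : ℕ) (ω : ℂ) (φ : ℝ → ℂ) : Prop where
  contDiff : ContDiff ℝ 2 φ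
  schrodinger : ∀ u : ℝ, -deriv (deriv φ) u + (-ω ^ 2 + (potential M l u : ℂ)) * φ u = 0
  tendsto_one : Tendsto (fun u : ℝ => Complex.exp (Complex.I * ω * u) * φ u) atTop (𝓝 1)
  tendsto_deriv :
    Tendsto (deriv fun u : ℝ => Complex.exp (Complex.I * ω * u) * φ u) atTop (𝓝 0)

/-- The Jost solution at `+∞` (the function satisfying `IsJostSolution`; its existence and
uniqueness for `ω ≠ 0`, `Im ω ≤ 0` is asserted wherever it is used). -/
def jostSolution (M : ℝ) (l : ℕ) (ω : ℂ) : ℝ → ℂ :=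
  Classical.epsilon (IsJostSolution M l ω)

/-- The symbol `(l + 1/2, k) = (l + k)! / (k! (l - k)!)`, used for `k ≤ l` only. -/
def hankelSymbol (l k : ℕ) : ℂ :=
  ((l + k).factorial : ℂ) / ((k.factorial : ℂ) * ((l - k).factorial : ℂ))

/-- The function `φ⁽⁰⁾_ω(u) = ω^l e^{-iωu} ∑_{k=0}^{l} (l + 1/2, k) / (2iωu)^k`, which is
`ω^l e^{-i(l+1)π/2} √(πωu/2) H⁽²⁾_{l+1/2}(ωu)` written out. -/
def initialFunction (l : ℕ) (ω u : ℝ) : ℂ :=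
  (ω : ℂ) ^ l * Complex.exp (-(Complex.I * ω * u)) *
    ∑ k ∈ Finset.range (l + 1), hankelSymbol l k / (2 * Complex.I * ω * u) ^ k

end

/-! Put t = r/(2M) and a = 4iMω; real ω ≠ 0 corresponds to nonzero imaginary a. Writing the Jost
solution as e^{-iωu} a^{-l} t n(t) with n(t) = ∫_0^∞ e^{-pt} F(p) dp turns the Schrödinger equation
into (p(p+a)F')' - l(l+1)F = p(pF)' for the Laplace density F. Without the right-hand side this is
Legendre's equation, solved by P(p) = a^l P_l(1+2p/a) (`legForm`). With F = Pv the equation can be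
integrated once: v' = p/(p+a) v - (p(p+a)P²)^{-1} ∫_0^p sP (sP)' v ds. Together with v(0) = 1 this
reads v = 1 + A_a v for a Volterra operator A_a (`volterraOp`).

The zeros of P lie at -θa with θ in [0,1] (Rodrigues and Gauss–Lucas), so no denominator vanishes
for p > 0 and a in an open sector of opening 4π/3, which contains the closed right half plane minus
0. By `volterraOp_contraction`, A_a is a contraction for weights of any exponential rate λ > 1. This
is enough, because t > 1 on the whole line. Hence v and n(t) are holomorphic in a on the sector,
with a limit as a → 0. `laplace_jostDensity_radial` and `isJostSolution_laplaceJost` show that n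
gives a Jost solution; a Wronskian argument gives uniqueness.

For low frequencies, compare A_a with A_0 on the limit density v_0. The integral of 1/(q+a) produces
the logarithm: A_a v_0 = A_0 v_0 + (1/2) a log a + a s (`volterraOp_radialDensity_zero`). Since v_0
= 1 + A_0 v_0, setting G = (1-A_a)^{-1} s gives the exact identity (1 - (1/2) a log a) v = v_0 + aG
(`radialDensity_expansion`). Multiplying by P and taking Laplace transforms, (1 - (1/2) a log a) N =
R, where N = n(t) and R is a polynomial in a plus a times a function holomorphic in the sector and
continuous at 0.

If h is holomorphic in the sector with limit h(0) at the vertex, Cauchy's estimate on discs of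
radius |a|/4 gives a h'(a) → 0, so a h(a) is C¹ in ω (`contDiff_jostParam_mul`). Therefore R and aN
are C¹ in ω. Inserting N = R + (1/2) a log a N into itself gives N = R + (1/2) a log a R + (1/4) a²
log²a N, and log a = log 2M + log 2iω yields the expansion. The Hankel term φ⁽⁰⁾ is itself C¹ in ω,
so it is absorbed by g₃. -/

/-! ### Zeros of shifted Legendre polynomials. -/

open MeasureTheory Polynomial in
/-- The roots of a shifted Legendre polynomial lie in the segment `[0, 1]`. -/
theorem shiftedLegendre_root_mem_segment (l : ℕ) {z : ℂ}
    (hz : aeval z (shiftedLegendre l) = 0) : z ∈ segment ℝ (0 : ℂ) 1 := by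
  set Q : ℂ[X] := X ^ l * (1 - X) ^ l with hQ
  have hQdeg : Q.natDegree = 2 * l := by
    have h1 : (1 - X : ℂ[X]).natDegree = 1 := by
      rw [show (1 - X : ℂ[X]) = -(X - C 1) by simp, natDegree_neg, natDegree_X_sub_C]
    have h1' : (1 - X : ℂ[X]) ≠ 0 := fun h => by simp [h] at h1
    rw [hQ, natDegree_mul (pow_ne_zero _ X_ne_zero) (pow_ne_zero _ h1'), natDegree_pow,
      natDegree_pow, h1, natDegree_X]
    ring
  -- Gauss–Lucas, iterated: the roots of a derivative lie in the convex hull of the roots before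
  -- differentiation. All derivatives met here have positive degree, since 2l - n > 0 for n < l.
  have key : ∀ n : ℕ, n ≤ l → (derivative^[n] Q).rootSet ℂ ⊆ segment ℝ (0 : ℂ) 1 := by
    intro n
    induction n with
    | zero =>
      intro _ w hw
      rw [Function.iterate_zero, id, mem_rootSet] at hw
      have h2 := hw.2
      simp only [hQ, map_mul, map_pow, aeval_X, map_sub, map_one, mul_eq_zero] at h2
      rcases h2 with h2 | h2
      · rw [eq_zero_of_pow_eq_zero h2]
        exact left_mem_segment ℝ _ _
      · rw [← sub_eq_zero.1 (eq_zero_of_pow_eq_zero h2)]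
        exact right_mem_segment ℝ _ _
    | succ n ih =>
      intro hn
      rw [Function.iterate_succ_apply']
      have hd : 0 < (derivative^[n] Q).degree := by
        rw [← natDegree_pos_iff_degree_pos]
        have hc : (derivative^[n] Q).coeff (2 * l - n) ≠ 0 := by
          rw [coeff_iterate_derivative, show 2 * l - n + n = 2 * l by omega]
          have : Q.coeff (2 * l) ≠ 0 := by
            rw [← hQdeg]
            refine leadingCoeff_ne_zero.2 fun h => ?_
            rw [h] at hQdeg
            simp at hQdeg
            omega
          rw [nsmul_eq_mul]
          refine mul_ne_zero ?_ this
          exact_mod_cast (Nat.pos_iff_ne_zero.1 (Nat.descFactorial_pos.2 (by omega)))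
        have := le_natDegree_of_ne_zero hc
        omega
      refine (rootSet_derivative_subset_convexHull_rootSet hd).trans ?_
      exact convexHull_min (ih (by omega)) (convex_segment _ _)
  -- Rodrigues' formula identifies the l-th derivative of Q with l! times the shifted Legendre
  -- polynomial.
  have hrod := factorial_mul_shiftedLegendre_eq l
  apply_fun Polynomial.map (Int.castRingHom ℂ) at hrod
  rw [← iterate_derivative_map] at hrod
  simp only [Polynomial.map_mul, Polynomial.map_natCast, Polynomial.map_pow, map_X,
    Polynomial.map_sub, Polynomial.map_one] at hrod
  have hne : derivative^[l] Q ≠ 0 := by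
    rw [hQ, ← hrod]
    refine mul_ne_zero (by exact_mod_cast l.factorial_ne_zero) ?_
    rw [Polynomial.map_ne_zero_iff (Int.castRingHom ℂ).injective_int]
    intro h
    have := degree_shiftedLegendre l
    simp [h] at this
  refine key l le_rfl ?_
  rw [mem_rootSet]
  refine ⟨hne, ?_⟩
  have hz' : aeval z ((shiftedLegendre l).map (Int.castRingHom ℂ)) = 0 := by
    rw [← hz, coe_aeval_eq_eval, eval_map, aeval_def]
    rfl
  rw [hQ, ← hrod, map_mul, hz', mul_zero]

/-! ### The homogenized Legendre polynomial and its differential equation. -/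

/-- The coefficients of the polynomial `P_l(1 + 2 ξ)`. -/
noncomputable def legCoeff (l k : ℕ) : ℂ := ((l.choose k * (l + k).choose l : ℕ) : ℂ)

/-- The homogenized shifted Legendre polynomial `a ^ l * P_l(1 + 2 p / a)`. -/
noncomputable def legForm (l : ℕ) (p a : ℂ) : ℂ :=
  ∑ k ∈ Finset.range (l + 1), legCoeff l k * p ^ k * a ^ (l - k)

/-- The derivative of `legForm l` in its first variable. -/
noncomputable def legFormD (l : ℕ) (p a : ℂ) : ℂ :=
  ∑ k ∈ Finset.range (l + 1), legCoeff l k * (k * p ^ (k - 1)) * a ^ (l - k)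

/-- The derivative of `p * legForm l p a` in `p`. -/
noncomputable def legFormH (l : ℕ) (p a : ℂ) : ℂ :=
  ∑ k ∈ Finset.range (l + 1), (legCoeff l k * (k + 1)) * p ^ k * a ^ (l - k)

/-- This recurrence is what Legendre's equation amounts to on coefficients. -/
theorem legCoeff_succ (l k : ℕ) (hk : k ≤ l) :
    ((k : ℂ) + 1) ^ 2 * legCoeff l (k + 1) = (l - k) * (l + k + 1) * legCoeff l k := by
  unfold legCoeff
  have h1 : (l.choose (k + 1) : ℂ) * (k + 1) = l.choose k * (l - k) := by
    have := Nat.choose_succ_right_eq l k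
    rw [← Nat.cast_sub hk]
    exact_mod_cast this
  have h2 : ((l + (k + 1)).choose l : ℂ) * (k + 1) = (l + k).choose l * (l + k + 1) := by
    have := Nat.choose_mul_succ_eq (l + k) l
    rw [show l + k + 1 - l = k + 1 by omega] at this
    exact_mod_cast this.symm
  push_cast at *
  linear_combination ((l + (k + 1)).choose l : ℂ) * (k + 1) * h1 + (l.choose k : ℂ) * (l - k) * h2

theorem legForm_hasDerivAt (l : ℕ) (p a : ℂ) :
    HasDerivAt (fun p => legForm l p a) (legFormD l p a) p := by
  unfold legForm legFormD
  refine HasDerivAt.fun_sum fun k _ => ?_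
  exact ((hasDerivAt_pow k p).const_mul _).mul_const _

theorem legFormH_eq (l : ℕ) (p a : ℂ) : legFormH l p a = legForm l p a + p * legFormD l p a := by
  unfold legFormH legForm legFormD
  rw [Finset.mul_sum, ← Finset.sum_add_distrib]
  refine Finset.sum_congr rfl fun k _ => ?_
  rcases k with _ | k
  · simp
  · simp only [Nat.add_sub_cancel, pow_succ]
    ring

/-- The Legendre equation in homogeneous form. -/
theorem legForm_legendre (l : ℕ) (p a : ℂ) :
    HasDerivAt (fun p => p * (p + a) * legFormD l p a) (l * (l + 1) * legForm l p a) p := by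
  have h1 : ∀ p : ℂ, p * (p + a) * legFormD l p a =
      ∑ k ∈ Finset.range (l + 1),
        (k * legCoeff l k) * (p ^ (k + 1) * a ^ (l - k) + p ^ k * a ^ (l - k + 1)) := by
    intro p
    unfold legFormD
    rw [Finset.mul_sum]
    refine Finset.sum_congr rfl fun k _ => ?_
    rcases k with _ | k
    · simp
    · simp only [Nat.add_sub_cancel, pow_succ]
      ring
  simp_rw [h1]
  have h2 : HasDerivAt (fun p : ℂ => ∑ k ∈ Finset.range (l + 1),
        (k * legCoeff l k) * (p ^ (k + 1) * a ^ (l - k) + p ^ k * a ^ (l - k + 1)))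
      (∑ k ∈ Finset.range (l + 1), (k * legCoeff l k) *
        (((k + 1 : ℕ) * p ^ k) * a ^ (l - k) + (k * p ^ (k - 1)) * a ^ (l - k + 1))) p := by
    refine HasDerivAt.fun_sum fun k _ => HasDerivAt.const_mul _ ?_
    exact ((hasDerivAt_pow (k + 1) p).mul_const _).add ((hasDerivAt_pow k p).mul_const _)
  convert h2 using 1
  unfold legForm
  rw [Finset.mul_sum]
  have h3 : ∀ k : ℕ, (k * legCoeff l k) *
        (((k + 1 : ℕ) * p ^ k) * a ^ (l - k) + (k * p ^ (k - 1)) * a ^ (l - k + 1)) =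
      (k * (k + 1) * legCoeff l k) * p ^ k * a ^ (l - k) +
        (k : ℂ) ^ 2 * legCoeff l k * p ^ (k - 1) * a ^ (l - k + 1) := by
    intro k
    push_cast
    ring
  simp_rw [h3]
  rw [Finset.sum_add_distrib]
  -- Index shift: the term k = 0 on the left is killed by k², the term k = l on the right by l - k,
  -- and `legCoeff_succ` matches the others.
  have h4 : ∑ k ∈ Finset.range (l + 1),
      (k : ℂ) ^ 2 * legCoeff l k * p ^ (k - 1) * a ^ (l - k + 1) =
      ∑ k ∈ Finset.range (l + 1), ((l - k) * (l + k + 1) * legCoeff l k) * p ^ k * a ^ (l - k) := by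
    rw [Finset.sum_range_succ', Finset.sum_range_succ _ l]
    simp only [Nat.cast_zero, sub_self, zero_mul, add_zero, ne_eq, OfNat.ofNat_ne_zero,
      not_false_eq_true, zero_pow]
    refine Finset.sum_congr rfl fun k hk => ?_
    have hk' := Finset.mem_range.1 hk
    rw [show l - (k + 1) + 1 = l - k by omega, Nat.add_sub_cancel]
    have := legCoeff_succ l k hk'.le
    push_cast
    rw [this]
  rw [h4, ← Finset.sum_add_distrib]
  refine Finset.sum_congr rfl fun k _ => ?_
  ring

/-! ### The parameter sector. -/

/-- The open sector of opening angle `4π/3` around the positive real axis. -/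
def sector : Set ℂ := {a | -(‖a‖ / 2) < a.re}

/-- The closed sector of opening angle `4π/3` around the positive real axis. -/
def closedSector : Set ℂ := {a | -(‖a‖ / 2) ≤ a.re}

theorem sector_subset : sector ⊆ closedSector := fun _ h => le_of_lt (α := ℝ) h

theorem zero_mem_closedSector : (0 : ℂ) ∈ closedSector := by simp [closedSector]

theorem ne_zero_of_mem_sector {a : ℂ} (ha : a ∈ sector) : a ≠ 0 := by
  rintro rfl
  simp [sector] at ha

theorem isOpen_sector : IsOpen sector :=
  isOpen_lt (by fun_prop) Complex.continuous_re

theorem isClosed_closedSector : IsClosed closedSector :=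
  isClosed_le (by fun_prop) Complex.continuous_re

theorem mem_sector_of_re_nonneg {a : ℂ} (ha : 0 ≤ a.re) (h0 : a ≠ 0) : a ∈ sector := by
  have := norm_pos_iff.2 h0
  show -(‖a‖ / 2) < a.re
  linarith

theorem closedSector_smul {a : ℂ} (ha : a ∈ closedSector) {c : ℝ} (hc : 0 ≤ c) :
    (c : ℂ) * a ∈ closedSector := by
  have ha' : -(‖a‖ / 2) ≤ a.re := ha
  show -(‖(c : ℂ) * a‖ / 2) ≤ ((c : ℂ) * a).re
  rw [norm_mul, Complex.norm_real, Real.norm_of_nonneg hc, Complex.re_ofReal_mul]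
  nlinarith

/-- In the closed sector, `|q + a|` is comparable with `q + |a|` for `q ≥ 0`. -/
theorem norm_add_ge {a : ℂ} (ha : a ∈ closedSector) {q : ℝ} (hq : 0 ≤ q) :
    (q + ‖a‖) / 2 ≤ ‖(q : ℂ) + a‖ := by
  have ha' : -(‖a‖ / 2) ≤ a.re := ha
  have h0 := norm_nonneg a
  have h1 : ‖a‖ ^ 2 = a.re ^ 2 + a.im ^ 2 := by
    rw [Complex.sq_norm, Complex.normSq_apply]; ring
  have h2 : ‖(q : ℂ) + a‖ ^ 2 = (q + a.re) ^ 2 + a.im ^ 2 := by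
    rw [Complex.sq_norm, Complex.normSq_apply]; simp; ring
  rw [← sq_le_sq₀ (by positivity) (norm_nonneg _), h2]
  nlinarith [sq_nonneg (q - ‖a‖), mul_nonneg hq h0]

theorem add_ne_zero_of_mem {a : ℂ} (ha : a ∈ closedSector) {q : ℝ} (hq : 0 < q) :
    (q : ℂ) + a ≠ 0 := by
  have h := norm_add_ge ha hq.le
  have := norm_nonneg a
  exact norm_pos_iff.1 (by linarith)

theorem add_mem_slitPlane {a : ℂ} (ha : a ∈ closedSector) {q : ℝ} (hq : 0 < q) :
    (q : ℂ) + a ∈ Complex.slitPlane := by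
  rw [Complex.mem_slitPlane_iff]
  by_cases him : a.im = 0
  · left
    have ha' : -(‖a‖ / 2) ≤ a.re := ha
    have hn : ‖a‖ = |a.re| := (Complex.abs_re_eq_norm.2 him).symm
    rw [hn] at ha'
    have : 0 ≤ a.re := by
      by_contra h
      rw [abs_of_neg (not_le.1 h)] at ha'
      linarith
    simp
    linarith
  · right
    simpa using him

theorem mem_slitPlane_of_mem_sector {a : ℂ} (ha : a ∈ sector) : a ∈ Complex.slitPlane := by
  rw [Complex.mem_slitPlane_iff]
  by_cases him : a.im = 0
  · left
    have ha' : -(‖a‖ / 2) < a.re := ha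
    have hn : ‖a‖ = |a.re| := (Complex.abs_re_eq_norm.2 him).symm
    rw [hn] at ha'
    by_contra h
    rw [abs_of_nonpos (not_lt.1 h)] at ha'
    linarith [not_lt.1 h]
  · right
    simpa using him

/-! ### Zeros and size of the Legendre form over the sector. -/

theorem legForm_zero_left (l : ℕ) (a : ℂ) : legForm l 0 a = a ^ l := by
  unfold legForm
  rw [Finset.sum_eq_single 0]
  · simp [legCoeff]
  · intro k _ hk
    simp [hk]
  · simp

theorem legForm_zero_right (l : ℕ) (p : ℂ) : legForm l p 0 = legCoeff l l * p ^ l := by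
  unfold legForm
  rw [Finset.sum_eq_single l]
  · simp
  · intro k hk hkl
    have := Finset.mem_range.1 hk
    rw [zero_pow (by omega), mul_zero]
  · simp

theorem legFormH_zero_right (l : ℕ) (p : ℂ) :
    legFormH l p 0 = legCoeff l l * (l + 1) * p ^ l := by
  unfold legFormH
  rw [Finset.sum_eq_single l]
  · simp
  · intro k hk hkl
    have := Finset.mem_range.1 hk
    rw [zero_pow (by omega), mul_zero]
  · simp

theorem legCoeff_self_ne_zero (l : ℕ) : legCoeff l l ≠ 0 := by
  unfold legCoeff
  exact_mod_cast (Nat.mul_pos (by simp) (Nat.choose_pos (by omega))).ne'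

theorem hom_sum_smul (l : ℕ) (f : ℕ → ℂ) (c p a : ℂ) :
    ∑ k ∈ Finset.range (l + 1), f k * (c * p) ^ k * (c * a) ^ (l - k) =
      c ^ l * ∑ k ∈ Finset.range (l + 1), f k * p ^ k * a ^ (l - k) := by
  rw [Finset.mul_sum]
  refine Finset.sum_congr rfl fun k hk => ?_
  have hk' := Finset.mem_range.1 hk
  rw [mul_pow, mul_pow, show c ^ l = c ^ k * c ^ (l - k) by
    rw [← pow_add]; congr 1; omega]
  ring

theorem legForm_smul (l : ℕ) (c p a : ℂ) :
    legForm l (c * p) (c * a) = c ^ l * legForm l p a := hom_sum_smul l _ c p a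

theorem legFormH_smul (l : ℕ) (c p a : ℂ) :
    legFormH l (c * p) (c * a) = c ^ l * legFormH l p a := hom_sum_smul l _ c p a

/-- For a ≠ 0 a zero would be q = -θa with θ in [0,1], and `norm_add_ge` applied to θa then forces q
= θ = 0, where the value is a^l. For a = 0 only the top monomial survives. -/
theorem legForm_ne_zero (l : ℕ) {a : ℂ} (ha : a ∈ closedSector) {q : ℝ} (hq : 0 ≤ q)
    (h : 0 < q + ‖a‖) : legForm l q a ≠ 0 := by
  rcases eq_or_ne a 0 with rfl | ha0
  · rw [legForm_zero_right]
    simp at h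
    exact mul_ne_zero (legCoeff_self_ne_zero l) (pow_ne_zero _ (by exact_mod_cast h.ne'))
  · intro h0
    have h1 : legForm l q a = a ^ l * Polynomial.aeval (-((q : ℂ) / a))
        (Polynomial.shiftedLegendre l) := by
      have : legForm l q a = legForm l (a * (q / a)) (a * 1) := by
        rw [mul_one, mul_div_cancel₀ _ ha0]
      rw [this, legForm_smul]
      congr 1
      unfold legForm Polynomial.shiftedLegendre
      rw [map_sum]
      refine Finset.sum_congr rfl fun k _ => ?_
      simp only [one_pow, mul_one, legCoeff, Nat.cast_mul, map_mul, map_pow, map_neg,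
        map_one, map_natCast, Polynomial.aeval_X]
      rw [neg_pow ((q : ℂ) / a)]
      have : ((-1 : ℂ) ^ k) * (-1) ^ k = 1 := by rw [← mul_pow]; simp
      linear_combination -(l.choose k : ℂ) * ((l + k).choose l) * (q / a) ^ k * this
    rw [h1] at h0
    have h2 := shiftedLegendre_root_mem_segment l
      ((mul_eq_zero.1 h0).resolve_left (pow_ne_zero _ ha0))
    rw [segment_eq_image] at h2
    obtain ⟨θ, hθ, hθ2⟩ := h2
    have h3 : (q : ℂ) + θ * a = 0 := by
      have : (θ : ℂ) = -((q : ℂ) / a) := by simpa using hθ2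
      rw [this]
      field_simp
      ring
    have h4 := norm_add_ge (closedSector_smul ha hθ.1) hq
    rw [h3, norm_zero, norm_mul, Complex.norm_real, Real.norm_of_nonneg hθ.1] at h4
    have h5 : 0 ≤ θ * ‖a‖ := mul_nonneg hθ.1 (norm_nonneg _)
    have h6 : q = 0 := by linarith
    have h7 : θ = 0 := by
      rw [h6] at h4
      have := norm_pos_iff.2 ha0
      nlinarith [hθ.1]
    rw [h6, h7] at hθ2
    simp at hθ2
    rw [← h1, h6, Complex.ofReal_zero, legForm_zero_left] at h0
    exact pow_ne_zero _ ha0 h0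

theorem continuous_legForm (l : ℕ) : Continuous fun x : ℂ × ℂ => legForm l x.1 x.2 := by
  unfold legForm
  fun_prop

theorem continuous_legFormH (l : ℕ) : Continuous fun x : ℂ × ℂ => legFormH l x.1 x.2 := by
  unfold legFormH
  fun_prop

theorem norm_hom_sum_le (l : ℕ) (f : ℕ → ℂ) {p a : ℂ} {X : ℝ} (hp : ‖p‖ ≤ X) (ha : ‖a‖ ≤ X) :
    ‖∑ k ∈ Finset.range (l + 1), f k * p ^ k * a ^ (l - k)‖ ≤
      (∑ k ∈ Finset.range (l + 1), ‖f k‖) * X ^ l := by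
  rw [Finset.sum_mul]
  refine norm_sum_le_of_le _ fun k hk => ?_
  have hk' := Finset.mem_range.1 hk
  rw [norm_mul, norm_mul, norm_pow, norm_pow, mul_assoc]
  refine mul_le_mul_of_nonneg_left ?_ (norm_nonneg _)
  have hX : 0 ≤ X := (norm_nonneg _).trans hp
  calc ‖p‖ ^ k * ‖a‖ ^ (l - k) ≤ X ^ k * X ^ (l - k) := by gcongr
    _ = X ^ l := by rw [← pow_add]; congr 1; omega

theorem legForm_upper (l : ℕ) : ∃ C : ℝ, 0 < C ∧ ∀ (p a : ℂ) (X : ℝ), ‖p‖ ≤ X → ‖a‖ ≤ X →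
    ‖legForm l p a‖ ≤ C * X ^ l ∧ ‖legFormH l p a‖ ≤ C * X ^ l := by
  refine ⟨∑ k ∈ Finset.range (l + 1), ‖legCoeff l k‖ +
    ∑ k ∈ Finset.range (l + 1), ‖legCoeff l k * (k + 1)‖ + 1, by positivity,
    fun p a X hp ha => ?_⟩
  have hX : 0 ≤ X := (norm_nonneg _).trans hp
  constructor
  · refine (norm_hom_sum_le l _ hp ha).trans ?_
    gcongr
    have : 0 ≤ ∑ k ∈ Finset.range (l + 1), ‖legCoeff l k * (k + 1)‖ := by positivity
    linarith
  · refine (norm_hom_sum_le l _ hp ha).trans ?_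
    gcongr
    have : 0 ≤ ∑ k ∈ Finset.range (l + 1), ‖legCoeff l k‖ := by positivity
    linarith

/-- Both sides are homogeneous of degree l, so c can be taken as the minimum of the modulus over the
compact set q + |a| = 1, where it does not vanish. -/
theorem legForm_lower (l : ℕ) : ∃ c : ℝ, 0 < c ∧ ∀ (q : ℝ) (a : ℂ), 0 ≤ q → a ∈ closedSector →
    c * (q + ‖a‖) ^ l ≤ ‖legForm l q a‖ := by
  set K : Set (ℝ × ℂ) := {x | 0 ≤ x.1 ∧ x.2 ∈ closedSector ∧ x.1 + ‖x.2‖ = 1} with hK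
  have hKc : IsCompact K := by
    refine Metric.isCompact_of_isClosed_isBounded ?_ ?_
    · exact (isClosed_le continuous_const continuous_fst).inter
        ((isClosed_closedSector.preimage continuous_snd).inter
          (isClosed_eq (by fun_prop) continuous_const))
    · refine (Metric.isBounded_closedBall (x := (0 : ℝ × ℂ)) (r := 1)).subset ?_
      rintro ⟨q, a⟩ ⟨h1, _, h3⟩
      simp only [mem_closedBall_zero_iff, Prod.norm_def, sup_le_iff]
      simp only at h1 h3
      rw [Real.norm_of_nonneg h1]
      constructor <;> linarith [norm_nonneg a]
  have hcont : ContinuousOn (fun x : ℝ × ℂ => ‖legForm l x.1 x.2‖) K := by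
    have := (continuous_legForm l).comp
      (show Continuous fun x : ℝ × ℂ => ((x.1 : ℂ), x.2) by fun_prop)
    exact this.norm.continuousOn
  have hne : K.Nonempty := ⟨(1, 0), by simp [hK, zero_mem_closedSector]⟩
  obtain ⟨x, hx, hmin⟩ := hKc.exists_isMinOn hne hcont
  refine ⟨‖legForm l x.1 x.2‖, norm_pos_iff.2
    (legForm_ne_zero l hx.2.1 hx.1 (by rw [hx.2.2]; exact one_pos)), fun q a hq ha => ?_⟩
  rcases (add_nonneg hq (norm_nonneg a)).eq_or_lt with h0 | h0
  · have hq0 : q = 0 := by linarith [norm_nonneg a]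
    have ha0 : a = 0 := norm_eq_zero.1 (by linarith [norm_nonneg a])
    subst hq0 ha0
    rcases l with _ | l
    · simp [legForm, legCoeff]
    · simp
  · set s := q + ‖a‖
    have hmem : ((s⁻¹ * q : ℝ), ((s⁻¹ : ℝ) : ℂ) * a) ∈ K := by
      refine ⟨by positivity, closedSector_smul ha (by positivity), ?_⟩
      simp only
      rw [norm_mul, Complex.norm_real, Real.norm_of_nonneg (by positivity), ← mul_add]
      exact inv_mul_cancel₀ h0.ne'
    have h1 := hmin hmem
    simp only [mem_ofPred_eq] at h1
    have h2 : legForm l q a = (s : ℂ) ^ l * legForm l ((s⁻¹ * q : ℝ)) (((s⁻¹ : ℝ) : ℂ) * a) := by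
      rw [← legForm_smul]
      have : (s : ℂ) ≠ 0 := by exact_mod_cast h0.ne'
      congr 1
      · push_cast; field_simp
      · push_cast; field_simp
    rw [h2, norm_mul, norm_pow, Complex.norm_real, Real.norm_of_nonneg h0.le, mul_comm]
    exact mul_le_mul_of_nonneg_left h1 (by positivity)

/-! ### Holomorphic dependence of integrals on a parameter. -/

open MeasureTheory in
/-- A dominated integral of holomorphic functions of a parameter is holomorphic. -/
theorem differentiableOn_integral_of_dominated {X : Type*} [MeasurableSpace X] {μ : Measure X}
    {U : Set ℂ} (hU : IsOpen U) {F : ℂ → X → ℂ} {bound : X → ℝ}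
    (hmeas : ∀ a ∈ U, AEStronglyMeasurable (F a) μ)
    (hdiff : ∀ᵐ x ∂μ, DifferentiableOn ℂ (fun a => F a x) U)
    (hbound : ∀ᵐ x ∂μ, ∀ a ∈ U, ‖F a x‖ ≤ bound x) (hint : Integrable bound μ) :
    DifferentiableOn ℂ (fun a => ∫ x, F a x ∂μ) U := by
  intro a ha
  obtain ⟨r, hr, hball⟩ := Metric.isOpen_iff.1 hU a ha
  have hmem : ∀ n : ℕ, a + (r / 2 / (n + 1) : ℝ) ∈ U := by
    intro n
    refine hball ?_
    rw [Metric.mem_ball, dist_eq_norm, add_sub_cancel_left, Complex.norm_real,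
      Real.norm_of_nonneg (by positivity)]
    calc r / 2 / (n + 1) ≤ r / 2 := div_le_self (by positivity) (by linarith [n.cast_nonneg (α := ℝ)])
      _ < r := by linarith
  have hlim : Tendsto (fun n : ℕ => ((r / 2 / (n + 1) : ℝ) : ℂ)) atTop (𝓝[≠] 0) := by
    refine tendsto_nhdsWithin_iff.2 ⟨?_, Eventually.of_forall fun n => ?_⟩
    · rw [← Complex.ofReal_zero]
      refine (Complex.continuous_ofReal.tendsto 0).comp ?_
      have := (tendsto_one_div_add_atTop_nhds_zero_nat (𝕜 := ℝ)).const_mul (r / 2)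
      simpa [div_eq_mul_inv] using this
    · simp only [mem_compl_iff, mem_singleton_iff, Complex.ofReal_eq_zero]
      positivity
  -- The derivative in the parameter is measurable as a pointwise limit of difference quotients
  -- along a sequence of real increments.
  have hF' : AEStronglyMeasurable (fun x => deriv (fun a => F a x) a) μ := by
    refine aestronglyMeasurable_of_tendsto_ae atTop
      (f := fun (n : ℕ) x => ((r / 2 / (n + 1) : ℝ) : ℂ)⁻¹ •
        (F (a + (r / 2 / (n + 1) : ℝ)) x - F a x))
      (fun n => AEStronglyMeasurable.fun_const_smul
        ((hmeas _ (hmem n)).sub (hmeas a ha)) _) ?_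
    filter_upwards [hdiff] with x hx
    have h1 := ((hx a ha).differentiableAt (hU.mem_nhds ha)).hasDerivAt
    exact (hasDerivAt_iff_tendsto_slope_zero.1 h1).comp hlim
  have hr2 : 0 < r / 2 := by positivity
  have hsub : ∀ b ∈ Metric.ball a (r / 2), Metric.closedBall b (r / 2) ⊆ U := by
    intro b hb c hc
    refine hball ?_
    rw [Metric.mem_ball] at hb ⊢
    rw [Metric.mem_closedBall] at hc
    linarith [dist_triangle c b a]
  have key := hasDerivAt_integral_of_dominated_loc_of_deriv_le (μ := μ) (𝕜 := ℂ)
    (F := F) (F' := fun b x => deriv (fun a => F a x) b) (x₀ := a)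
    (bound := fun x => bound x / (r / 2)) (Metric.ball_mem_nhds a hr2)
    (by filter_upwards [hU.mem_nhds ha] with b hb using hmeas b hb)
    (by
      refine hint.mono' (hmeas a ha) ?_
      filter_upwards [hbound] with x hx using hx a ha)
    hF' ?_ (hint.div_const _) ?_
  · exact key.2.differentiableAt.differentiableWithinAt
  -- Cauchy's estimate on discs of radius r/2 turns the bound on F into one on its derivative, so no
  -- domination of the derivative has to be assumed.
  · filter_upwards [hdiff, hbound] with x hx hb b hbb
    refine Complex.norm_deriv_le_of_forall_mem_sphere_norm_le hr2 ?_ ?_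
    · refine DifferentiableOn.diffContOnCl (hx.mono ?_)
      exact (closure_mono Metric.ball_subset_closedBall).trans
        (by rw [Metric.isClosed_closedBall.closure_eq]; exact hsub b hbb)
    · intro z hz
      exact hb z (hsub b hbb (Metric.sphere_subset_closedBall hz))
  · filter_upwards [hdiff] with x hx b hbb
    have hbU : b ∈ U := hsub b hbb (Metric.mem_closedBall_self hr2.le)
    exact ((hx b hbU).differentiableAt (hU.mem_nhds hbU)).hasDerivAt

/-! ### The Volterra kernel: bounds, scaling and regularity. -/

/-- The kernel of the averaging part of the Volterra operator. -/
noncomputable def volterraKernel (l : ℕ) (σ q : ℝ) (a : ℂ) : ℂ :=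
  σ * q * legForm l (σ * q) a * legFormH l (σ * q) a / ((q + a) * legForm l q a ^ 2)

theorem volterraKernel_den_ne_zero (l : ℕ) {a : ℂ} (ha : a ∈ closedSector) {q : ℝ} (hq : 0 < q) :
    ((q : ℂ) + a) * legForm l q a ^ 2 ≠ 0 :=
  mul_ne_zero (add_ne_zero_of_mem ha hq)
    (pow_ne_zero _ (legForm_ne_zero l ha hq.le (by linarith [norm_nonneg a])))

/-- With X = q + |a|, the numerator is at most and the denominator at least a constant times
X^(2l+1). -/
theorem volterraKernel_bound (l : ℕ) : ∃ C : ℝ, 0 < C ∧ ∀ (σ q : ℝ) (a : ℂ), σ ∈ Icc (0 : ℝ) 1 →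
    0 < q → a ∈ closedSector → ‖volterraKernel l σ q a‖ ≤ C := by
  obtain ⟨C, hC, hup⟩ := legForm_upper l
  obtain ⟨c, hc, hlo⟩ := legForm_lower l
  refine ⟨2 * C ^ 2 / c ^ 2, by positivity, fun σ q a hσ hq ha => ?_⟩
  have hX : 0 < q + ‖a‖ := by linarith [norm_nonneg a]
  set X := q + ‖a‖ with hXdef
  have hσq : ‖(σ : ℂ) * q‖ ≤ X := by
    rw [norm_mul, Complex.norm_real, Complex.norm_real, Real.norm_of_nonneg hσ.1,
      Real.norm_of_nonneg hq.le]
    nlinarith [norm_nonneg a, hσ.2]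
  have haX : ‖a‖ ≤ X := by linarith
  obtain ⟨h1, h2⟩ := hup _ a X hσq haX
  have h3 := hlo q a hq.le ha
  have h4 := norm_add_ge ha hq.le
  have hnum : ‖(σ : ℂ) * q * legForm l (σ * q) a * legFormH l (σ * q) a‖ ≤
      X * (C * X ^ l) * (C * X ^ l) := by
    rw [norm_mul, norm_mul]
    gcongr
  have hden : X / 2 * (c * X ^ l) ^ 2 ≤ ‖((q : ℂ) + a) * legForm l q a ^ 2‖ := by
    rw [norm_mul, norm_pow]
    gcongr
  unfold volterraKernel
  rw [norm_div]
  calc _ ≤ (X * (C * X ^ l) * (C * X ^ l)) / (X / 2 * (c * X ^ l) ^ 2) := by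
        gcongr
    _ = 2 * C ^ 2 / c ^ 2 := by
      have : X ^ l ≠ 0 := by positivity
      field_simp

/-- The kernel is homogeneous of degree 0 in (q, a), so only the ratio a/q matters and estimates can
be made at q = 1. -/
theorem volterraKernel_scale (l : ℕ) (σ : ℝ) {q : ℝ} (hq : 0 < q) (a : ℂ) :
    volterraKernel l σ q a = volterraKernel l σ 1 (((q⁻¹ : ℝ) : ℂ) * a) := by
  have hq' : (q : ℂ) ≠ 0 := by exact_mod_cast hq.ne'
  have e1 : legForm l (σ * q) a =
      (q : ℂ) ^ l * legForm l (σ * (1 : ℝ)) (((q⁻¹ : ℝ) : ℂ) * a) := by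
    rw [← legForm_smul]
    congr 1
    · push_cast; ring
    · push_cast; field_simp
  have e2 : legFormH l (σ * q) a =
      (q : ℂ) ^ l * legFormH l (σ * (1 : ℝ)) (((q⁻¹ : ℝ) : ℂ) * a) := by
    rw [← legFormH_smul]
    congr 1
    · push_cast; ring
    · push_cast; field_simp
  have e3 : legForm l q a = (q : ℂ) ^ l * legForm l (1 : ℝ) (((q⁻¹ : ℝ) : ℂ) * a) := by
    rw [← legForm_smul]
    congr 1
    · push_cast; ring
    · push_cast; field_simp
  have e4 : (q : ℂ) + a = q * ((1 : ℝ) + ((q⁻¹ : ℝ) : ℂ) * a) := by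
    push_cast; field_simp
  unfold volterraKernel
  rw [e1, e2, e3, e4]
  have hql : (q : ℂ) ^ l ≠ 0 := pow_ne_zero _ hq'
  have : ∀ A B D E : ℂ, σ * q * ((q : ℂ) ^ l * A) * ((q : ℂ) ^ l * B) /
      (q * D * ((q : ℂ) ^ l * E) ^ 2) =
      ((q : ℂ) * ((q : ℂ) ^ l) ^ 2) * (σ * A * B) / (((q : ℂ) * ((q : ℂ) ^ l) ^ 2) * (D * E ^ 2)) := by
    intro A B D E
    ring_nf
  rw [this, mul_div_mul_left _ _ (mul_ne_zero hq' (pow_ne_zero _ hql))]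
  push_cast
  ring_nf

/-- Every monomial other than the one with k = l carries at least one factor a. -/
theorem norm_hom_sum_sub_le (l : ℕ) (f : ℕ → ℂ) {p a : ℂ} (hp : ‖p‖ ≤ 1) (ha : ‖a‖ ≤ 1) :
    ‖∑ k ∈ Finset.range (l + 1), f k * p ^ k * a ^ (l - k) - f l * p ^ l‖ ≤
      (∑ k ∈ Finset.range (l + 1), ‖f k‖) * ‖a‖ := by
  rw [Finset.sum_range_succ, Finset.sum_range_succ]
  simp only [Nat.sub_self, pow_zero, mul_one, add_sub_cancel_right]
  calc ‖∑ k ∈ Finset.range l, f k * p ^ k * a ^ (l - k)‖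
      ≤ ∑ k ∈ Finset.range l, ‖f k‖ * ‖a‖ := by
        refine norm_sum_le_of_le _ fun k hk => ?_
        have hk' := Finset.mem_range.1 hk
        rw [norm_mul, norm_mul, norm_pow, norm_pow, mul_assoc]
        refine mul_le_mul_of_nonneg_left ?_ (norm_nonneg _)
        have h1 : ‖p‖ ^ k ≤ 1 := pow_le_one₀ (norm_nonneg _) hp
        have h2 : ‖a‖ ^ (l - k) ≤ ‖a‖ := pow_le_of_le_one (norm_nonneg _) ha (by omega)
        calc _ ≤ 1 * ‖a‖ := by gcongr
          _ = _ := one_mul _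
    _ ≤ _ := by
        rw [← Finset.sum_mul]
        refine mul_le_mul_of_nonneg_right ?_ (norm_nonneg _)
        linarith [norm_nonneg (f l)]

theorem norm_mul_sub_mul_le {x y x₀ y₀ : ℂ} {B L t : ℝ} (hx : ‖x‖ ≤ B)
    (hy₀ : ‖y₀‖ ≤ B) (h1 : ‖x - x₀‖ ≤ L * t) (h2 : ‖y - y₀‖ ≤ L * t) :
    ‖x * y - x₀ * y₀‖ ≤ 2 * B * L * t := by
  have hB : 0 ≤ B := (norm_nonneg _).trans hx
  have : x * y - x₀ * y₀ = x * (y - y₀) + (x - x₀) * y₀ := by ring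
  rw [this]
  calc _ ≤ ‖x‖ * ‖y - y₀‖ + ‖x - x₀‖ * ‖y₀‖ := by
        refine (norm_add_le _ _).trans ?_
        rw [norm_mul, norm_mul]
    _ ≤ B * (L * t) + (L * t) * B := by
        have := (norm_nonneg _).trans h1
        gcongr
    _ = _ := by ring

/-- By scaling take q = 1. If |a| ≥ 1, boundedness of the kernel suffices; if |a| ≤ 1, numerator and
denominator are Lipschitz in a and the denominator is bounded away from 0. The gain |a|/q makes the
difference quotient in a, multiplied by σq, a bounded kernel. -/
theorem volterraKernel_lipschitz (l : ℕ) : ∃ C : ℝ, 0 < C ∧ ∀ (σ q : ℝ) (a : ℂ),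
    σ ∈ Icc (0 : ℝ) 1 → 0 < q → a ∈ closedSector →
    ‖volterraKernel l σ q a - volterraKernel l σ q 0‖ ≤ C * (‖a‖ / q) := by
  obtain ⟨C₀, hC₀, hb⟩ := volterraKernel_bound l
  obtain ⟨C, hC, hup⟩ := legForm_upper l
  obtain ⟨c, hc, hlo⟩ := legForm_lower l
  set L : ℝ := ∑ k ∈ Finset.range (l + 1), ‖legCoeff l k‖ +
    ∑ k ∈ Finset.range (l + 1), ‖legCoeff l k * (k + 1)‖ + 1 with hL
  have hLa : ∑ k ∈ Finset.range (l + 1), ‖legCoeff l k‖ ≤ L := by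
    have : 0 ≤ ∑ k ∈ Finset.range (l + 1), ‖legCoeff l k * (k + 1)‖ := by positivity
    linarith
  have hLb : ∑ k ∈ Finset.range (l + 1), ‖legCoeff l k * (k + 1)‖ ≤ L := by
    have : 0 ≤ ∑ k ∈ Finset.range (l + 1), ‖legCoeff l k‖ := by positivity
    linarith
  have hLpos : 0 < L := by positivity
  set B : ℝ := C + C ^ 2 + 2 with hB
  set L' : ℝ := 2 * C * L + 1 with hL'
  set D : ℝ := (2 * C * L + C₀ * (2 * B * L')) / (1 / 2 * c ^ 2) with hD
  have hDpos : 0 < D := by positivity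
  refine ⟨2 * C₀ + D, by positivity, fun σ q a hσ hq ha => ?_⟩
  rw [volterraKernel_scale l σ hq a, volterraKernel_scale l σ hq 0, mul_zero]
  set τ : ℂ := ((q⁻¹ : ℝ) : ℂ) * a with hτdef
  have hτ : τ ∈ closedSector := closedSector_smul ha (by positivity)
  have hτn : ‖a‖ / q = ‖τ‖ := by
    rw [hτdef, norm_mul, Complex.norm_real, Real.norm_of_nonneg (by positivity)]
    field_simp
  rw [hτn]
  rcases le_total 1 ‖τ‖ with h1 | h1
  · calc _ ≤ ‖volterraKernel l σ 1 τ‖ + ‖volterraKernel l σ 1 0‖ := norm_sub_le _ _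
      _ ≤ C₀ + C₀ := add_le_add (hb σ 1 τ hσ one_pos hτ)
          (hb σ 1 0 hσ one_pos zero_mem_closedSector)
      _ ≤ (2 * C₀ + D) * 1 := by linarith
      _ ≤ _ := by gcongr
  · have hσn : ‖(σ : ℂ)‖ ≤ 1 := by
      rw [Complex.norm_real, Real.norm_of_nonneg hσ.1]; exact hσ.2
    have h0n : ‖(0 : ℂ)‖ ≤ 1 := by simp
    have lipP : ∀ p : ℂ, ‖p‖ ≤ 1 → ‖legForm l p τ - legForm l p 0‖ ≤ L * ‖τ‖ := by
      intro p hp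
      rw [legForm_zero_right]
      refine (norm_hom_sum_sub_le l _ hp h1).trans ?_
      gcongr
    have lipH : ∀ p : ℂ, ‖p‖ ≤ 1 → ‖legFormH l p τ - legFormH l p 0‖ ≤ L * ‖τ‖ := by
      intro p hp
      rw [legFormH_zero_right]
      refine (norm_hom_sum_sub_le l _ hp h1).trans ?_
      gcongr
    have bdP : ∀ p b : ℂ, ‖p‖ ≤ 1 → ‖b‖ ≤ 1 → ‖legForm l p b‖ ≤ C ∧ ‖legFormH l p b‖ ≤ C := by
      intro p b hp hb
      simpa using hup p b 1 hp hb
    have hnum : ‖legForm l σ τ * legFormH l σ τ - legForm l σ 0 * legFormH l σ 0‖ ≤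
        2 * C * L * ‖τ‖ :=
      norm_mul_sub_mul_le (bdP _ _ hσn h1).1 (bdP _ _ hσn h0n).2 (lipP _ hσn) (lipH _ hσn)
    have hone : ‖((1 : ℝ) : ℂ)‖ ≤ 1 := by simp
    have hsq : ‖legForm l (1 : ℝ) τ ^ 2 - legForm l (1 : ℝ) 0 ^ 2‖ ≤ L' * ‖τ‖ := by
      rw [pow_two, pow_two]
      refine (norm_mul_sub_mul_le (bdP _ _ hone h1).1 (bdP _ _ hone h0n).1 (lipP _ hone)
        (lipP _ hone)).trans ?_
      gcongr
      linarith
    have hden : ‖((1 : ℝ) + τ) * legForm l (1 : ℝ) τ ^ 2 -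
        ((1 : ℝ) + 0) * legForm l (1 : ℝ) 0 ^ 2‖ ≤ 2 * B * L' * ‖τ‖ := by
      refine norm_mul_sub_mul_le ?_ ?_ ?_ hsq
      · refine (norm_add_le _ _).trans ?_
        have : 0 < C + C ^ 2 := by positivity
        linarith
      · rw [norm_pow]
        have h5 := (bdP _ _ hone h0n).1
        calc _ ≤ C ^ 2 := by gcongr
          _ ≤ B := by linarith
      · rw [add_zero, add_sub_cancel_left]
        have : 0 < 2 * C * L := by positivity
        nlinarith [norm_nonneg τ]
    have hdenlo : 1 / 2 * c ^ 2 ≤ ‖((1 : ℝ) + τ) * legForm l (1 : ℝ) τ ^ 2‖ := by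
      rw [norm_mul, norm_pow]
      have h6 := norm_add_ge hτ zero_le_one
      have h7 := hlo 1 τ zero_le_one hτ
      have h8 : c * 1 ≤ c * (1 + ‖τ‖) ^ l := by
        gcongr
        exact one_le_pow₀ (by linarith [norm_nonneg τ])
      have h9 : c ≤ ‖legForm l (1 : ℝ) τ‖ := by linarith
      have h10 : 1 / 2 ≤ ‖((1 : ℝ) : ℂ) + τ‖ := by linarith [norm_nonneg τ]
      gcongr
    have hd1 := volterraKernel_den_ne_zero l hτ one_pos
    have hd0 := volterraKernel_den_ne_zero l zero_mem_closedSector one_pos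
    have hk0 := hb σ 1 0 hσ one_pos zero_mem_closedSector
    -- The identity n/d - n₀/d₀ = (n - n₀ - (n₀/d₀)(d - d₀))/d, which needs a lower bound for d
    -- only.
    have hid : volterraKernel l σ 1 τ - volterraKernel l σ 1 0 =
        (σ * (legForm l σ τ * legFormH l σ τ - legForm l σ 0 * legFormH l σ 0) -
          volterraKernel l σ 1 0 * (((1 : ℝ) + τ) * legForm l (1 : ℝ) τ ^ 2 -
        ((1 : ℝ) + 0) * legForm l (1 : ℝ) 0 ^ 2)) / (((1 : ℝ) + τ) * legForm l (1 : ℝ) τ ^ 2) := by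
      have e0 : volterraKernel l σ 1 0 * (((1 : ℝ) + 0) * legForm l (1 : ℝ) 0 ^ 2) =
          σ * (legForm l σ 0 * legFormH l σ 0) := by
        unfold volterraKernel
        rw [div_mul_cancel₀ _ hd0]
        push_cast
        ring_nf
      have e1 : volterraKernel l σ 1 τ * (((1 : ℝ) + τ) * legForm l (1 : ℝ) τ ^ 2) =
          σ * (legForm l σ τ * legFormH l σ τ) := by
        unfold volterraKernel
        rw [div_mul_cancel₀ _ hd1]
        push_cast
        ring_nf
      rw [eq_div_iff hd1, sub_mul, e1, mul_sub, mul_sub, e0]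
      ring
    rw [hid, norm_div]
    calc _ ≤ (2 * C * L * ‖τ‖ + C₀ * (2 * B * L' * ‖τ‖)) / (1 / 2 * c ^ 2) := by
          gcongr
          refine (norm_sub_le _ _).trans ?_
          rw [norm_mul, norm_mul]
          refine add_le_add ?_ ?_
          · calc _ ≤ 1 * (2 * C * L * ‖τ‖) := by gcongr
              _ = _ := one_mul _
          · gcongr
      _ = D * ‖τ‖ := by rw [hD]; ring
      _ ≤ _ := by gcongr; linarith

theorem volterraKernel_continuousOn (l : ℕ) {a : ℂ} (ha : a ∈ closedSector) :
    ContinuousOn (fun x : ℝ × ℝ => volterraKernel l x.1 x.2 a) (univ ×ˢ Ioi 0) := by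
  have hc : ∀ g : ℂ × ℂ → ℂ, Continuous g →
      Continuous fun x : ℝ × ℝ => g ((x.1 : ℂ) * x.2, a) := fun g hg => hg.comp (by fun_prop)
  have h1 : Continuous fun x : ℝ × ℝ => legForm l (x.1 * x.2) a := hc _ (continuous_legForm l)
  have h2 : Continuous fun x : ℝ × ℝ => legFormH l (x.1 * x.2) a := hc _ (continuous_legFormH l)
  have h3 : Continuous fun x : ℝ × ℝ => legForm l x.2 a :=
    Continuous.comp (g := fun x : ℂ × ℂ => legForm l x.1 x.2)
      (f := fun x : ℝ × ℝ => ((x.2 : ℂ), a)) (continuous_legForm l) (by fun_prop)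
  have h4 : Continuous fun x : ℝ × ℝ => (x.1 : ℂ) * x.2 := by fun_prop
  have h5 : Continuous fun x : ℝ × ℝ => (x.2 : ℂ) + a := by fun_prop
  have hnum := (h4.mul h1).mul h2
  have hden := h5.mul (h3.pow 2)
  have hne : ∀ x ∈ (univ : Set ℝ) ×ˢ Ioi (0 : ℝ), ((x.2 : ℂ) + a) * legForm l x.2 a ^ 2 ≠ 0 :=
    fun x hx => volterraKernel_den_ne_zero l ha hx.2
  exact ContinuousOn.div (hnum.continuousOn (s := univ ×ˢ Ioi 0)) hden.continuousOn hne

theorem differentiable_legForm_right (l : ℕ) (p : ℂ) : Differentiable ℂ fun a => legForm l p a := by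
  unfold legForm
  fun_prop

theorem differentiable_legFormH_right (l : ℕ) (p : ℂ) :
    Differentiable ℂ fun a => legFormH l p a := by
  unfold legFormH
  fun_prop

theorem volterraKernel_differentiableAt (l : ℕ) (σ : ℝ) {q : ℝ} (hq : 0 < q) {a : ℂ}
    (ha : a ∈ closedSector) : DifferentiableAt ℂ (fun a => volterraKernel l σ q a) a := by
  unfold volterraKernel
  have h1 := differentiable_legForm_right l (σ * q)
  have h2 := differentiable_legFormH_right l (σ * q)
  have h3 := differentiable_legForm_right l q
  refine DifferentiableAt.fun_div ?_ ?_ (volterraKernel_den_ne_zero l ha hq)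
  · exact (((differentiableAt_const _).mul (h1 a)).mul (h2 a))
  · exact ((differentiableAt_const _).add differentiableAt_id).mul ((h3 a).pow 2)

theorem legForm_hasDerivAt_ofReal (l : ℕ) (p : ℝ) (a : ℂ) :
    HasDerivAt (fun p : ℝ => legForm l p a) (legFormD l p a) p :=
  (legForm_hasDerivAt l p a).comp_ofReal

/-- With s = σq the numerator is sP (sP)', the derivative of (sP)²/2. This explicit value is the
source of the logarithm in the expansion. -/
theorem volterraKernel_integral (l : ℕ) {q : ℝ} (hq : 0 < q) {a : ℂ} (ha : a ∈ closedSector) :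
    ∫ σ in (0 : ℝ)..1, volterraKernel l σ q a = q / (q + a) / 2 := by
  have hq' : (q : ℂ) ≠ 0 := by exact_mod_cast hq.ne'
  have hd := volterraKernel_den_ne_zero l ha hq
  have hd1 := add_ne_zero_of_mem ha hq
  have hd2 : legForm l q a ≠ 0 := fun h => hd (by rw [h]; simp)
  have hder : ∀ σ ∈ uIcc (0 : ℝ) 1, HasDerivAt
      (fun σ : ℝ => (σ * q * legForm l (σ * q) a) ^ 2 / (2 * q * ((q + a) * legForm l q a ^ 2)))
      (volterraKernel l σ q a) σ := by
    intro σ _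
    have h1 : HasDerivAt (fun σ : ℝ => (σ : ℂ) * q) q σ := by
      simpa using (Complex.ofRealCLM.hasDerivAt (x := σ)).mul_const (q : ℂ)
    have h2 := (legForm_hasDerivAt l ((σ : ℂ) * q) a).comp σ h1
    have h3 := ((h1.mul h2).pow 2).div_const (2 * q * ((q + a) * legForm l q a ^ 2))
    refine h3.congr_deriv ?_
    unfold volterraKernel
    rw [legFormH_eq]
    simp only [Function.comp, Pi.mul_apply]
    field_simp
    ring
  rw [intervalIntegral.integral_eq_sub_of_hasDerivAt hder]
  · simp only [Complex.ofReal_one, one_mul, Complex.ofReal_zero, zero_mul]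
    field_simp
    simp
  · refine ContinuousOn.intervalIntegrable ?_
    exact (volterraKernel_continuousOn l ha).comp (f := fun σ : ℝ => (σ, q))
      (Continuous.continuousOn (by fun_prop)) (fun σ _ => ⟨mem_univ _, hq⟩)

/-! ### Averages and primitives of functions with an integrable singularity at 0. -/

open MeasureTheory

/-- The averaging operator `f ↦ ∫₀¹ k(σ, q) f(σ q) dσ`. -/
noncomputable def kernelAvg (k : ℝ → ℝ → ℂ) (f : ℝ → ℂ) (q : ℝ) : ℂ :=
  ∫ σ in (0 : ℝ)..1, k σ q * f (σ * q)

/-- The primitive `p ↦ ∫₀ᵖ f`. -/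
noncomputable def primitive (f : ℝ → ℂ) (p : ℝ) : ℂ := ∫ q in (0 : ℝ)..p, f q

/-- A function bounded by a multiple of `q ^ (-1/2)` on `(0, P]`. -/
def SingBound (f : ℝ → ℂ) (P K : ℝ) : Prop :=
  ∀ q ∈ Ioc (0 : ℝ) P, ‖f q‖ ≤ K * q ^ (-(1 / 2) : ℝ)

theorem SingBound.nonneg {f : ℝ → ℂ} {P K : ℝ} (hP : 0 < P) (h : SingBound f P K) : 0 ≤ K := by
  have h1 := (norm_nonneg _).trans (h P ⟨hP, le_rfl⟩)
  exact nonneg_of_mul_nonneg_left h1 (by positivity)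

theorem SingBound.mono {f : ℝ → ℂ} {P P' K : ℝ} (h : SingBound f P K) (hP : P' ≤ P) :
    SingBound f P' K := fun q hq => h q ⟨hq.1, hq.2.trans hP⟩

theorem integrable_rpow_neg_half (P : ℝ) :
    IntervalIntegrable (fun q : ℝ => q ^ (-(1 / 2) : ℝ)) volume 0 P :=
  intervalIntegral.intervalIntegrable_rpow' (by norm_num)

theorem integral_rpow_neg_half (P : ℝ) :
    ∫ q in (0 : ℝ)..P, q ^ (-(1 / 2) : ℝ) = 2 * P ^ (1 / 2 : ℝ) := by
  rw [integral_rpow (Or.inl (by norm_num)), Real.zero_rpow (by norm_num)]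
  norm_num
  ring

theorem SingBound.intervalIntegrable {f : ℝ → ℂ} {P K : ℝ} (hf : ContinuousOn f (Ioi 0))
    (h : SingBound f P K) (hP : 0 ≤ P) : IntervalIntegrable f volume 0 P := by
  rw [intervalIntegrable_iff_integrableOn_Ioc_of_le hP]
  have hi := ((integrable_rpow_neg_half P).const_mul K)
  rw [intervalIntegrable_iff_integrableOn_Ioc_of_le hP] at hi
  refine hi.mono' ((hf.mono Ioc_subset_Ioi_self).aestronglyMeasurable measurableSet_Ioc) ?_
  exact (ae_restrict_iff' measurableSet_Ioc).2 (Eventually.of_forall h)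

theorem SingBound.primitive_le {f : ℝ → ℂ} {P K : ℝ} (h : SingBound f P K) (hP : 0 ≤ P) :
    ‖primitive f P‖ ≤ K * (2 * P ^ (1 / 2 : ℝ)) := by
  rw [← integral_rpow_neg_half, ← intervalIntegral.integral_const_mul]
  exact intervalIntegral.norm_integral_le_of_norm_le hP
    (Eventually.of_forall fun q hq => h q hq) ((integrable_rpow_neg_half P).const_mul K)

theorem SingBound.primitive {f : ℝ → ℂ} {P K : ℝ} (h : SingBound f P K) (hP : 0 < P) :
    SingBound (primitive f) P (2 * P * K) := by
  intro p hp
  have hK := h.nonneg hP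
  refine ((h.mono hp.2).primitive_le hp.1.le).trans ?_
  have h1 : p ^ (1 / 2 : ℝ) = p * p ^ (-(1 / 2) : ℝ) := by
    rw [mul_comm, ← Real.rpow_add_one hp.1.ne']
    norm_num
  rw [h1]
  have h2 : 0 ≤ p ^ (-(1 / 2) : ℝ) := Real.rpow_nonneg hp.1.le _
  calc K * (2 * (p * p ^ (-(1 / 2) : ℝ))) = (2 * p * K) * p ^ (-(1 / 2) : ℝ) := by ring
    _ ≤ (2 * P * K) * p ^ (-(1 / 2) : ℝ) := by
      gcongr
      exact hp.2

theorem hasDerivAt_primitive {f : ℝ → ℂ} (hf : ContinuousOn f (Ioi 0))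
    {p K : ℝ} (hp : 0 < p) (h : SingBound f p K) : HasDerivAt (primitive f) (f p) p :=
  intervalIntegral.integral_hasDerivAt_right (h.intervalIntegrable hf hp.le)
    (hf.stronglyMeasurableAtFilter isOpen_Ioi p hp) (hf.continuousAt (Ioi_mem_nhds hp))

theorem SingBound.kernelAvg_integrand {k : ℝ → ℝ → ℂ} {f : ℝ → ℂ} {C P K : ℝ}
    (hk : ∀ σ ∈ Ioc (0 : ℝ) 1, ∀ q, 0 < q → ‖k σ q‖ ≤ C) (h : SingBound f P K) {q : ℝ}
    (hq : q ∈ Ioc 0 P) (hC : 0 ≤ C) {σ : ℝ} (hσ : σ ∈ Ioc (0 : ℝ) 1) :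
    ‖k σ q * f (σ * q)‖ ≤ C * K * q ^ (-(1 / 2) : ℝ) * σ ^ (-(1 / 2) : ℝ) := by
  have h1 : σ * q ∈ Ioc 0 P := ⟨mul_pos hσ.1 hq.1, by nlinarith [hσ.2, hq.1, hq.2]⟩
  rw [norm_mul]
  calc _ ≤ C * (K * (σ * q) ^ (-(1 / 2) : ℝ)) :=
        mul_le_mul (hk σ hσ q hq.1) (h _ h1) (norm_nonneg _) hC
    _ = _ := by rw [Real.mul_rpow hσ.1.le hq.1.le]; ring

/-- The power -1/2 separates in the product σq, and ∫_0^1 σ^(-1/2) dσ = 2, so the class of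
singularities is preserved. -/
theorem SingBound.kernelAvg {k : ℝ → ℝ → ℂ} {f : ℝ → ℂ} {C P K : ℝ} (hC : 0 ≤ C)
    (hk : ∀ σ ∈ Ioc (0 : ℝ) 1, ∀ q, 0 < q → ‖k σ q‖ ≤ C) (h : SingBound f P K) :
    SingBound (kernelAvg k f) P (2 * C * K) := by
  intro q hq
  have h1 : ‖_root_.kernelAvg k f q‖ ≤
      ∫ σ in (0 : ℝ)..1, C * K * q ^ (-(1 / 2) : ℝ) * σ ^ (-(1 / 2) : ℝ) :=
    intervalIntegral.norm_integral_le_of_norm_le zero_le_one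
      (Eventually.of_forall fun σ hσ => h.kernelAvg_integrand hk hq hC hσ)
      ((integrable_rpow_neg_half 1).const_mul _)
  rw [intervalIntegral.integral_const_mul, integral_rpow_neg_half] at h1
  refine h1.trans (le_of_eq ?_)
  rw [Real.one_rpow]
  ring

theorem kernelAvg_integrand_continuousOn {k : ℝ → ℝ → ℂ} {f : ℝ → ℂ}
    (hkc : ContinuousOn (fun x : ℝ × ℝ => k x.1 x.2) (Ioi 0 ×ˢ Ioi 0))
    (hf : ContinuousOn f (Ioi 0)) :
    ContinuousOn (fun x : ℝ × ℝ => k x.1 x.2 * f (x.1 * x.2)) (Ioi 0 ×ˢ Ioi 0) :=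
  hkc.mul (hf.comp (Continuous.continuousOn (by fun_prop))
    fun _ hx => mul_pos (mem_Ioi.1 hx.1) (mem_Ioi.1 hx.2))

theorem kernelAvg_integrand_measurable {k : ℝ → ℝ → ℂ} {f : ℝ → ℂ}
    (hkc : ContinuousOn (fun x : ℝ × ℝ => k x.1 x.2) (Ioi 0 ×ˢ Ioi 0))
    (hf : ContinuousOn f (Ioi 0)) {q : ℝ} (hq : 0 < q) :
    AEStronglyMeasurable (fun σ => k σ q * f (σ * q)) (volume.restrict (Ioc 0 1)) := by
  refine ContinuousOn.aestronglyMeasurable ?_ measurableSet_Ioc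
  exact (kernelAvg_integrand_continuousOn hkc hf).comp (f := fun σ : ℝ => (σ, q))
    (Continuous.continuousOn (by fun_prop)) fun σ hσ => ⟨hσ.1, hq⟩

theorem kernelAvg_intervalIntegrable {k : ℝ → ℝ → ℂ} {f : ℝ → ℂ} {C K q : ℝ} (hC : 0 ≤ C)
    (hkc : ContinuousOn (fun x : ℝ × ℝ => k x.1 x.2) (Ioi 0 ×ˢ Ioi 0))
    (hk : ∀ σ ∈ Ioc (0 : ℝ) 1, ∀ q, 0 < q → ‖k σ q‖ ≤ C)
    (hf : ContinuousOn f (Ioi 0)) (hq : 0 < q) (h : SingBound f q K) :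
    IntervalIntegrable (fun σ => k σ q * f (σ * q)) volume 0 1 := by
  rw [intervalIntegrable_iff_integrableOn_Ioc_of_le zero_le_one]
  have hi := (integrable_rpow_neg_half 1).const_mul (C * K * q ^ (-(1 / 2) : ℝ))
  rw [intervalIntegrable_iff_integrableOn_Ioc_of_le zero_le_one] at hi
  refine hi.mono' (kernelAvg_integrand_measurable hkc hf hq) ?_
  exact (ae_restrict_iff' measurableSet_Ioc).2
    (Eventually.of_forall fun σ hσ => h.kernelAvg_integrand hk ⟨hq, le_rfl⟩ hC hσ)

theorem kernelAvg_continuousOn {k : ℝ → ℝ → ℂ} {f : ℝ → ℂ} {C : ℝ} (hC : 0 ≤ C)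
    (hkc : ContinuousOn (fun x : ℝ × ℝ => k x.1 x.2) (Ioi 0 ×ˢ Ioi 0))
    (hk : ∀ σ ∈ Ioc (0 : ℝ) 1, ∀ q, 0 < q → ‖k σ q‖ ≤ C)
    (hf : ContinuousOn f (Ioi 0)) (h : ∀ P, 0 < P → ∃ K, SingBound f P K) :
    ContinuousOn (kernelAvg k f) (Ioi 0) := by
  intro q₀ hq₀
  have hq₀' : (0 : ℝ) < q₀ := hq₀
  refine ContinuousAt.continuousWithinAt ?_
  obtain ⟨K, hK⟩ := h (2 * q₀) (by positivity)
  have hK0 := hK.nonneg (by positivity)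
  have hnhds : ∀ᶠ q in 𝓝 q₀, q ∈ Ioo (q₀ / 2) (2 * q₀) :=
    Ioo_mem_nhds (by linarith) (by linarith)
  refine intervalIntegral.continuousAt_of_dominated_interval
    (bound := fun σ => C * K * (q₀ / 2) ^ (-(1 / 2) : ℝ) * σ ^ (-(1 / 2) : ℝ)) ?_ ?_
    ((integrable_rpow_neg_half 1).const_mul _) ?_
  · filter_upwards [hnhds] with q hq
    rw [uIoc_of_le zero_le_one]
    exact kernelAvg_integrand_measurable hkc hf (by linarith [hq.1])
  · filter_upwards [hnhds] with q hq
    refine Eventually.of_forall fun σ hσ => ?_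
    rw [uIoc_of_le zero_le_one] at hσ
    refine (hK.kernelAvg_integrand hk ⟨by linarith [hq.1], hq.2.le⟩ hC hσ).trans ?_
    have : q ^ (-(1 / 2) : ℝ) ≤ (q₀ / 2) ^ (-(1 / 2) : ℝ) :=
      Real.rpow_le_rpow_of_nonpos (by positivity) hq.1.le (by norm_num)
    have h2 : 0 ≤ σ ^ (-(1 / 2) : ℝ) := Real.rpow_nonneg hσ.1.le _
    gcongr
  · refine Eventually.of_forall fun σ hσ => ?_
    rw [uIoc_of_le zero_le_one] at hσ
    have hc := (kernelAvg_integrand_continuousOn hkc hf).continuousAt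
      ((isOpen_Ioi.prod isOpen_Ioi).mem_nhds (show (σ, q₀) ∈ Ioi 0 ×ˢ Ioi 0 from ⟨hσ.1, hq₀⟩))
    exact ContinuousAt.comp (f := fun q : ℝ => (σ, q)) hc (by fun_prop)

/-! ### Holomorphic families over the sector. -/

/-- A family of functions on `(0, ∞)` depending holomorphically on a parameter in the sector, with
an integrable singularity at `0` and a limit as the parameter tends to `0`. -/
structure HoloFamily (f : ℂ → ℝ → ℂ) : Prop where
  cont : ∀ a ∈ sector, ContinuousOn (f a) (Ioi 0)
  bdd : ∀ R P : ℝ, 0 < P → ∃ K : ℝ, ∀ a ∈ sector, ‖a‖ ≤ R → SingBound (f a) P K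
  holo : ∀ q : ℝ, 0 < q → DifferentiableOn ℂ (fun a => f a q) sector
  lim : ∀ q : ℝ, 0 < q → Tendsto (fun a => f a q) (𝓝[sector] 0) (𝓝 (f 0 q))

/-- A family of bounded kernels depending holomorphically on a parameter in the sector. -/
structure HoloKernel (k : ℂ → ℝ → ℝ → ℂ) : Prop where
  cont : ∀ a ∈ sector, ContinuousOn (fun x : ℝ × ℝ => k a x.1 x.2) (Ioi 0 ×ˢ Ioi 0)
  bdd : ∃ C : ℝ, 0 ≤ C ∧ ∀ a ∈ sector, ∀ σ ∈ Ioc (0 : ℝ) 1, ∀ q, 0 < q → ‖k a σ q‖ ≤ C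
  holo : ∀ σ ∈ Ioc (0 : ℝ) 1, ∀ q, 0 < q → DifferentiableOn ℂ (fun a => k a σ q) sector
  lim : ∀ σ ∈ Ioc (0 : ℝ) 1, ∀ q, 0 < q →
    Tendsto (fun a => k a σ q) (𝓝[sector] 0) (𝓝 (k 0 σ q))

/-- Dominated integrals over an interval preserve holomorphy in the sector and limits at `0`. -/
theorem intervalIntegral_holo_lim {F : ℂ → ℝ → ℂ} {P : ℝ} (hP : 0 ≤ P) {bound : ℝ → ℝ → ℝ}
    (hmeas : ∀ a ∈ sector, AEStronglyMeasurable (F a) (volume.restrict (Ioc 0 P)))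
    (hdiff : ∀ q ∈ Ioc 0 P, DifferentiableOn ℂ (fun a => F a q) sector)
    (hbound : ∀ R, ∀ a ∈ sector, ‖a‖ ≤ R → ∀ q ∈ Ioc 0 P, ‖F a q‖ ≤ bound R q)
    (hint : ∀ R, IntervalIntegrable (bound R) volume 0 P)
    (hlim : ∀ q ∈ Ioc 0 P, Tendsto (fun a => F a q) (𝓝[sector] 0) (𝓝 (F 0 q))) :
    DifferentiableOn ℂ (fun a => ∫ q in (0 : ℝ)..P, F a q) sector ∧
    Tendsto (fun a => ∫ q in (0 : ℝ)..P, F a q) (𝓝[sector] 0) (𝓝 (∫ q in (0 : ℝ)..P, F 0 q)) := by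
  simp_rw [intervalIntegral.integral_of_le hP]
  have hint' : ∀ R, Integrable (bound R) (volume.restrict (Ioc 0 P)) := fun R =>
    (intervalIntegrable_iff_integrableOn_Ioc_of_le hP).1 (hint R)
  constructor
  · intro a₀ ha₀
    -- The majorant is uniform only for bounded parameters, so holomorphy is checked on a bounded
    -- piece of the sector.
    set U : Set ℂ := sector ∩ Metric.ball 0 (‖a₀‖ + 1) with hU
    have hUo : IsOpen U := isOpen_sector.inter Metric.isOpen_ball
    have ha₀U : a₀ ∈ U := ⟨ha₀, by simp⟩
    have key := differentiableOn_integral_of_dominated (μ := volume.restrict (Ioc 0 P)) hUo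
      (F := F) (bound := bound (‖a₀‖ + 1)) (fun a ha => hmeas a ha.1)
      ((ae_restrict_iff' measurableSet_Ioc).2
        (Eventually.of_forall fun q hq => (hdiff q hq).mono inter_subset_left))
      ((ae_restrict_iff' measurableSet_Ioc).2
        (Eventually.of_forall fun q hq a ha => hbound _ a ha.1 (by
          have := ha.2
          rw [mem_ball_zero_iff] at this
          exact this.le) q hq)) (hint' _)
    exact ((key a₀ ha₀U).differentiableAt (hUo.mem_nhds ha₀U)).differentiableWithinAt
  · have hev : ∀ᶠ a in 𝓝[sector] (0 : ℂ), a ∈ sector ∧ ‖a‖ ≤ 1 := by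
      refine (eventually_mem_nhdsWithin).and ?_
      refine nhdsWithin_le_nhds ?_
      filter_upwards [Metric.closedBall_mem_nhds (0 : ℂ) one_pos] with a ha
      simpa using ha
    refine tendsto_integral_filter_of_dominated_convergence (bound 1) ?_ ?_ (hint' 1) ?_
    · filter_upwards [hev] with a ha using hmeas a ha.1
    · filter_upwards [hev] with a ha
      exact (ae_restrict_iff' measurableSet_Ioc).2
        (Eventually.of_forall fun q hq => hbound 1 a ha.1 ha.2 q hq)
    · exact (ae_restrict_iff' measurableSet_Ioc).2 (Eventually.of_forall hlim)

theorem HoloFamily.exists_bdd {f : ℂ → ℝ → ℂ} (hf : HoloFamily f) {a : ℂ} (ha : a ∈ sector) :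
    ∀ P, 0 < P → ∃ K, SingBound (f a) P K := fun P hP => by
  obtain ⟨K, hK⟩ := hf.bdd ‖a‖ P hP
  exact ⟨K, hK a ha le_rfl⟩

theorem HoloFamily.primitive {f : ℂ → ℝ → ℂ} (hf : HoloFamily f) :
    HoloFamily fun a => primitive (f a) := by
  have key : ∀ p : ℝ, 0 < p → DifferentiableOn ℂ (fun a => ∫ q in (0 : ℝ)..p, f a q) sector ∧
      Tendsto (fun a => ∫ q in (0 : ℝ)..p, f a q) (𝓝[sector] 0)
        (𝓝 (∫ q in (0 : ℝ)..p, f 0 q)) := by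
    intro p hp
    choose K hK using fun R => hf.bdd R p hp
    exact intervalIntegral_holo_lim hp.le (bound := fun R q => K R * q ^ (-(1 / 2) : ℝ))
      (fun a ha => ((hf.cont a ha).mono Ioc_subset_Ioi_self).aestronglyMeasurable measurableSet_Ioc)
      (fun q hq => hf.holo q hq.1) (fun R a ha haR q hq => hK R a ha haR q hq)
      (fun R => (integrable_rpow_neg_half p).const_mul _) (fun q hq => hf.lim q hq.1)
  refine ⟨fun a ha p hp => ?_, fun R P hP => ?_, fun p hp => (key p hp).1, fun p hp => (key p hp).2⟩
  · obtain ⟨K, hK⟩ := hf.exists_bdd ha p hp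
    exact (hasDerivAt_primitive (hf.cont a ha) hp hK).continuousAt.continuousWithinAt
  · obtain ⟨K, hK⟩ := hf.bdd R P hP
    exact ⟨_, fun a ha haR => (hK a ha haR).primitive hP⟩

theorem HoloFamily.kernelAvg {f : ℂ → ℝ → ℂ} (hf : HoloFamily f) {k : ℂ → ℝ → ℝ → ℂ}
    (hk : HoloKernel k) : HoloFamily fun a => kernelAvg (k a) (f a) := by
  obtain ⟨C, hC, hkC⟩ := hk.bdd
  have key : ∀ q : ℝ, 0 < q →
      DifferentiableOn ℂ (fun a => ∫ σ in (0 : ℝ)..1, k a σ q * f a (σ * q)) sector ∧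
      Tendsto (fun a => ∫ σ in (0 : ℝ)..1, k a σ q * f a (σ * q)) (𝓝[sector] 0)
        (𝓝 (∫ σ in (0 : ℝ)..1, k 0 σ q * f 0 (σ * q))) := by
    intro q hq
    choose K hK using fun R => hf.bdd R q hq
    refine intervalIntegral_holo_lim zero_le_one (F := fun a σ => k a σ q * f a (σ * q))
      (bound := fun R σ => C * K R * q ^ (-(1 / 2) : ℝ) * σ ^ (-(1 / 2) : ℝ))
      (fun a ha => kernelAvg_integrand_measurable (hk.cont a ha) (hf.cont a ha) hq)
      (fun σ hσ => (hk.holo σ hσ q hq).mul (hf.holo _ (mul_pos hσ.1 hq)))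
      (fun R a ha haR σ hσ => (hK R a ha haR).kernelAvg_integrand (hkC a ha) ⟨hq, le_rfl⟩ hC hσ)
      (fun R => (integrable_rpow_neg_half 1).const_mul _)
      (fun σ hσ => (hk.lim σ hσ q hq).mul (hf.lim _ (mul_pos hσ.1 hq)))
  refine ⟨fun a ha => ?_, fun R P hP => ?_, fun p hp => (key p hp).1, fun p hp => (key p hp).2⟩
  · exact kernelAvg_continuousOn hC (hk.cont a ha) (hkC a ha) (hf.cont a ha) (hf.exists_bdd ha)
  · obtain ⟨K, hK⟩ := hf.bdd R P hP
    exact ⟨_, fun a ha haR => (hK a ha haR).kernelAvg hC (hkC a ha)⟩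

theorem HoloFamily.add {f g : ℂ → ℝ → ℂ} (hf : HoloFamily f) (hg : HoloFamily g) :
    HoloFamily fun a q => f a q + g a q := by
  refine ⟨fun a ha => (hf.cont a ha).add (hg.cont a ha), fun R P hP => ?_,
    fun q hq => (hf.holo q hq).add (hg.holo q hq), fun q hq => (hf.lim q hq).add (hg.lim q hq)⟩
  obtain ⟨K, hK⟩ := hf.bdd R P hP
  obtain ⟨K', hK'⟩ := hg.bdd R P hP
  refine ⟨K + K', fun a ha haR q hq => ?_⟩
  rw [add_mul]
  exact (norm_add_le _ _).trans (add_le_add (hK a ha haR q hq) (hK' a ha haR q hq))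

/-- Multiplication of a family by a locally bounded holomorphic family of multipliers. -/
theorem HoloFamily.mul {f m : ℂ → ℝ → ℂ} (hf : HoloFamily f)
    (hcont : ∀ a ∈ sector, ContinuousOn (m a) (Ioi 0))
    (hbdd : ∀ R P : ℝ, 0 < P → ∃ K : ℝ, ∀ a ∈ sector, ‖a‖ ≤ R → ∀ q ∈ Ioc 0 P, ‖m a q‖ ≤ K)
    (hholo : ∀ q : ℝ, 0 < q → DifferentiableOn ℂ (fun a => m a q) sector)
    (hlim : ∀ q : ℝ, 0 < q → Tendsto (fun a => m a q) (𝓝[sector] 0) (𝓝 (m 0 q))) :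
    HoloFamily fun a q => m a q * f a q := by
  refine ⟨fun a ha => (hcont a ha).mul (hf.cont a ha), fun R P hP => ?_,
    fun q hq => (hholo q hq).mul (hf.holo q hq), fun q hq => (hlim q hq).mul (hf.lim q hq)⟩
  obtain ⟨K, hK⟩ := hf.bdd R P hP
  obtain ⟨K', hK'⟩ := hbdd R P hP
  refine ⟨K' * K, fun a ha haR q hq => ?_⟩
  rw [norm_mul, mul_assoc]
  have h1 := hK' a ha haR q hq
  exact mul_le_mul h1 (hK a ha haR q hq) (norm_nonneg _) ((norm_nonneg _).trans h1)

theorem HoloFamily.const_mul {f : ℂ → ℝ → ℂ} (hf : HoloFamily f) (c : ℂ) :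
    HoloFamily fun a q => c * f a q :=
  hf.mul (m := fun _ _ => c) (fun _ _ => continuousOn_const)
    (fun _ _ _ => ⟨‖c‖, fun _ _ _ _ _ => le_rfl⟩) (fun _ _ => differentiableOn_const c)
    (fun _ _ => tendsto_const_nhds)

/-- A family that does not depend on the parameter. -/
theorem HoloFamily.of_const {f : ℝ → ℂ} (hf : ContinuousOn f (Ioi 0))
    (h : ∀ P, 0 < P → ∃ K, SingBound f P K) : HoloFamily fun _ => f :=
  ⟨fun _ _ => hf, fun _ P hP => (h P hP).imp fun _ hK _ _ _ => hK,
    fun _ _ => differentiableOn_const _, fun _ _ => tendsto_const_nhds⟩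

theorem singBound_of_norm_le {f : ℝ → ℂ} {P K : ℝ}
    (h : ∀ q ∈ Ioc 0 P, ‖f q‖ ≤ K) : SingBound f P (K * P ^ (1 / 2 : ℝ)) := by
  intro q hq
  have hK : 0 ≤ K := (norm_nonneg _).trans (h q hq)
  refine (h q hq).trans ?_
  have h1 : 1 ≤ P ^ (1 / 2 : ℝ) * q ^ (-(1 / 2) : ℝ) := by
    have h2 : q ^ (1 / 2 : ℝ) * q ^ (-(1 / 2) : ℝ) = 1 := by
      rw [← Real.rpow_add hq.1]; norm_num
    calc (1 : ℝ) = q ^ (1 / 2 : ℝ) * q ^ (-(1 / 2) : ℝ) := h2.symm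
      _ ≤ _ := mul_le_mul_of_nonneg_right (Real.rpow_le_rpow hq.1.le hq.2 (by norm_num))
        (Real.rpow_nonneg hq.1.le _)
  nlinarith

/-! ### The Volterra operator. -/

/-- The integrand of the Volterra operator. -/
noncomputable def volterraIntegrand (l : ℕ) (a : ℂ) (f : ℝ → ℂ) (q : ℝ) : ℂ :=
  q / (q + a) * f q - kernelAvg (fun σ q => volterraKernel l σ q a) f q

/-- The Volterra operator. -/
noncomputable def volterraOp (l : ℕ) (a : ℂ) (f : ℝ → ℂ) : ℝ → ℂ :=
  primitive (volterraIntegrand l a f)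

/-- The Neumann series of the Volterra operator. -/
noncomputable def volterraResolvent (l : ℕ) (a : ℂ) (g : ℝ → ℂ) (p : ℝ) : ℂ :=
  ∑' n : ℕ, (volterraOp l a)^[n] g p

/-- The weight `e ^ (λ q) (1 + q) ^ m`. -/
noncomputable def expWeight (lam : ℝ) (m : ℕ) (q : ℝ) : ℝ := Real.exp (lam * q) * (1 + q) ^ m

theorem volterraKernel_continuousOn_Ioi (l : ℕ) {a : ℂ} (ha : a ∈ closedSector) :
    ContinuousOn (fun x : ℝ × ℝ => volterraKernel l x.1 x.2 a) (Ioi 0 ×ˢ Ioi 0) :=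
  (volterraKernel_continuousOn l ha).mono (prod_mono (subset_univ _) subset_rfl)

theorem norm_div_add_le {a : ℂ} (ha : a ∈ closedSector) {q : ℝ} (hq : 0 < q) :
    ‖(q : ℂ) / (q + a)‖ ≤ 2 := by
  have h1 := norm_add_ge ha hq.le
  have h2 := norm_nonneg a
  rw [norm_div, Complex.norm_real, Real.norm_of_nonneg hq.le, div_le_iff₀ (by linarith)]
  linarith

/-- Write q/(q+a) = 1 - a/(q+a). The leading constant 1, with an error O(1/(1+q)), is what allows
growth rates arbitrarily close to 1; the cruder bound by 2 would not. -/
theorem norm_div_add_le' {a : ℂ} (ha : a ∈ closedSector) {q R : ℝ} (hq : 0 < q) (haR : ‖a‖ ≤ R) :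
    ‖(q : ℂ) / (q + a)‖ ≤ 1 + 2 * (1 + R) / (1 + q) := by
  have h1 := norm_add_ge ha hq.le
  have h2 := norm_nonneg a
  have h3 : (q : ℂ) / (q + a) = 1 - a / (q + a) := by
    rw [eq_sub_iff_add_eq, ← add_div, div_self (add_ne_zero_of_mem ha hq)]
  rw [h3]
  refine (norm_sub_le _ _).trans ?_
  rw [norm_one, norm_div]
  refine add_le_add le_rfl ?_
  rw [div_le_div_iff₀ (by linarith) (by linarith)]
  nlinarith

theorem continuousOn_div_add {a : ℂ} (ha : a ∈ closedSector) :
    ContinuousOn (fun q : ℝ => (q : ℂ) / (q + a)) (Ioi 0) :=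
  ContinuousOn.div (Continuous.continuousOn (by fun_prop)) (Continuous.continuousOn (by fun_prop))
    fun _ hq => add_ne_zero_of_mem ha hq

theorem volterraIntegrand_continuousOn (l : ℕ) {a : ℂ} (ha : a ∈ closedSector) {f : ℝ → ℂ}
    (hf : ContinuousOn f (Ioi 0)) (h : ∀ P, 0 < P → ∃ K, SingBound f P K) :
    ContinuousOn (volterraIntegrand l a f) (Ioi 0) := by
  obtain ⟨C, hC, hk⟩ := volterraKernel_bound l
  exact ((continuousOn_div_add ha).mul hf).sub (kernelAvg_continuousOn hC.le
    (volterraKernel_continuousOn_Ioi l ha)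
    (fun σ hσ q hq => hk σ q a (Ioc_subset_Icc_self hσ) hq ha) hf h)

theorem volterraIntegrand_singBound (l : ℕ) : ∃ C : ℝ, 0 < C ∧ ∀ a ∈ closedSector,
    ∀ (f : ℝ → ℂ) (P K : ℝ), SingBound f P K → SingBound (volterraIntegrand l a f) P (C * K) := by
  obtain ⟨C, hC, hk⟩ := volterraKernel_bound l
  refine ⟨2 + 2 * C, by positivity, fun a ha f P K h q hq => ?_⟩
  have h1 := h.kernelAvg (k := fun σ q => volterraKernel l σ q a) hC.le
    (fun σ hσ q hq => hk σ q a (Ioc_subset_Icc_self hσ) hq ha) q hq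
  have h2 := h q hq
  have h3 := norm_div_add_le ha hq.1
  calc _ ≤ ‖(q : ℂ) / (q + a) * f q‖ + ‖kernelAvg (fun σ q => volterraKernel l σ q a) f q‖ :=
        norm_sub_le _ _
    _ ≤ 2 * (K * q ^ (-(1 / 2) : ℝ)) + 2 * C * K * q ^ (-(1 / 2) : ℝ) := by
        rw [norm_mul]
        gcongr
    _ = _ := by ring

theorem volterraIntegrand_singBound' {l : ℕ} {a : ℂ} (ha : a ∈ closedSector) {f : ℝ → ℂ}
    (h : ∀ P, 0 < P → ∃ K, SingBound f P K) :
    ∀ P, 0 < P → ∃ K, SingBound (volterraIntegrand l a f) P K := by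
  obtain ⟨C, _, hC⟩ := volterraIntegrand_singBound l
  intro P hP
  obtain ⟨K, hK⟩ := h P hP
  exact ⟨_, hC a ha f P K hK⟩

theorem volterraOp_hasDerivAt (l : ℕ) {a : ℂ} (ha : a ∈ closedSector) {f : ℝ → ℂ}
    (hf : ContinuousOn f (Ioi 0)) (h : ∀ P, 0 < P → ∃ K, SingBound f P K) {p : ℝ} (hp : 0 < p) :
    HasDerivAt (volterraOp l a f) (volterraIntegrand l a f p) p := by
  obtain ⟨K, hK⟩ := volterraIntegrand_singBound' (l := l) ha h p hp
  exact hasDerivAt_primitive (volterraIntegrand_continuousOn l ha hf h) hp hK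

theorem volterraOp_continuousOn (l : ℕ) {a : ℂ} (ha : a ∈ closedSector) {f : ℝ → ℂ}
    (hf : ContinuousOn f (Ioi 0)) (h : ∀ P, 0 < P → ∃ K, SingBound f P K) :
    ContinuousOn (volterraOp l a f) (Ioi 0) := fun _ hp =>
  (volterraOp_hasDerivAt l ha hf h hp).continuousAt.continuousWithinAt

theorem volterraIntegrand_add_smul (l : ℕ) {a : ℂ} (ha : a ∈ closedSector) {f g : ℝ → ℂ} (c : ℂ)
    (hf : ContinuousOn f (Ioi 0)) (hfb : ∀ P, 0 < P → ∃ K, SingBound f P K)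
    (hg : ContinuousOn g (Ioi 0)) (hgb : ∀ P, 0 < P → ∃ K, SingBound g P K)
    {q : ℝ} (hq : 0 < q) :
    volterraIntegrand l a (fun q => f q + c * g q) q =
      volterraIntegrand l a f q + c * volterraIntegrand l a g q := by
  obtain ⟨C, hC, hk⟩ := volterraKernel_bound l
  have hkc := volterraKernel_continuousOn_Ioi l ha
  have hk' : ∀ σ ∈ Ioc (0 : ℝ) 1, ∀ q, 0 < q → ‖volterraKernel l σ q a‖ ≤ C :=
    fun σ hσ q hq => hk σ q a (Ioc_subset_Icc_self hσ) hq ha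
  obtain ⟨K, hK⟩ := hfb q hq
  obtain ⟨K', hK'⟩ := hgb q hq
  have i1 := kernelAvg_intervalIntegrable hC.le hkc hk' hf hq hK
  have i2 := kernelAvg_intervalIntegrable hC.le hkc hk' hg hq hK'
  unfold volterraIntegrand kernelAvg
  have : ∀ σ : ℝ, volterraKernel l σ q a * (f (σ * q) + c * g (σ * q)) =
      volterraKernel l σ q a * f (σ * q) + c * (volterraKernel l σ q a * g (σ * q)) :=
    fun σ => by ring
  simp_rw [this]
  rw [intervalIntegral.integral_add i1 (i2.const_mul c), intervalIntegral.integral_const_mul]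
  ring

theorem volterraOp_add_smul (l : ℕ) {a : ℂ} (ha : a ∈ closedSector) {f g : ℝ → ℂ} (c : ℂ)
    (hf : ContinuousOn f (Ioi 0)) (hfb : ∀ P, 0 < P → ∃ K, SingBound f P K)
    (hg : ContinuousOn g (Ioi 0)) (hgb : ∀ P, 0 < P → ∃ K, SingBound g P K)
    {p : ℝ} (hp : 0 < p) :
    volterraOp l a (fun q => f q + c * g q) p = volterraOp l a f p + c * volterraOp l a g p := by
  obtain ⟨K, hK⟩ := volterraIntegrand_singBound' (l := l) ha hfb p hp
  obtain ⟨K', hK'⟩ := volterraIntegrand_singBound' (l := l) ha hgb p hp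
  have i1 := hK.intervalIntegrable (volterraIntegrand_continuousOn l ha hf hfb) hp.le
  have i2 := hK'.intervalIntegrable (volterraIntegrand_continuousOn l ha hg hgb) hp.le
  unfold volterraOp primitive
  rw [← intervalIntegral.integral_const_mul, ← intervalIntegral.integral_add i1 (i2.const_mul c)]
  refine intervalIntegral.integral_congr_ae (Eventually.of_forall fun q hq => ?_)
  rw [uIoc_of_le hp.le] at hq
  exact volterraIntegrand_add_smul l ha c hf hfb hg hgb hq.1

theorem volterraIntegrand_one (l : ℕ) {a : ℂ} (ha : a ∈ closedSector) {q : ℝ} (hq : 0 < q) :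
    volterraIntegrand l a (fun _ => 1) q = q / (q + a) / 2 := by
  unfold volterraIntegrand kernelAvg
  simp only [mul_one]
  rw [volterraKernel_integral l hq ha]
  ring

/-! ### Exponential weights and the contraction estimate. -/

theorem expWeight_pos (lam : ℝ) (m : ℕ) {q : ℝ} (hq : 0 ≤ q) : 0 < expWeight lam m q := by
  unfold expWeight
  positivity

theorem expWeight_mono {lam : ℝ} (hlam : 0 ≤ lam) (m : ℕ) {p q : ℝ} (hp : 0 ≤ p) (hpq : p ≤ q) :
    expWeight lam m p ≤ expWeight lam m q := by
  unfold expWeight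
  gcongr

theorem exp_le_expWeight (lam : ℝ) (m : ℕ) {q : ℝ} (hq : 0 ≤ q) :
    Real.exp (lam * q) ≤ expWeight lam m q := by
  unfold expWeight
  have : (1 : ℝ) ≤ (1 + q) ^ m := one_le_pow₀ (by linarith)
  have h := Real.exp_pos (lam * q)
  nlinarith

theorem one_add_pow_le_exp {δ : ℝ} (hδ : 0 < δ) (m : ℕ) : ∃ C : ℝ, 0 < C ∧ ∀ q : ℝ, 0 ≤ q →
    (1 + q) ^ m ≤ C * Real.exp (δ * q) := by
  refine ⟨m.factorial * Real.exp δ / δ ^ m, by positivity, fun q hq => ?_⟩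
  have h := Real.pow_div_factorial_le_exp (δ * (1 + q)) (by positivity) m
  rw [div_le_iff₀ (by positivity), mul_pow, mul_add, mul_one, Real.exp_add] at h
  rw [div_mul_eq_mul_div, le_div_iff₀ (by positivity)]
  nlinarith

theorem expWeight_le_exp {lam lam' : ℝ} (h : lam < lam') (m : ℕ) : ∃ C : ℝ, 0 < C ∧
    ∀ q : ℝ, 0 ≤ q → expWeight lam m q ≤ C * Real.exp (lam' * q) := by
  obtain ⟨C, hC, hb⟩ := one_add_pow_le_exp (sub_pos.2 h) m
  refine ⟨C, hC, fun q hq => ?_⟩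
  unfold expWeight
  calc _ ≤ Real.exp (lam * q) * (C * Real.exp ((lam' - lam) * q)) := by
        gcongr
        exact hb q hq
    _ = C * Real.exp (lam' * q) := by
        rw [mul_left_comm, ← Real.exp_add]
        ring_nf

theorem expWeight_hasDerivAt (lam : ℝ) (m : ℕ) {q : ℝ} (hq : 0 ≤ q) :
    HasDerivAt (expWeight lam m) ((lam + m / (1 + q)) * expWeight lam m q) q := by
  have h1 : HasDerivAt (fun q : ℝ => Real.exp (lam * q)) (Real.exp (lam * q) * lam) q := by
    simpa using ((hasDerivAt_id q).const_mul lam).exp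
  have h2 : HasDerivAt (fun q : ℝ => (1 + q) ^ m) (m * (1 + q) ^ (m - 1)) q := by
    simpa using ((hasDerivAt_id q).const_add 1).fun_pow m
  refine (h1.mul h2).congr_deriv ?_
  unfold expWeight
  rcases m with _ | m
  · simp [mul_comm]
  · have : 1 + q ≠ 0 := by linarith
    rw [Nat.add_sub_cancel, pow_succ]
    field_simp

theorem integral_exp_le {q : ℝ} (hq : 0 < q) :
    ∫ σ in (0 : ℝ)..1, Real.exp (-(q * (1 - σ))) ≤ 2 / (1 + q) := by
  have hder : ∀ σ ∈ uIcc (0 : ℝ) 1, HasDerivAt (fun σ : ℝ => Real.exp (-(q * (1 - σ))) / q)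
      (Real.exp (-(q * (1 - σ)))) σ := by
    intro σ _
    have h1 : HasDerivAt (fun σ : ℝ => -(q * (1 - σ))) q σ := by
      simpa using (((hasDerivAt_id σ).const_sub 1).const_mul q).fun_neg
    refine (h1.exp.div_const q).congr_deriv ?_
    field_simp
  rw [intervalIntegral.integral_eq_sub_of_hasDerivAt hder
    (Continuous.intervalIntegrable (by fun_prop) _ _)]
  have h1 := Real.add_one_le_exp (-q)
  have h2 := Real.exp_pos (-q)
  simp only [sub_self, mul_zero, neg_zero, Real.exp_zero, sub_zero, mul_one]
  rw [← sub_div, div_le_div_iff₀ hq (by linarith)]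
  -- For q ≤ 1 use 1 - e^{-q} ≤ q, for q ≥ 1 use 1 - e^{-q} ≤ 1.
  rcases le_total q 1 with h | h <;> nlinarith

/-- The multiplier q/(q+a) contributes 1 + O(1/(1+q)). The average only sees f on (0, q), where the
weight is smaller by a factor e^{-q(1-σ)}, and integrating that factor in σ gains 1/(1+q). -/
theorem volterraIntegrand_weight_le (l : ℕ) (R : ℝ) : ∃ D : ℝ, 0 < D ∧
    ∀ (lam : ℝ) (m : ℕ), 1 ≤ lam → ∀ a ∈ closedSector, ‖a‖ ≤ R → ∀ (f : ℝ → ℂ) (K : ℝ), 0 ≤ K →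
      (∀ q, 0 < q → ‖f q‖ ≤ K * expWeight lam m q) → ∀ q, 0 < q →
      ‖volterraIntegrand l a f q‖ ≤ K * ((1 + D / (1 + q)) * expWeight lam m q) := by
  obtain ⟨C, hC, hk⟩ := volterraKernel_bound l
  refine ⟨2 * (1 + |R|) + 2 * C, by positivity, fun lam m hlam a ha haR f K hK hf q hq => ?_⟩
  have hW := expWeight_pos lam m hq.le
  have h1 := norm_div_add_le' ha hq (haR.trans (le_abs_self R))
  have h2 : ‖kernelAvg (fun σ q => volterraKernel l σ q a) f q‖ ≤
      C * K * expWeight lam m q * (2 / (1 + q)) := by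
    refine le_trans ?_ (mul_le_mul_of_nonneg_left (integral_exp_le hq) (by positivity))
    rw [← intervalIntegral.integral_const_mul]
    refine intervalIntegral.norm_integral_le_of_norm_le zero_le_one
      (Eventually.of_forall fun σ hσ => ?_) (Continuous.intervalIntegrable (by fun_prop) _ _)
    rw [norm_mul]
    have hσq : 0 < σ * q := mul_pos hσ.1 hq
    -- This is where λ ≥ 1 enters: λσq ≤ λq - q(1-σ).
    have h3 : expWeight lam m (σ * q) ≤ expWeight lam m q * Real.exp (-(q * (1 - σ))) := by
      unfold expWeight
      rw [mul_right_comm, ← Real.exp_add]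
      have hσ' : 0 ≤ 1 - σ := by linarith [hσ.2]
      gcongr ?_ * (1 + ?_) ^ m
      · refine Real.exp_le_exp.2 ?_
        nlinarith [mul_nonneg (mul_nonneg (sub_nonneg.2 hlam) hq.le) hσ']
      · nlinarith [hσ.2]
    calc _ ≤ C * (K * expWeight lam m (σ * q)) :=
          mul_le_mul (hk σ q a (Ioc_subset_Icc_self hσ) hq ha) (hf _ hσq) (norm_nonneg _) hC.le
      _ ≤ C * (K * (expWeight lam m q * Real.exp (-(q * (1 - σ))))) := by gcongr
      _ = _ := by ring
  calc _ ≤ ‖(q : ℂ) / (q + a) * f q‖ + ‖kernelAvg (fun σ q => volterraKernel l σ q a) f q‖ :=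
        norm_sub_le _ _
    _ ≤ (1 + 2 * (1 + |R|) / (1 + q)) * (K * expWeight lam m q) +
        C * K * expWeight lam m q * (2 / (1 + q)) := by
        rw [norm_mul]
        refine add_le_add (mul_le_mul h1 (hf q hq) (norm_nonneg _) ?_) h2
        exact (norm_nonneg _).trans h1
    _ = _ := by ring

/-- For a suitable weight the Volterra operator is a contraction, uniformly for bounded
parameters. -/
theorem volterraOp_contraction (l : ℕ) (R : ℝ) {lam : ℝ} (hlam : 1 < lam) : ∃ m : ℕ,
    ∀ a ∈ closedSector, ‖a‖ ≤ R → ∀ (f : ℝ → ℂ) (K : ℝ), 0 ≤ K →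
      (∀ q, 0 < q → ‖f q‖ ≤ K * expWeight lam m q) → ∀ p, 0 < p →
      ‖volterraOp l a f p‖ ≤ K * lam⁻¹ * expWeight lam m p := by
  obtain ⟨D, hD, hb⟩ := volterraIntegrand_weight_le l R
  have hl0 : 0 < lam := by linarith
  -- The weight W satisfies W' = (λ + m/(1+q)) W. With m ≥ λD this dominates λ (1 + D/(1+q)) W, so
  -- the integrand is at most λ^{-1} K W' and integration gives the factor λ^{-1}.
  obtain ⟨m, hm⟩ := exists_nat_ge (lam * D)
  refine ⟨m, fun a ha haR f K hK hf p hp => ?_⟩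
  have hder : ∀ q ∈ uIcc 0 p, HasDerivAt (fun q => K * lam⁻¹ * expWeight lam m q)
      (K * lam⁻¹ * ((lam + m / (1 + q)) * expWeight lam m q)) q := by
    intro q hq
    rw [uIcc_of_le hp.le] at hq
    exact (expWeight_hasDerivAt lam m hq.1).const_mul _
  have hcont : ContinuousOn (fun q => K * lam⁻¹ * ((lam + m / (1 + q)) * expWeight lam m q))
      (uIcc 0 p) := by
    rw [uIcc_of_le hp.le]
    refine continuousOn_const.mul (ContinuousOn.mul (continuousOn_const.add
      (continuousOn_const.div (Continuous.continuousOn (by fun_prop)) fun q hq => ?_)) ?_)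
    · have := hq.1
      linarith
    · exact fun q hq => (expWeight_hasDerivAt lam m hq.1).continuousAt.continuousWithinAt
  have key : ‖volterraOp l a f p‖ ≤
      ∫ q in (0 : ℝ)..p, K * lam⁻¹ * ((lam + m / (1 + q)) * expWeight lam m q) := by
    refine intervalIntegral.norm_integral_le_of_norm_le hp.le
      (Eventually.of_forall fun q hq => ?_) hcont.intervalIntegrable
    refine (hb lam m hlam.le a ha haR f K hK hf q hq.1).trans ?_
    rw [mul_assoc]
    refine mul_le_mul_of_nonneg_left ?_ hK
    rw [← mul_assoc]
    refine mul_le_mul_of_nonneg_right ?_ (expWeight_pos lam m hq.1.le).le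
    rw [mul_add, inv_mul_cancel₀ hl0.ne', inv_mul_eq_div, div_div, add_le_add_iff_left]
    have : 0 < 1 + q := by linarith [hq.1]
    rw [div_le_div_iff₀ this (by positivity)]
    nlinarith
  rw [intervalIntegral.integral_eq_sub_of_hasDerivAt hder hcont.intervalIntegrable] at key
  have : 0 ≤ K * lam⁻¹ * expWeight lam m 0 := by
    have := expWeight_pos lam m le_rfl
    positivity
  linarith

theorem volterraOp_congr (l : ℕ) (a : ℂ) {f g : ℝ → ℂ} (h : ∀ q, 0 < q → f q = g q) {p : ℝ}
    (hp : 0 < p) : volterraOp l a f p = volterraOp l a g p := by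
  unfold volterraOp primitive
  refine intervalIntegral.integral_congr_ae (Eventually.of_forall fun q hq => ?_)
  rw [uIoc_of_le hp.le] at hq
  unfold volterraIntegrand kernelAvg
  rw [h q hq.1]
  congr 1
  refine intervalIntegral.integral_congr_ae (Eventually.of_forall fun σ hσ => ?_)
  rw [uIoc_of_le zero_le_one] at hσ
  rw [h _ (mul_pos hσ.1 hq.1)]

theorem singBound_of_expWeight {f : ℝ → ℂ} {K lam : ℝ} {m : ℕ} (hlam : 0 ≤ lam) (hK : 0 ≤ K)
    (hf : ∀ q, 0 < q → ‖f q‖ ≤ K * expWeight lam m q) : ∀ P, 0 < P → ∃ K', SingBound f P K' :=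
  fun P _ => ⟨_, singBound_of_norm_le (K := K * expWeight lam m P) fun q hq =>
    (hf q hq.1).trans (mul_le_mul_of_nonneg_left (expWeight_mono hlam m hq.1.le hq.2) hK)⟩

/-! ### The Neumann series. -/

section Resolvent

variable {l : ℕ} {R lam : ℝ} {m : ℕ} {a : ℂ} {g : ℝ → ℂ} {K : ℝ}

/-- The contraction property of the Volterra operator for the weight `expWeight lam m`. -/
def VolterraContraction (l : ℕ) (R lam : ℝ) (m : ℕ) : Prop :=
  ∀ a ∈ closedSector, ‖a‖ ≤ R → ∀ (f : ℝ → ℂ) (K : ℝ), 0 ≤ K →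
    (∀ q, 0 < q → ‖f q‖ ≤ K * expWeight lam m q) → ∀ p, 0 < p →
    ‖volterraOp l a f p‖ ≤ K * lam⁻¹ * expWeight lam m p

theorem VolterraContraction.iterate (hm : VolterraContraction l R lam m) (hlam : 1 < lam)
    (ha : a ∈ closedSector) (haR : ‖a‖ ≤ R) (hg : ContinuousOn g (Ioi 0)) (hK : 0 ≤ K)
    (hgK : ∀ q, 0 < q → ‖g q‖ ≤ K * expWeight lam m q) (n : ℕ) :
    ContinuousOn ((volterraOp l a)^[n] g) (Ioi 0) ∧
    ∀ q, 0 < q → ‖(volterraOp l a)^[n] g q‖ ≤ K * lam⁻¹ ^ n * expWeight lam m q := by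
  induction n with
  | zero => exact ⟨hg, by simpa using hgK⟩
  | succ n ih =>
    have hK' : 0 ≤ K * lam⁻¹ ^ n := by positivity
    rw [Function.iterate_succ_apply']
    refine ⟨volterraOp_continuousOn l ha ih.1
      (singBound_of_expWeight (by linarith) hK' ih.2), fun q hq => ?_⟩
    refine (hm a ha haR _ _ hK' ih.2 q hq).trans (le_of_eq ?_)
    ring

theorem summable_inv_pow (hlam : 1 < lam) (c d : ℝ) : Summable fun n : ℕ => c * lam⁻¹ ^ n * d :=
  ((summable_geometric_of_lt_one (by positivity) (inv_lt_one_of_one_lt₀ hlam)).mul_left c).mul_right d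

theorem VolterraContraction.resolvent_le (hm : VolterraContraction l R lam m) (hlam : 1 < lam)
    (ha : a ∈ closedSector) (haR : ‖a‖ ≤ R) (hg : ContinuousOn g (Ioi 0)) (hK : 0 ≤ K)
    (hgK : ∀ q, 0 < q → ‖g q‖ ≤ K * expWeight lam m q) {q : ℝ} (hq : 0 < q) :
    ‖volterraResolvent l a g q‖ ≤ K * (1 - lam⁻¹)⁻¹ * expWeight lam m q := by
  have h1 := summable_inv_pow hlam K (expWeight lam m q)
  refine (tsum_of_norm_bounded h1.hasSum
    fun n => (hm.iterate hlam ha haR hg hK hgK n).2 q hq).trans (le_of_eq ?_)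
  rw [tsum_mul_right, tsum_mul_left, tsum_geometric_of_lt_one (by positivity)
    (inv_lt_one_of_one_lt₀ hlam)]

theorem VolterraContraction.resolvent_continuousOn (hm : VolterraContraction l R lam m)
    (hlam : 1 < lam) (ha : a ∈ closedSector) (haR : ‖a‖ ≤ R) (hg : ContinuousOn g (Ioi 0))
    (hK : 0 ≤ K) (hgK : ∀ q, 0 < q → ‖g q‖ ≤ K * expWeight lam m q) :
    ContinuousOn (volterraResolvent l a g) (Ioi 0) := by
  intro q₀ hq₀
  have hq₀' : (0 : ℝ) < q₀ := hq₀
  have h1 : ContinuousOn (volterraResolvent l a g) (Ioo 0 (q₀ + 1)) := by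
    refine continuousOn_tsum (fun n => ((hm.iterate hlam ha haR hg hK hgK n).1.mono
      fun q hq => hq.1)) (summable_inv_pow hlam K (expWeight lam m (q₀ + 1))) fun n q hq => ?_
    refine ((hm.iterate hlam ha haR hg hK hgK n).2 q hq.1).trans ?_
    have := expWeight_mono (by linarith : 0 ≤ lam) m hq.1.le hq.2.le
    gcongr
  exact (h1.continuousAt (Ioo_mem_nhds hq₀' (by linarith))).continuousWithinAt

/-- No interchange of the series with the operator is needed. Let S_N be the partial sums and v_N
the Neumann series of A^N g; then v = S_N + v_N and S_{N+1} = g + A S_N, so the defect v - g - Av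
equals v_{N+1} - A v_N, which is O(λ^{-N}). -/
theorem VolterraContraction.resolvent_eq (hm : VolterraContraction l R lam m) (hlam : 1 < lam)
    (ha : a ∈ closedSector) (haR : ‖a‖ ≤ R) (hg : ContinuousOn g (Ioi 0)) (hK : 0 ≤ K)
    (hgK : ∀ q, 0 < q → ‖g q‖ ≤ K * expWeight lam m q) {p : ℝ} (hp : 0 < p) :
    volterraResolvent l a g p = g p + volterraOp l a (volterraResolvent l a g) p := by
  have hlam0 : 0 ≤ lam := by linarith
  have hit := hm.iterate hlam ha haR hg hK hgK
  set S : ℕ → ℝ → ℂ := fun N q => ∑ n ∈ Finset.range N, (volterraOp l a)^[n] g q with hS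
  have hScont : ∀ N, ContinuousOn (S N) (Ioi 0) := fun N =>
    continuousOn_finsetSum _ fun n _ => (hit n).1
  have hSb : ∀ N, ∀ q, 0 < q → ‖S N q‖ ≤
      (∑ n ∈ Finset.range N, K * lam⁻¹ ^ n) * expWeight lam m q := by
    intro N q hq
    rw [Finset.sum_mul]
    exact norm_sum_le_of_le _ fun n _ => (hit n).2 q hq
  have hSs : ∀ N, ∀ P, 0 < P → ∃ K', SingBound (S N) P K' := fun N =>
    singBound_of_expWeight hlam0 (by positivity) (hSb N)
  have hits : ∀ n, ∀ P, 0 < P → ∃ K', SingBound ((volterraOp l a)^[n] g) P K' := fun n =>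
    singBound_of_expWeight hlam0 (by positivity) (hit n).2
  have hSA : ∀ N, ∀ q, 0 < q → S (N + 1) q = g q + volterraOp l a (S N) q := by
    intro N
    induction N with
    | zero =>
      intro q hq
      simp [hS, volterraOp, primitive, volterraIntegrand, kernelAvg]
    | succ N ih =>
      intro q hq
      have h1 : S (N + 1) = fun q => S N q + 1 * (volterraOp l a)^[N] g q := by
        funext q
        rw [hS]
        simp only [Finset.sum_range_succ, one_mul]
      rw [h1, volterraOp_add_smul l ha 1 (hScont N) (hSs N) (hit N).1 (hits N) hq, ← add_assoc,
        ← ih q hq, one_mul, ← Function.iterate_succ_apply' (volterraOp l a)]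
      exact Finset.sum_range_succ _ _
  have hsum : ∀ q, 0 < q → Summable fun n => (volterraOp l a)^[n] g q := fun q hq =>
    Summable.of_norm_bounded (summable_inv_pow hlam K _) fun n => (hit n).2 q hq
  have hsplit : ∀ N, ∀ q, 0 < q → volterraResolvent l a g q =
      S N q + 1 * volterraResolvent l a ((volterraOp l a)^[N] g) q := by
    intro N q hq
    rw [one_mul, volterraResolvent, ← (hsum q hq).sum_add_tsum_nat_add N]
    simp only [hS, volterraResolvent, ← Function.iterate_add_apply]
  have hrb : ∀ N, ∀ q, 0 < q → ‖volterraResolvent l a ((volterraOp l a)^[N] g) q‖ ≤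
      (K * lam⁻¹ ^ N * (1 - lam⁻¹)⁻¹) * expWeight lam m q := fun N q hq =>
    hm.resolvent_le hlam ha haR (hit N).1 (by positivity) (hit N).2 hq
  have hlam1 : lam⁻¹ < 1 := inv_lt_one_of_one_lt₀ hlam
  have hinv : 0 ≤ (1 - lam⁻¹)⁻¹ := inv_nonneg.2 (by linarith)
  have hrest : ∀ N : ℕ, ‖volterraResolvent l a g p -
      (g p + volterraOp l a (volterraResolvent l a g) p)‖ ≤
      2 * (K * lam⁻¹ ^ N * (1 - lam⁻¹)⁻¹ * expWeight lam m p) := by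
    intro N
    have hrc := hm.resolvent_continuousOn hlam ha haR (hit N).1 (by positivity) (hit N).2
    have hrs := singBound_of_expWeight hlam0 (by positivity) (hrb N)
    rw [volterraOp_congr l a (hsplit N) hp,
      volterraOp_add_smul l ha 1 (hScont N) (hSs N) hrc hrs hp, ← add_assoc, ← hSA N p hp,
      hsplit (N + 1) p hp, one_mul, one_mul, add_sub_add_left_eq_sub]
    have hA := hm a ha haR _ _ (by positivity) (hrb N) p hp
    have hB := hrb (N + 1) p hp
    have hW := expWeight_pos lam m hp.le
    have hX : 0 ≤ K * lam⁻¹ ^ N * (1 - lam⁻¹)⁻¹ * expWeight lam m p := by positivity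
    have e1 : K * lam⁻¹ ^ N * (1 - lam⁻¹)⁻¹ * lam⁻¹ * expWeight lam m p =
        lam⁻¹ * (K * lam⁻¹ ^ N * (1 - lam⁻¹)⁻¹ * expWeight lam m p) := by ring
    have e2 : K * lam⁻¹ ^ (N + 1) * (1 - lam⁻¹)⁻¹ * expWeight lam m p =
        lam⁻¹ * (K * lam⁻¹ ^ N * (1 - lam⁻¹)⁻¹ * expWeight lam m p) := by ring
    rw [e1] at hA
    rw [e2] at hB
    refine (norm_sub_le _ _).trans ?_
    nlinarith
  have hlim : Tendsto (fun N : ℕ => 2 * (K * lam⁻¹ ^ N * (1 - lam⁻¹)⁻¹ * expWeight lam m p))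
      atTop (𝓝 0) := by
    have := (((((tendsto_pow_atTop_nhds_zero_of_lt_one (inv_nonneg.2 hlam0) hlam1).const_mul
      K).mul_const (1 - lam⁻¹)⁻¹).mul_const (expWeight lam m p)).const_mul 2)
    simpa using this
  have := ge_of_tendsto hlim (Eventually.of_forall hrest)
  exact sub_eq_zero.1 (norm_le_zero_iff.1 this)

/-- Each substitution of the fixed point equation into itself improves the weighted bound by λ^{-1}.
-/
theorem VolterraContraction.eq_zero (hm : VolterraContraction l R lam m) (hlam : 1 < lam)
    (ha : a ∈ closedSector) (haR : ‖a‖ ≤ R) (hK : 0 ≤ K)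
    (hgK : ∀ q, 0 < q → ‖g q‖ ≤ K * expWeight lam m q)
    (hgA : ∀ q, 0 < q → g q = volterraOp l a g q) {p : ℝ} (hp : 0 < p) : g p = 0 := by
  have hlam1 : lam⁻¹ < 1 := inv_lt_one_of_one_lt₀ hlam
  have hn : ∀ n : ℕ, ∀ q, 0 < q → ‖g q‖ ≤ K * lam⁻¹ ^ n * expWeight lam m q := by
    intro n
    induction n with
    | zero => simpa using hgK
    | succ n ih =>
      intro q hq
      rw [hgA q hq]
      refine (hm a ha haR g _ (by positivity) ih q hq).trans (le_of_eq ?_)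
      ring
  have hlim : Tendsto (fun N : ℕ => K * lam⁻¹ ^ N * expWeight lam m p) atTop (𝓝 0) := by
    have := (((tendsto_pow_atTop_nhds_zero_of_lt_one (by positivity) hlam1).const_mul
      K).mul_const (expWeight lam m p))
    simpa using this
  exact norm_le_zero_iff.1 (ge_of_tendsto hlim (Eventually.of_forall fun n => hn n p hp))

end Resolvent

/-! ### Growth classes and holomorphy of the resolvent. -/

/-- Families with exponential growth of every rate larger than one, locally uniformly in the
parameter. -/
def ExpBounded (T : Set ℂ) (f : ℂ → ℝ → ℂ) : Prop :=
  ∀ R lam : ℝ, 1 < lam → ∃ K : ℝ, 0 ≤ K ∧ ∀ a ∈ T, ‖a‖ ≤ R → ∀ q, 0 < q →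
    ‖f a q‖ ≤ K * Real.exp (lam * q)

theorem ExpBounded.mono {T T' : Set ℂ} {f : ℂ → ℝ → ℂ} (hf : ExpBounded T f) (h : T' ⊆ T) :
    ExpBounded T' f := fun R lam hlam => by
  obtain ⟨K, hK, hb⟩ := hf R lam hlam
  exact ⟨K, hK, fun a ha => hb a (h ha)⟩

theorem expBounded_const (T : Set ℂ) (c : ℂ) : ExpBounded T fun _ _ => c :=
  fun _ lam hlam => ⟨‖c‖, norm_nonneg _, fun _ _ _ q hq => by
    have : 1 ≤ Real.exp (lam * q) := Real.one_le_exp (by nlinarith)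
    nlinarith [norm_nonneg c]⟩

theorem ExpBounded.add {T : Set ℂ} {f g : ℂ → ℝ → ℂ} (hf : ExpBounded T f)
    (hg : ExpBounded T g) : ExpBounded T fun a q => f a q + g a q := fun R lam hlam => by
  obtain ⟨K, hK, hb⟩ := hf R lam hlam
  obtain ⟨K', hK', hb'⟩ := hg R lam hlam
  refine ⟨K + K', by positivity, fun a ha haR q hq => ?_⟩
  rw [add_mul]
  exact (norm_add_le _ _).trans (add_le_add (hb a ha haR q hq) (hb' a ha haR q hq))

theorem ExpBounded.singBound {T : Set ℂ} {f : ℂ → ℝ → ℂ} (hf : ExpBounded T f) {a : ℂ}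
    (ha : a ∈ T) : ∀ P, 0 < P → ∃ K, SingBound (f a) P K := by
  obtain ⟨K, hK, hb⟩ := hf ‖a‖ 2 one_lt_two
  refine singBound_of_expWeight (lam := 2) (m := 0) zero_le_two hK fun q hq => ?_
  simpa [expWeight] using hb a ha le_rfl q hq

theorem ExpBounded.exists_expWeight {T : Set ℂ} {f : ℂ → ℝ → ℂ} (hf : ExpBounded T f)
    (l : ℕ) (R : ℝ) {lam : ℝ} (hlam : 1 < lam) : ∃ (m : ℕ) (K : ℝ), VolterraContraction l R lam m ∧
      0 ≤ K ∧ ∀ a ∈ T, ‖a‖ ≤ R → ∀ q, 0 < q → ‖f a q‖ ≤ K * expWeight lam m q := by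
  obtain ⟨m, hm⟩ := volterraOp_contraction l R hlam
  obtain ⟨K, hK, hb⟩ := hf R lam hlam
  exact ⟨m, K, hm, hK, fun a ha haR q hq => (hb a ha haR q hq).trans
    (mul_le_mul_of_nonneg_left (exp_le_expWeight lam m hq.le) hK)⟩

section

variable {T : Set ℂ} {g : ℂ → ℝ → ℂ} (l : ℕ)

/-- The contraction is used at the intermediate rate (1+λ)/2; the remaining room up to λ absorbs the
polynomial factor of the weight. -/
theorem ExpBounded.resolvent (hT : T ⊆ closedSector) (hg : ExpBounded T g)
    (hc : ∀ a ∈ T, ContinuousOn (g a) (Ioi 0)) :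
    ExpBounded T fun a => volterraResolvent l a (g a) := by
  intro R lam hlam
  have hlam' : 1 < (1 + lam) / 2 := by linarith
  obtain ⟨m, K, hm, hK, hb⟩ := hg.exists_expWeight l R hlam'
  obtain ⟨C, hC, hw⟩ := expWeight_le_exp (by linarith : (1 + lam) / 2 < lam) m
  have hinv : 0 ≤ (1 - ((1 + lam) / 2)⁻¹)⁻¹ :=
    inv_nonneg.2 (by linarith [inv_lt_one_of_one_lt₀ hlam'])
  refine ⟨K * (1 - ((1 + lam) / 2)⁻¹)⁻¹ * C, by positivity, fun a ha haR q hq => ?_⟩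
  refine (hm.resolvent_le hlam' (hT ha) haR (hc a ha) hK (hb a ha haR) hq).trans ?_
  rw [mul_assoc _ C]
  exact mul_le_mul_of_nonneg_left (hw q hq.le) (by positivity)

theorem ExpBounded.resolvent_continuousOn (hT : T ⊆ closedSector) (hg : ExpBounded T g)
    (hc : ∀ a ∈ T, ContinuousOn (g a) (Ioi 0)) {a : ℂ} (ha : a ∈ T) :
    ContinuousOn (volterraResolvent l a (g a)) (Ioi 0) := by
  obtain ⟨m, K, hm, hK, hb⟩ := hg.exists_expWeight l ‖a‖ one_lt_two
  exact hm.resolvent_continuousOn one_lt_two (hT ha) le_rfl (hc a ha) hK (hb a ha le_rfl)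

theorem ExpBounded.resolvent_eq (hT : T ⊆ closedSector) (hg : ExpBounded T g)
    (hc : ∀ a ∈ T, ContinuousOn (g a) (Ioi 0)) {a : ℂ} (ha : a ∈ T) {p : ℝ} (hp : 0 < p) :
    volterraResolvent l a (g a) p = g a p + volterraOp l a (volterraResolvent l a (g a)) p := by
  obtain ⟨m, K, hm, hK, hb⟩ := hg.exists_expWeight l ‖a‖ one_lt_two
  exact hm.resolvent_eq one_lt_two (hT ha) le_rfl (hc a ha) hK (hb a ha le_rfl) hp

end

theorem holoKernel_volterraKernel (l : ℕ) : HoloKernel fun a σ q => volterraKernel l σ q a := by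
  obtain ⟨C, hC, hk⟩ := volterraKernel_bound l
  refine ⟨fun a ha => volterraKernel_continuousOn_Ioi l (sector_subset ha),
    ⟨C, hC.le, fun a ha σ hσ q hq => hk σ q a (Ioc_subset_Icc_self hσ) hq (sector_subset ha)⟩,
    fun σ _ q hq a ha => (volterraKernel_differentiableAt l σ hq
      (sector_subset ha)).differentiableWithinAt, fun σ _ q hq => ?_⟩
  exact (volterraKernel_differentiableAt l σ hq
    zero_mem_closedSector).continuousAt.tendsto.mono_left nhdsWithin_le_nhds

theorem HoloFamily.div_add_mul {f : ℂ → ℝ → ℂ} (hf : HoloFamily f) :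
    HoloFamily fun a q => (q : ℂ) / (q + a) * f a q := by
  refine hf.mul (m := fun a q => (q : ℂ) / (q + a))
    (fun a ha => continuousOn_div_add (sector_subset ha))
    (fun R P _ => ⟨2, fun a ha _ q hq => norm_div_add_le (sector_subset ha) hq.1⟩)
    (fun q hq a ha => ?_) fun q hq => ?_
  · exact (DifferentiableAt.div (differentiableAt_const _)
      ((differentiableAt_const _).add differentiableAt_id)
      (add_ne_zero_of_mem (sector_subset ha) hq)).differentiableWithinAt
  · refine Tendsto.mono_left ?_ nhdsWithin_le_nhds
    exact ContinuousAt.div continuousAt_const (continuousAt_const.add continuousAt_id)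
      (add_ne_zero_of_mem zero_mem_closedSector hq)

theorem HoloFamily.volterraOp {f : ℂ → ℝ → ℂ} (hf : HoloFamily f) (l : ℕ) :
    HoloFamily fun a => volterraOp l a (f a) := by
  have h2 := (hf.div_add_mul.add ((hf.kernelAvg (holoKernel_volterraKernel l)).const_mul (-1))).primitive
  refine (iff_of_eq (congrArg HoloFamily ?_)).1 h2
  funext a
  refine congrArg _root_.primitive ?_
  funext q
  unfold volterraIntegrand
  ring

/-- Every iterate is a holomorphic family, and the terms have a geometric majorant uniform for
bounded a. Weierstrass' theorem gives holomorphy of the sum, and dominated convergence gives the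
limit as a → 0. -/
theorem HoloFamily.resolvent {g : ℂ → ℝ → ℂ} (hg : HoloFamily g) (hb : ExpBounded sector g)
    (l : ℕ) : HoloFamily fun a => volterraResolvent l a (g a) := by
  have hit : ∀ n : ℕ, HoloFamily fun a => (_root_.volterraOp l a)^[n] (g a) := by
    intro n
    induction n with
    | zero => exact hg
    | succ n ih =>
      simp_rw [Function.iterate_succ_apply']
      exact ih.volterraOp l
  have hsec := sector_subset
  refine ⟨fun a ha => hb.resolvent_continuousOn l hsec hg.cont ha, fun R P hP => ?_,
    fun q hq a₀ ha₀ => ?_, fun q hq => ?_⟩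
  · obtain ⟨K, hK, hKb⟩ := hb.resolvent l hsec hg.cont R 2 one_lt_two
    refine ⟨_, fun a ha haR => singBound_of_norm_le (K := K * Real.exp (2 * P)) fun q hq => ?_⟩
    refine (hKb a ha haR q hq.1).trans (mul_le_mul_of_nonneg_left ?_ hK)
    exact Real.exp_le_exp.2 (by linarith [hq.2])
  · obtain ⟨m, K, hm, hK, hw⟩ := hb.exists_expWeight l (‖a₀‖ + 1) one_lt_two
    set U : Set ℂ := sector ∩ Metric.ball 0 (‖a₀‖ + 1) with hU
    have hUo : IsOpen U := isOpen_sector.inter Metric.isOpen_ball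
    have ha₀U : a₀ ∈ U := ⟨ha₀, by simp⟩
    have hUn : ∀ a ∈ U, ‖a‖ ≤ ‖a₀‖ + 1 := fun a ha => by
      have := ha.2
      rw [mem_ball_zero_iff] at this
      exact this.le
    have key : DifferentiableOn ℂ (fun a => volterraResolvent l a (g a) q) U := by
      refine Complex.differentiableOn_tsum_of_summable_norm
        (summable_inv_pow one_lt_two K (expWeight 2 m q))
        (fun n => ((hit n).holo q hq).mono inter_subset_left) hUo fun n a ha => ?_
      exact (hm.iterate one_lt_two (hsec ha.1) (hUn a ha) (hg.cont a ha.1) hK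
        (hw a ha.1 (hUn a ha)) n).2 q hq
    exact ((key a₀ ha₀U).differentiableAt (hUo.mem_nhds ha₀U)).differentiableWithinAt
  · obtain ⟨m, K, hm, hK, hw⟩ := hb.exists_expWeight l 1 one_lt_two
    refine tendsto_tsum_of_dominated_convergence
      (summable_inv_pow one_lt_two K (expWeight 2 m q)) (fun n => (hit n).lim q hq) ?_
    have h1 : ∀ᶠ a in 𝓝[sector] (0 : ℂ), ‖a‖ ≤ 1 := nhdsWithin_le_nhds (by
      filter_upwards [Metric.closedBall_mem_nhds (0 : ℂ) one_pos] with a ha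
      simpa using ha)
    filter_upwards [eventually_mem_nhdsWithin, h1] with a ha ha1 n
    exact (hm.iterate one_lt_two (hsec ha) ha1 (hg.cont a ha) hK (hw a ha ha1) n).2 q hq

/-! ### Singular growth classes and the logarithm. -/

/-- Families bounded on `(0, P]` by a multiple of `e ^ (λ P) q ^ (-1/2)` for every `λ > 1`, locally
uniformly in the parameter. -/
def SingExpBounded (T : Set ℂ) (f : ℂ → ℝ → ℂ) : Prop :=
  ∀ R lam : ℝ, 1 < lam → ∃ K : ℝ, 0 ≤ K ∧ ∀ a ∈ T, ‖a‖ ≤ R → ∀ P, 0 < P →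
    SingBound (f a) P (K * Real.exp (lam * P))

theorem rpow_half_le {P : ℝ} (hP : 0 ≤ P) : P ^ (1 / 2 : ℝ) ≤ 1 + P := by
  rw [← Real.sqrt_eq_rpow]
  nlinarith [Real.sq_sqrt hP, Real.sqrt_nonneg P, sq_nonneg (Real.sqrt P - 1)]

theorem exp_mul_one_add_pow_le {lam lam' : ℝ} (h : lam < lam') (m : ℕ) : ∃ C : ℝ, 0 < C ∧
    ∀ q : ℝ, 0 ≤ q → (1 + q) ^ m * Real.exp (lam * q) ≤ C * Real.exp (lam' * q) := by
  obtain ⟨C, hC, hb⟩ := expWeight_le_exp h m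
  exact ⟨C, hC, fun q hq => by rw [mul_comm]; exact hb q hq⟩

theorem ExpBounded.singExpBounded {T : Set ℂ} {f : ℂ → ℝ → ℂ} (hf : ExpBounded T f) :
    SingExpBounded T f := by
  intro R lam hlam
  obtain ⟨K, hK, hb⟩ := hf R ((1 + lam) / 2) (by linarith)
  obtain ⟨C, hC, hw⟩ := exp_mul_one_add_pow_le (by linarith : (1 + lam) / 2 < lam) 1
  refine ⟨K * C, by positivity, fun a ha haR P hP => ?_⟩
  have h1 := singBound_of_norm_le (f := f a) (P := P) (K := K * Real.exp ((1 + lam) / 2 * P))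
    fun q hq => (hb a ha haR q hq.1).trans
      (mul_le_mul_of_nonneg_left (Real.exp_le_exp.2 (by nlinarith [hq.2])) hK)
  intro q hq
  refine (h1 q hq).trans (mul_le_mul_of_nonneg_right ?_ (Real.rpow_nonneg hq.1.le _))
  have h2 := hw P hP.le
  have h3 := rpow_half_le hP.le
  rw [pow_one] at h2
  rw [mul_assoc, mul_assoc]
  refine mul_le_mul_of_nonneg_left (le_trans ?_ h2) hK
  rw [mul_comm]
  exact mul_le_mul_of_nonneg_right h3 (Real.exp_pos _).le

theorem SingExpBounded.add {T : Set ℂ} {f g : ℂ → ℝ → ℂ} (hf : SingExpBounded T f)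
    (hg : SingExpBounded T g) : SingExpBounded T fun a q => f a q + g a q := by
  intro R lam hlam
  obtain ⟨K, hK, hb⟩ := hf R lam hlam
  obtain ⟨K', hK', hb'⟩ := hg R lam hlam
  refine ⟨K + K', by positivity, fun a ha haR P hP q hq => ?_⟩
  rw [add_mul, add_mul]
  exact (norm_add_le _ _).trans (add_le_add (hb a ha haR P hP q hq) (hb' a ha haR P hP q hq))

theorem SingExpBounded.const_mul {T : Set ℂ} {f : ℂ → ℝ → ℂ} (hf : SingExpBounded T f) (c : ℂ) :
    SingExpBounded T fun a q => c * f a q := by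
  intro R lam hlam
  obtain ⟨K, hK, hb⟩ := hf R lam hlam
  refine ⟨‖c‖ * K, by positivity, fun a ha haR P hP q hq => ?_⟩
  rw [norm_mul, mul_assoc, mul_assoc, ← mul_assoc K]
  exact mul_le_mul_of_nonneg_left (hb a ha haR P hP q hq) (norm_nonneg c)

theorem SingExpBounded.primitive {T : Set ℂ} {f : ℂ → ℝ → ℂ} (hf : SingExpBounded T f) :
    ExpBounded T fun a => primitive (f a) := by
  intro R lam hlam
  obtain ⟨K, hK, hb⟩ := hf R ((1 + lam) / 2) (by linarith)
  obtain ⟨C, hC, hw⟩ := exp_mul_one_add_pow_le (by linarith : (1 + lam) / 2 < lam) 1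
  refine ⟨2 * K * C, by positivity, fun a ha haR P hP => ?_⟩
  refine ((hb a ha haR P hP).primitive_le hP.le).trans ?_
  have h2 := hw P hP.le
  have h3 := rpow_half_le hP.le
  rw [pow_one] at h2
  calc K * Real.exp ((1 + lam) / 2 * P) * (2 * P ^ (1 / 2 : ℝ))
      ≤ K * Real.exp ((1 + lam) / 2 * P) * (2 * (1 + P)) := by gcongr
    _ = 2 * K * ((1 + P) * Real.exp ((1 + lam) / 2 * P)) := by ring
    _ ≤ 2 * K * (C * Real.exp (lam * P)) := by gcongr
    _ = _ := by ring

theorem SingExpBounded.volterraIntegrand {T : Set ℂ} (hT : T ⊆ closedSector) {f : ℂ → ℝ → ℂ}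
    (hf : SingExpBounded T f) (l : ℕ) : SingExpBounded T fun a => volterraIntegrand l a (f a) := by
  intro R lam hlam
  obtain ⟨K, hK, hb⟩ := hf R lam hlam
  obtain ⟨C, hC, h⟩ := volterraIntegrand_singBound l
  refine ⟨C * K, by positivity, fun a ha haR P hP => ?_⟩
  rw [mul_assoc]
  exact h a (hT ha) _ _ _ (hb a ha haR P hP)

theorem SingExpBounded.volterraOp {T : Set ℂ} (hT : T ⊆ closedSector) {f : ℂ → ℝ → ℂ}
    (hf : SingExpBounded T f) (l : ℕ) : ExpBounded T fun a => volterraOp l a (f a) :=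
  (hf.volterraIntegrand hT l).primitive

theorem SingExpBounded.singBound {T : Set ℂ} {f : ℂ → ℝ → ℂ} (hf : SingExpBounded T f) {a : ℂ}
    (ha : a ∈ T) : ∀ P, 0 < P → ∃ K, SingBound (f a) P K := by
  obtain ⟨K, hK, hb⟩ := hf ‖a‖ 2 one_lt_two
  exact fun P hP => ⟨_, hb a ha le_rfl P hP⟩

/-- Apply log y ≤ y - 1 to y = x and to y = x^(-1/2). -/
theorem abs_log_le {x : ℝ} (hx : 0 < x) : |Real.log x| ≤ x + 2 * x ^ (-(1 / 2) : ℝ) := by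
  have h1 := Real.log_le_sub_one_of_pos hx
  have h2 := Real.log_le_sub_one_of_pos (Real.rpow_pos_of_pos hx (-(1 / 2)))
  rw [Real.log_rpow hx] at h2
  have h3 := Real.rpow_pos_of_pos hx (-(1 / 2))
  rw [abs_le]
  constructor <;> linarith

theorem norm_log_add_le {a : ℂ} (ha : a ∈ closedSector) {q R : ℝ} (hq : 0 < q) (haR : ‖a‖ ≤ R) :
    ‖Complex.log (q + a)‖ ≤ q + R + 4 + 4 * q ^ (-(1 / 2) : ℝ) := by
  have hlo := norm_add_ge ha hq.le
  have hna := norm_nonneg a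
  set z : ℂ := q + a
  have hz : 0 < ‖z‖ := by linarith
  have h1 : ‖Complex.log z‖ ≤ |Real.log ‖z‖| + 4 := by
    refine (Complex.norm_le_abs_re_add_abs_im _).trans ?_
    rw [Complex.log_re, Complex.log_im]
    linarith [Complex.abs_arg_le_pi z, Real.pi_le_four]
  have h2 := abs_log_le hz
  have h3 : ‖z‖ ≤ q + R := by
    refine (norm_add_le _ _).trans ?_
    rw [Complex.norm_real, Real.norm_of_nonneg hq.le]
    linarith
  have h4 : ‖z‖ ^ (-(1 / 2) : ℝ) ≤ 2 * q ^ (-(1 / 2) : ℝ) := by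
    -- The factor 1/4, weaker than the available 1/2, is chosen because its power -1/2 is exactly 2.
    have h5 : ‖z‖ ^ (-(1 / 2) : ℝ) ≤ ((1 / 4) * q) ^ (-(1 / 2) : ℝ) :=
      Real.rpow_le_rpow_of_nonpos (by positivity) (by linarith) (by norm_num)
    rw [Real.mul_rpow (by norm_num) hq.le] at h5
    have h6 : (1 / 4 : ℝ) ^ (-(1 / 2) : ℝ) = 2 := by
      rw [show (1 / 4 : ℝ) = 2 ^ (-2 : ℝ) by norm_num, ← Real.rpow_mul (by norm_num)]
      norm_num
    rwa [h6] at h5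
  linarith

/-- Near q = 0 the logarithm is not bounded uniformly as a → 0, but it is dominated by a multiple of
q^(-1/2) uniformly for bounded a. This is why families are allowed an integrable singularity. -/
theorem holoFamily_log : HoloFamily fun a q => Complex.log (q + a) := by
  refine ⟨fun a ha => ?_, fun R P hP => ?_, fun q hq a ha => ?_, fun q hq => ?_⟩
  · exact ContinuousOn.clog (Continuous.continuousOn (by fun_prop))
      fun q hq => add_mem_slitPlane (sector_subset ha) hq
  · refine ⟨(P + |R| + 4) * P ^ (1 / 2 : ℝ) + 4, fun a ha haR q hq => ?_⟩
    have h1 := norm_log_add_le (sector_subset ha) hq.1 (haR.trans (le_abs_self R))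
    have h2 := singBound_of_norm_le (f := fun _ => ((P + |R| + 4 : ℝ) : ℂ)) (P := P)
      (K := P + |R| + 4) (fun q _ => by
        rw [Complex.norm_real, Real.norm_of_nonneg (by positivity)]) q hq
    rw [Complex.norm_real, Real.norm_of_nonneg (by positivity)] at h2
    rw [add_mul]
    linarith [hq.2]
  · exact (((differentiableAt_const _).add differentiableAt_id).clog
      (add_mem_slitPlane (sector_subset ha) hq)).differentiableWithinAt
  · refine Tendsto.mono_left ?_ nhdsWithin_le_nhds
    exact ContinuousAt.clog (continuousAt_const.add continuousAt_id)
      (add_mem_slitPlane zero_mem_closedSector hq)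

theorem singExpBounded_log : SingExpBounded sector fun a q => Complex.log (q + a) := by
  have h4 : ExpBounded sector fun (_ : ℂ) q => ((1 + q : ℝ) : ℂ) := by
    intro R lam hlam
    refine ⟨1, zero_le_one, fun a _ _ q hq => ?_⟩
    rw [Complex.norm_real, Real.norm_of_nonneg (by positivity)]
    have := Real.add_one_le_exp (lam * q)
    nlinarith
  intro R lam hlam
  obtain ⟨K, hK, hb⟩ := h4.singExpBounded R lam hlam
  refine ⟨(|R| + 4) * K + 4, by positivity, fun a ha haR P hP q hq => ?_⟩
  have h1 := norm_log_add_le (sector_subset ha) hq.1 (haR.trans (le_abs_self R))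
  have h2 := hb a ha haR P hP q hq
  rw [Complex.norm_real, Real.norm_of_nonneg (by linarith [hq.1])] at h2
  have h3 : 1 ≤ Real.exp (lam * P) := Real.one_le_exp (by nlinarith)
  have h5 := Real.rpow_nonneg hq.1.le (-(1 / 2))
  have hR := abs_nonneg R
  calc _ ≤ (|R| + 4) * (1 + q) + 4 * q ^ (-(1 / 2) : ℝ) := by nlinarith [hq.1]
    _ ≤ (|R| + 4) * (K * Real.exp (lam * P) * q ^ (-(1 / 2) : ℝ)) +
        4 * (Real.exp (lam * P) * q ^ (-(1 / 2) : ℝ)) := by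
        gcongr
        nlinarith
    _ = _ := by ring

/-! ### The density, its limit at a = 0 and the first order correction. -/

/-- The normalized Laplace density: the Laplace transform of `legForm l p a * radialDensity l a p`
is a multiple of the decaying solution of the radial equation. -/
noncomputable def radialDensity (l : ℕ) (a : ℂ) : ℝ → ℂ := volterraResolvent l a fun _ => 1

theorem radialDensity_expBounded (l : ℕ) : ExpBounded closedSector (radialDensity l) :=
  (expBounded_const closedSector 1).resolvent l subset_rfl fun _ _ => continuousOn_const

theorem radialDensity_continuousOn (l : ℕ) {a : ℂ} (ha : a ∈ closedSector) :
    ContinuousOn (radialDensity l a) (Ioi 0) :=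
  (expBounded_const closedSector 1).resolvent_continuousOn l subset_rfl
    (fun _ _ => continuousOn_const) ha

theorem radialDensity_eq (l : ℕ) {a : ℂ} (ha : a ∈ closedSector) {p : ℝ} (hp : 0 < p) :
    radialDensity l a p = 1 + volterraOp l a (radialDensity l a) p :=
  (expBounded_const closedSector 1).resolvent_eq l subset_rfl (fun _ _ => continuousOn_const) ha hp

theorem radialDensity_holoFamily (l : ℕ) : HoloFamily (radialDensity l) := by
  refine HoloFamily.resolvent (g := fun _ _ => 1) ?_ (expBounded_const _ 1) l
  exact HoloFamily.of_const (f := fun _ => 1) continuousOn_const fun P _ =>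
    ⟨_, singBound_of_norm_le fun _ _ => le_rfl⟩

theorem radialDensity_singBound (l : ℕ) {a : ℂ} (ha : a ∈ closedSector) :
    ∀ P, 0 < P → ∃ K, SingBound (radialDensity l a) P K :=
  (radialDensity_expBounded l).singBound ha

theorem radialDensity_hasDerivAt (l : ℕ) {a : ℂ} (ha : a ∈ closedSector) {p : ℝ} (hp : 0 < p) :
    HasDerivAt (radialDensity l a) (volterraIntegrand l a (radialDensity l a) p) p := by
  refine ((volterraOp_hasDerivAt l ha (radialDensity_continuousOn l ha)
    (radialDensity_singBound l ha) hp).const_add 1).congr_of_eventuallyEq ?_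
  filter_upwards [Ioi_mem_nhds hp] with q hq
  exact radialDensity_eq l ha hq

/-- The growth rate of the density in the limit `a = 0`. -/
noncomputable def densitySlope (l : ℕ) (q : ℝ) : ℂ := (radialDensity l 0 q - 1) / q

theorem densitySlope_continuousOn (l : ℕ) : ContinuousOn (densitySlope l) (Ioi 0) :=
  ((radialDensity_continuousOn l zero_mem_closedSector).sub continuousOn_const).div
    (Continuous.continuousOn (by fun_prop)) fun q hq => by
      have : (0 : ℝ) < q := hq
      exact_mod_cast this.ne'

/-- The density minus 1 is the primitive of an integrand that stays bounded near 0, hence O(q)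
there. For a = 0 this makes `densitySlope` bounded near 0. -/
theorem norm_radialDensity_sub_one_le (l : ℕ) {a : ℂ} (ha : a ∈ closedSector) {lam : ℝ}
    (hlam : 1 < lam) : ∃ K : ℝ, 0 ≤ K ∧
    ∀ q, 0 < q → ‖radialDensity l a q - 1‖ ≤ K * q * Real.exp (lam * q) := by
  obtain ⟨K, hK, hb⟩ := radialDensity_expBounded l ‖a‖ lam hlam
  obtain ⟨D, hD, hw⟩ := volterraIntegrand_weight_le l ‖a‖
  refine ⟨K * (1 + D), by positivity, fun p hp => ?_⟩
  rw [radialDensity_eq l ha hp, add_sub_cancel_left]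
  have h1 : ∀ q ∈ uIoc (0 : ℝ) p, ‖volterraIntegrand l a (radialDensity l a) q‖ ≤
      K * (1 + D) * Real.exp (lam * p) := by
    intro q hq
    rw [uIoc_of_le hp.le] at hq
    have h2 := hw lam 0 hlam.le a ha le_rfl (radialDensity l a) K hK
      (fun q hq => by simpa [expWeight] using hb a ha le_rfl q hq) q hq.1
    refine h2.trans ?_
    simp only [expWeight, pow_zero, mul_one]
    rw [mul_assoc K]
    have h3 : D / (1 + q) ≤ D := div_le_self hD.le (by linarith [hq.1])
    have h4 : Real.exp (lam * q) ≤ Real.exp (lam * p) :=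
      Real.exp_le_exp.2 (by nlinarith [hq.2])
    have h5 : 0 ≤ D / (1 + q) := div_nonneg hD.le (by linarith [hq.1])
    gcongr
  refine (intervalIntegral.norm_integral_le_of_norm_le_const h1).trans (le_of_eq ?_)
  rw [sub_zero, abs_of_pos hp]
  ring

theorem densitySlope_expBounded (l : ℕ) : ExpBounded univ fun _ => densitySlope l := by
  intro R lam hlam
  obtain ⟨K, hK, hb⟩ := norm_radialDensity_sub_one_le l zero_mem_closedSector hlam
  refine ⟨K, hK, fun _ _ _ q hq => ?_⟩
  unfold densitySlope
  rw [norm_div, Complex.norm_real, Real.norm_of_nonneg hq.le, div_le_iff₀ hq]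
  refine (hb q hq).trans (le_of_eq ?_)
  ring

/-- The difference quotient in the parameter of the Volterra kernel, scaled to be bounded. -/
noncomputable def slopeKernel (l : ℕ) (a : ℂ) (σ q : ℝ) : ℂ :=
  σ * q * dslope (fun a => volterraKernel l σ q a) 0 a

theorem slopeKernel_of_ne (l : ℕ) {a : ℂ} (ha : a ≠ 0) (σ q : ℝ) : slopeKernel l a σ q =
    σ * q * (a⁻¹ * (volterraKernel l σ q a - volterraKernel l σ q 0)) := by
  unfold slopeKernel
  rw [dslope_of_ne _ ha, slope_def_module, sub_zero, smul_eq_mul]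

/-- Boundedness is exactly `volterraKernel_lipschitz`: the factor σq cancels the 1/q there. Using
`dslope` gives the value at a = 0 as the derivative, so the limit at the vertex is immediate. -/
theorem holoKernel_slopeKernel (l : ℕ) : HoloKernel (slopeKernel l) := by
  obtain ⟨C, hC, hk⟩ := volterraKernel_lipschitz l
  refine ⟨fun a ha => ?_, ⟨C, hC.le, fun a ha σ hσ q hq => ?_⟩, fun σ _ q hq a ha => ?_,
    fun σ _ q hq => ?_⟩
  · have hne := ne_zero_of_mem_sector ha
    simp_rw [slopeKernel_of_ne l hne]
    exact (Continuous.continuousOn (by fun_prop)).mul (continuousOn_const.mul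
      ((volterraKernel_continuousOn_Ioi l (sector_subset ha)).sub
        (volterraKernel_continuousOn_Ioi l zero_mem_closedSector)))
  · have hne := ne_zero_of_mem_sector ha
    have hna := norm_pos_iff.2 hne
    rw [slopeKernel_of_ne l hne, norm_mul, norm_mul, norm_mul, norm_inv, Complex.norm_real,
      Complex.norm_real, Real.norm_of_nonneg hσ.1.le, Real.norm_of_nonneg hq.le]
    have h1 := hk σ q a (Ioc_subset_Icc_self hσ) hq (sector_subset ha)
    calc _ ≤ 1 * q * (‖a‖⁻¹ * (C * (‖a‖ / q))) := by
          gcongr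
          exact hσ.2
      _ = C := by field_simp
  · have hne := ne_zero_of_mem_sector ha
    refine DifferentiableAt.differentiableWithinAt ?_
    have h1 : DifferentiableAt ℂ (fun a => (σ : ℂ) * q * (a⁻¹ *
        (volterraKernel l σ q a - volterraKernel l σ q 0))) a :=
      (differentiableAt_const _).mul ((differentiableAt_inv hne).mul
        ((volterraKernel_differentiableAt l σ hq (sector_subset ha)).sub
          (differentiableAt_const _)))
    refine h1.congr_of_eventuallyEq ?_
    filter_upwards [isOpen_ne.mem_nhds hne] with b hb
    exact slopeKernel_of_ne l hb σ q
  · refine Tendsto.mono_left ?_ nhdsWithin_le_nhds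
    exact continuousAt_const.mul (continuousAt_dslope_same.2
      (volterraKernel_differentiableAt l σ hq zero_mem_closedSector))

/-- The difference quotient at `a = 0` of the Volterra integrands applied to the limit density. -/
noncomputable def sourceIntegrand (l : ℕ) (a : ℂ) (q : ℝ) : ℂ :=
  -1 * (q / (q + a) * densitySlope l q) + -1 * kernelAvg (slopeKernel l a) (densitySlope l) q

/-- The source term of the equation for the first order correction of the density. -/
noncomputable def sourceTerm (l : ℕ) (a : ℂ) (p : ℝ) : ℂ :=
  -(1 / 2) * Complex.log (p + a) + primitive (sourceIntegrand l a) p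

theorem densitySlope_singBound (l : ℕ) : ∀ P, 0 < P → ∃ K, SingBound (densitySlope l) P K :=
  (densitySlope_expBounded l).singBound (mem_univ (0 : ℂ))

theorem densitySlope_holoFamily (l : ℕ) : HoloFamily fun _ => densitySlope l :=
  HoloFamily.of_const (densitySlope_continuousOn l) (densitySlope_singBound l)

theorem sourceIntegrand_holoFamily (l : ℕ) : HoloFamily (sourceIntegrand l) :=
  ((densitySlope_holoFamily l).div_add_mul.const_mul (-1)).add
    (((densitySlope_holoFamily l).kernelAvg (holoKernel_slopeKernel l)).const_mul (-1))

theorem sourceIntegrand_singExpBounded (l : ℕ) : SingExpBounded sector (sourceIntegrand l) := by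
  have h0 := ((densitySlope_expBounded l).mono (subset_univ sector)).singExpBounded
  have h1 : SingExpBounded sector fun a q => (q : ℂ) / (q + a) * densitySlope l q := by
    intro R lam hlam
    obtain ⟨K, hK, hb⟩ := h0 R lam hlam
    refine ⟨2 * K, by positivity, fun a ha haR P hP q hq => ?_⟩
    rw [norm_mul, mul_assoc, mul_assoc, ← mul_assoc K]
    exact mul_le_mul (norm_div_add_le (sector_subset ha) hq.1) (hb a ha haR P hP q hq)
      (norm_nonneg _) zero_le_two
  have h2 : SingExpBounded sector fun a => kernelAvg (slopeKernel l a) (densitySlope l) := by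
    obtain ⟨C, hC, hk⟩ := (holoKernel_slopeKernel l).bdd
    intro R lam hlam
    obtain ⟨K, hK, hb⟩ := h0 R lam hlam
    refine ⟨2 * C * K, by positivity, fun a ha haR P hP => ?_⟩
    rw [mul_assoc _ K]
    exact (hb a ha haR P hP).kernelAvg hC (hk a ha)
  exact (h1.const_mul (-1)).add (h2.const_mul (-1))

theorem sourceTerm_holoFamily (l : ℕ) : HoloFamily (sourceTerm l) :=
  (holoFamily_log.const_mul (-(1 / 2))).add (sourceIntegrand_holoFamily l).primitive

theorem sourceTerm_singExpBounded (l : ℕ) : SingExpBounded sector (sourceTerm l) :=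
  (singExpBounded_log.const_mul (-(1 / 2))).add
    (sourceIntegrand_singExpBounded l).primitive.singExpBounded

/-- The first order correction of the density. -/
noncomputable def densityCorrection (l : ℕ) (a : ℂ) (p : ℝ) : ℂ :=
  sourceTerm l a p + volterraResolvent l a (volterraOp l a (sourceTerm l a)) p

/-- The source contains log(p+a), which is outside the class in which the Neumann series is
controlled uniformly as a → 0. One application of the Volterra operator removes the singularity, so
`densityCorrection` applies the resolvent only to this image. -/
theorem volterraOp_sourceTerm_expBounded (l : ℕ) :
    ExpBounded sector fun a => volterraOp l a (sourceTerm l a) :=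
  (sourceTerm_singExpBounded l).volterraOp sector_subset l

theorem densityCorrection_holoFamily (l : ℕ) : HoloFamily (densityCorrection l) :=
  (sourceTerm_holoFamily l).add
    (((sourceTerm_holoFamily l).volterraOp l).resolvent (volterraOp_sourceTerm_expBounded l) l)

theorem densityCorrection_singExpBounded (l : ℕ) : SingExpBounded sector (densityCorrection l) :=
  (sourceTerm_singExpBounded l).add ((volterraOp_sourceTerm_expBounded l).resolvent l sector_subset
    ((sourceTerm_holoFamily l).volterraOp l).cont).singExpBounded

/-- If w = As + Aw then s + w = s + A(s + w). -/
theorem densityCorrection_eq (l : ℕ) {a : ℂ} (ha : a ∈ sector) {p : ℝ} (hp : 0 < p) :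
    densityCorrection l a p = sourceTerm l a p + volterraOp l a (densityCorrection l a) p := by
  have hs := sourceTerm_holoFamily l
  have hb := volterraOp_sourceTerm_expBounded l
  have hr := hb.resolvent_eq l sector_subset (hs.volterraOp l).cont ha hp
  have h1 : densityCorrection l a = fun q => sourceTerm l a q +
      1 * volterraResolvent l a (volterraOp l a (sourceTerm l a)) q := by
    funext q
    rw [one_mul]
    rfl
  rw [h1, volterraOp_add_smul l (sector_subset ha) 1 (hs.cont a ha) (hs.exists_bdd ha)
    (hb.resolvent_continuousOn l sector_subset (hs.volterraOp l).cont ha)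
    ((hb.resolvent l sector_subset (hs.volterraOp l).cont).singBound ha) hp]
  simp only [one_mul]
  rw [hr]

/-- Split v_0 = 1 + h. On the constant 1 the integrands are known, and q/(2(q+a)) - 1/2 =
-a/(2(q+a)). On h a factor a comes out as well: from the multiplier directly, from the kernel by
pairing σq times its difference quotient with h(σq)/(σq). -/
theorem volterraIntegrand_sub_zero (l : ℕ) {a : ℂ} (ha : a ∈ sector) {q : ℝ} (hq : 0 < q) :
    volterraIntegrand l a (radialDensity l 0) q - volterraIntegrand l 0 (radialDensity l 0) q =
      a * (-(1 / 2) * (1 / (q + a)) + sourceIntegrand l a q) := by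
  have ha' := sector_subset ha
  have hne := ne_zero_of_mem_sector ha
  have hq' : (q : ℂ) ≠ 0 := by exact_mod_cast hq.ne'
  have hqa := add_ne_zero_of_mem ha' hq
  obtain ⟨C, hC, hk⟩ := volterraKernel_bound l
  set h : ℝ → ℂ := fun q => radialDensity l 0 q - 1 with hh
  have hone : ContinuousOn (fun _ : ℝ => (1 : ℂ)) (Ioi 0) := continuousOn_const
  have honeb : ∀ P, 0 < P → ∃ K, SingBound (fun _ : ℝ => (1 : ℂ)) P K :=
    (expBounded_const univ 1).singBound (mem_univ (0 : ℂ))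
  have hc : ContinuousOn h (Ioi 0) :=
    (radialDensity_continuousOn l zero_mem_closedSector).sub continuousOn_const
  have hb : ∀ P, 0 < P → ∃ K, SingBound h P K := by
    have h1 : ExpBounded {0} (radialDensity l) :=
      (radialDensity_expBounded l).mono (by simpa using zero_mem_closedSector)
    have h2 := (h1.add (expBounded_const {0} (-1))).singBound (mem_singleton (0 : ℂ))
    simpa [hh, sub_eq_add_neg] using h2
  have hsplit : radialDensity l 0 = fun q => (1 : ℂ) + 1 * h q := by
    funext q
    simp [hh]
  have e1 : ∀ b ∈ closedSector, volterraIntegrand l b (radialDensity l 0) q =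
      q / (q + b) / 2 + volterraIntegrand l b h q := by
    intro b hb'
    rw [hsplit, volterraIntegrand_add_smul l hb' 1 hone honeb hc hb hq,
      volterraIntegrand_one l hb' hq, one_mul]
  have e2 : kernelAvg (fun σ q => volterraKernel l σ q a) h q -
      kernelAvg (fun σ q => volterraKernel l σ q 0) h q =
      a * kernelAvg (slopeKernel l a) (densitySlope l) q := by
    obtain ⟨K, hK⟩ := hb q hq
    have i1 := kernelAvg_intervalIntegrable hC.le (volterraKernel_continuousOn_Ioi l ha')
      (fun σ hσ q hq => hk σ q a (Ioc_subset_Icc_self hσ) hq ha') hc hq hK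
    have i2 := kernelAvg_intervalIntegrable hC.le
      (volterraKernel_continuousOn_Ioi l zero_mem_closedSector)
      (fun σ hσ q hq => hk σ q 0 (Ioc_subset_Icc_self hσ) hq zero_mem_closedSector) hc hq hK
    unfold kernelAvg
    rw [← intervalIntegral.integral_sub i1 i2, ← intervalIntegral.integral_const_mul]
    refine intervalIntegral.integral_congr_ae (Eventually.of_forall fun σ hσ => ?_)
    rw [uIoc_of_le zero_le_one] at hσ
    have hσ' : (σ : ℂ) ≠ 0 := by exact_mod_cast hσ.1.ne'
    rw [slopeKernel_of_ne l hne, densitySlope, hh]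
    push_cast
    field_simp
  rw [e1 a ha', e1 0 zero_mem_closedSector]
  have e3 : sourceIntegrand l a q = -1 * (q / (q + a) * (h q / q)) +
      -1 * kernelAvg (slopeKernel l a) (densitySlope l) q := rfl
  rw [e3]
  unfold volterraIntegrand
  have e4 : kernelAvg (fun σ q => volterraKernel l σ q a) h q =
      kernelAvg (fun σ q => volterraKernel l σ q 0) h q +
      a * kernelAvg (slopeKernel l a) (densitySlope l) q := by rw [← e2]; ring
  rw [e4, add_zero, div_self hq']
  field_simp
  ring

/-- Integrate the pointwise difference over (0, p) and use A_0 v_0 = v_0 - 1. The primitive of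
1/(q+a) contributes log(p+a) - log a; the upper endpoint goes into `sourceTerm`, and the lower one
is the term (1/2) a log a. -/
theorem volterraOp_radialDensity_zero (l : ℕ) {a : ℂ} (ha : a ∈ sector) {p : ℝ} (hp : 0 < p) :
    volterraOp l a (radialDensity l 0) p =
      radialDensity l 0 p - 1 + 1 / 2 * a * Complex.log a + a * sourceTerm l a p := by
  have ha' := sector_subset ha
  have hc := radialDensity_continuousOn l zero_mem_closedSector
  have hb := radialDensity_singBound l zero_mem_closedSector
  obtain ⟨K, hK⟩ := volterraIntegrand_singBound' (l := l) ha' hb p hp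
  obtain ⟨K', hK'⟩ := volterraIntegrand_singBound' (l := l) zero_mem_closedSector hb p hp
  have i1 := hK.intervalIntegrable (volterraIntegrand_continuousOn l ha' hc hb) hp.le
  have i2 := hK'.intervalIntegrable
    (volterraIntegrand_continuousOn l zero_mem_closedSector hc hb) hp.le
  obtain ⟨K'', hK''⟩ := (sourceIntegrand_holoFamily l).exists_bdd ha p hp
  have i3 := hK''.intervalIntegrable ((sourceIntegrand_holoFamily l).cont a ha) hp.le
  have hslit : ∀ q ∈ uIcc 0 p, ((q : ℂ) + a) ∈ Complex.slitPlane := by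
    intro q hq
    rw [uIcc_of_le hp.le] at hq
    rcases hq.1.eq_or_lt with rfl | h
    · simpa using mem_slitPlane_of_mem_sector ha
    · exact add_mem_slitPlane ha' h
  have hlog : ∀ q ∈ uIcc 0 p, HasDerivAt (fun q : ℝ => Complex.log (q + a)) (1 / (q + a)) q := by
    intro q hq
    exact HasDerivAt.clog_real ((Complex.ofRealCLM.hasDerivAt (x := q)).add_const a) (hslit q hq)
  have i4 : IntervalIntegrable (fun q : ℝ => 1 / ((q : ℂ) + a)) volume 0 p :=
    (continuousOn_const.div (Continuous.continuousOn (by fun_prop)) fun q hq =>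
      Complex.slitPlane_ne_zero (hslit q hq)).intervalIntegrable
  have hint := intervalIntegral.integral_eq_sub_of_hasDerivAt hlog i4
  have key : volterraOp l a (radialDensity l 0) p - volterraOp l 0 (radialDensity l 0) p =
      ∫ q in (0 : ℝ)..p, a * (-(1 / 2) * (1 / (q + a)) + sourceIntegrand l a q) := by
    unfold volterraOp primitive
    rw [← intervalIntegral.integral_sub i1 i2]
    refine intervalIntegral.integral_congr_ae (Eventually.of_forall fun q hq => ?_)
    rw [uIoc_of_le hp.le] at hq
    exact volterraIntegrand_sub_zero l ha hq.1
  rw [intervalIntegral.integral_const_mul, intervalIntegral.integral_add (i4.const_mul _) i3,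
    intervalIntegral.integral_const_mul, hint, Complex.ofReal_zero, zero_add] at key
  have h0 := radialDensity_eq l zero_mem_closedSector hp
  have hs : sourceTerm l a p = -(1 / 2) * Complex.log (p + a) +
    ∫ q in (0 : ℝ)..p, sourceIntegrand l a q := rfl
  rw [hs]
  linear_combination key - h0

/-- The expansion of the density: up to a term of first order in `a`, the dependence on `a` is
through an explicit logarithmic factor. -/
theorem radialDensity_expansion (l : ℕ) {a : ℂ} (ha : a ∈ sector) {p : ℝ} (hp : 0 < p) :
    (1 - 1 / 2 * a * Complex.log a) * radialDensity l a p =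
      radialDensity l 0 p + a * densityCorrection l a p := by
  have ha' := sector_subset ha
  set c : ℂ := -(1 - 1 / 2 * a * Complex.log a) with hc
  have hv0c := radialDensity_continuousOn l zero_mem_closedSector
  have hv0b := radialDensity_singBound l zero_mem_closedSector
  have hvc := radialDensity_continuousOn l ha'
  have hvb := radialDensity_singBound l ha'
  have hGc := (densityCorrection_holoFamily l).cont a ha
  have hGb := (densityCorrection_holoFamily l).exists_bdd ha
  set e : ℝ → ℂ := fun q => radialDensity l 0 q + a * densityCorrection l a q with he
  set d : ℝ → ℂ := fun q => e q + c * radialDensity l a q with hd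
  have hec : ContinuousOn e (Ioi 0) := hv0c.add (continuousOn_const.mul hGc)
  -- The growth classes concern families over a set of parameters; here a is fixed, so the set is a
  -- singleton.
  have hT : ({a} : Set ℂ) ⊆ closedSector := by simpa using ha'
  have hTs : ({a} : Set ℂ) ⊆ sector := by simpa using ha
  have hv0e : ExpBounded {a} fun _ => radialDensity l 0 := by
    intro R lam hlam
    obtain ⟨K, hK, hb⟩ := radialDensity_expBounded l 0 lam hlam
    exact ⟨K, hK, fun _ _ _ => hb 0 zero_mem_closedSector (by simp)⟩
  have hGe : SingExpBounded {a} (densityCorrection l) := fun R lam hlam => by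
    obtain ⟨K, hK, hb⟩ := densityCorrection_singExpBounded l R lam hlam
    exact ⟨K, hK, fun b hb' => hb b (hTs hb')⟩
  have hes : SingExpBounded {a} fun b q => radialDensity l 0 q + a * densityCorrection l b q :=
    hv0e.singExpBounded.add (hGe.const_mul a)
  have hve := (radialDensity_expBounded l).mono hT
  have hds : SingExpBounded {a} fun b q => (radialDensity l 0 q + a * densityCorrection l b q) +
      c * radialDensity l b q := hes.add (hve.singExpBounded.const_mul c)
  -- Both sides of the claim solve f = 1 - (1/2) a log a + A_a f: in v_0 + aG the source of G
  -- cancels the remainder a s of A_a v_0. Their difference d is therefore a fixed point of the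
  -- contraction.
  have hdA : ∀ q, 0 < q → d q = volterraOp l a d q := by
    intro q hq
    rw [hd, volterraOp_add_smul l ha' c hec (hes.singBound (mem_singleton a)) hvc hvb hq, he,
      volterraOp_add_smul l ha' a hv0c hv0b hGc hGb hq, volterraOp_radialDensity_zero l ha hq]
    have h1 := radialDensity_eq l ha' hq
    have h2 := densityCorrection_eq l ha hq
    simp only
    linear_combination c * h1 + a * h2 + hc
  have hde := hds.volterraOp hT l
  obtain ⟨m, K, hm, hK, hb⟩ := hde.exists_expWeight l ‖a‖ one_lt_two
  have hz := hm.eq_zero (g := d) one_lt_two ha' le_rfl hK (fun q hq => by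
    rw [hdA q hq]
    exact hb a (mem_singleton a) le_rfl q hq) hdA hp
  simp only [hd, he] at hz
  linear_combination -hz + radialDensity l a p * hc

/-! ### Laplace transforms. -/

/-- Functions on `(0, ∞)` growing at most exponentially with every rate larger than one, with an
integrable singularity at `0`. -/
structure LaplaceAdmissible (f : ℝ → ℂ) : Prop where
  cont : ContinuousOn f (Ioi 0)
  bdd : ∀ lam : ℝ, 1 < lam → ∃ K : ℝ, 0 ≤ K ∧
    ∀ p, 0 < p → ‖f p‖ ≤ K * Real.exp (lam * p) * p ^ (-(1 / 2) : ℝ)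

/-- The integrand of the Laplace transform. -/
noncomputable def laplaceIntegrand (f : ℝ → ℂ) (t p : ℝ) : ℂ := (Real.exp (-(p * t)) : ℂ) * f p

/-- The Laplace transform. -/
noncomputable def laplace (f : ℝ → ℂ) (t : ℝ) : ℂ := ∫ p in Ioi (0 : ℝ), laplaceIntegrand f t p

theorem integrableOn_exp_rpow {δ : ℝ} (hδ : 0 < δ) :
    IntegrableOn (fun p : ℝ => Real.exp (-(δ * p)) * p ^ (-(1 / 2) : ℝ)) (Ioi 0) := by
  have h := integrableOn_rpow_mul_exp_neg_mul_rpow (s := -(1 / 2)) (p := 1) (by norm_num)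
    one_pos hδ
  refine h.congr_fun (fun p _ => ?_) measurableSet_Ioi
  simp only [Real.rpow_one]
  rw [mul_comm, neg_mul]

theorem laplaceIntegrand_continuousOn {f : ℝ → ℂ} (hf : ContinuousOn f (Ioi 0)) (t : ℝ) :
    ContinuousOn (laplaceIntegrand f t) (Ioi 0) :=
  (Continuous.continuousOn (by fun_prop)).mul hf

theorem laplaceIntegrand_measurable {f : ℝ → ℂ} (hf : ContinuousOn f (Ioi 0)) (t : ℝ) :
    AEStronglyMeasurable (laplaceIntegrand f t) (volume.restrict (Ioi 0)) :=
  (laplaceIntegrand_continuousOn hf t).aestronglyMeasurable measurableSet_Ioi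

theorem norm_laplaceIntegrand_le {f : ℝ → ℂ} {K lam t p : ℝ}
    (hf : ‖f p‖ ≤ K * Real.exp (lam * p) * p ^ (-(1 / 2) : ℝ)) :
    ‖laplaceIntegrand f t p‖ ≤ K * (Real.exp (-((t - lam) * p)) * p ^ (-(1 / 2) : ℝ)) := by
  unfold laplaceIntegrand
  rw [norm_mul, Complex.norm_real, Real.norm_of_nonneg (Real.exp_pos _).le]
  calc _ ≤ Real.exp (-(p * t)) * (K * Real.exp (lam * p) * p ^ (-(1 / 2) : ℝ)) := by gcongr
    _ = K * (Real.exp (-(p * t)) * Real.exp (lam * p) * p ^ (-(1 / 2) : ℝ)) := by ring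
    _ = _ := by
      rw [← Real.exp_add]
      ring_nf

theorem LaplaceAdmissible.integrable {f : ℝ → ℂ} (hf : LaplaceAdmissible f) {t : ℝ} (ht : 1 < t) :
    IntegrableOn (laplaceIntegrand f t) (Ioi 0) := by
  obtain ⟨K, hK, hb⟩ := hf.bdd ((1 + t) / 2) (by linarith)
  have hδ : 0 < t - (1 + t) / 2 := by linarith
  refine ((integrableOn_exp_rpow hδ).const_mul K).mono' (laplaceIntegrand_measurable hf.cont t) ?_
  exact (ae_restrict_iff' measurableSet_Ioi).2
    (Eventually.of_forall fun p hp => norm_laplaceIntegrand_le (hb p hp))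

theorem LaplaceAdmissible.mul_id {f : ℝ → ℂ} (hf : LaplaceAdmissible f) :
    LaplaceAdmissible fun p => p * f p := by
  refine ⟨(Continuous.continuousOn (by fun_prop)).mul hf.cont, fun lam hlam => ?_⟩
  obtain ⟨K, hK, hb⟩ := hf.bdd ((1 + lam) / 2) (by linarith)
  obtain ⟨C, hC, hw⟩ := exp_mul_one_add_pow_le (by linarith : (1 + lam) / 2 < lam) 1
  refine ⟨K * C, by positivity, fun p hp => ?_⟩
  rw [norm_mul, Complex.norm_real, Real.norm_of_nonneg hp.le]
  have h1 := hw p hp.le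
  rw [pow_one] at h1
  have h2 := Real.rpow_nonneg hp.le (-(1 / 2))
  have h3 := Real.exp_pos ((1 + lam) / 2 * p)
  calc _ ≤ p * (K * Real.exp ((1 + lam) / 2 * p) * p ^ (-(1 / 2) : ℝ)) := by
        gcongr
        exact hb p hp
    _ = K * (p * Real.exp ((1 + lam) / 2 * p)) * p ^ (-(1 / 2) : ℝ) := by ring
    _ ≤ K * (C * Real.exp (lam * p)) * p ^ (-(1 / 2) : ℝ) :=
        mul_le_mul_of_nonneg_right (mul_le_mul_of_nonneg_left (by nlinarith) hK) h2
    _ = _ := by ring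

theorem LaplaceAdmissible.hasDerivAt {f : ℝ → ℂ} (hf : LaplaceAdmissible f) {t : ℝ} (ht : 1 < t) :
    HasDerivAt (laplace f) (-laplace (fun p => p * f p) t) t := by
  -- On the ball of radius δ around t the variable exceeds 1 + δ; with growth rate 1 + δ/2 this
  -- leaves uniform decay e^{-δp/2}.
  set δ : ℝ := (t - 1) / 2 with hδ
  have hδ0 : 0 < δ := by linarith
  obtain ⟨K, hK, hb⟩ := hf.mul_id.bdd (1 + δ / 2) (by linarith)
  have key := hasDerivAt_integral_of_dominated_loc_of_deriv_le (𝕜 := ℝ)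
    (μ := volume.restrict (Ioi (0 : ℝ)))
    (F := fun t p => laplaceIntegrand f t p)
    (F' := fun t p => -laplaceIntegrand (fun p => p * f p) t p) (x₀ := t) (s := Metric.ball t δ)
    (bound := fun p => K * (Real.exp (-(δ / 2 * p)) * p ^ (-(1 / 2) : ℝ)))
    (Metric.ball_mem_nhds t hδ0)
    (Eventually.of_forall fun s => laplaceIntegrand_measurable hf.cont s)
    (hf.integrable ht) (laplaceIntegrand_measurable hf.mul_id.cont t).neg ?_
    ((integrableOn_exp_rpow (by positivity)).const_mul K) ?_
  · refine key.2.congr_deriv ?_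
    exact integral_neg _
  · refine (ae_restrict_iff' measurableSet_Ioi).2 (Eventually.of_forall fun p hp s hs => ?_)
    rw [norm_neg]
    refine (norm_laplaceIntegrand_le (hb p hp)).trans ?_
    have hp' : 0 < p := hp
    rw [Metric.mem_ball, Real.dist_eq, abs_lt] at hs
    have h2 := Real.rpow_nonneg hp'.le (-(1 / 2))
    have h3 : Real.exp (-((s - (1 + δ / 2)) * p)) ≤ Real.exp (-(δ / 2 * p)) := by
      refine Real.exp_le_exp.2 ?_
      have : δ / 2 ≤ s - (1 + δ / 2) := by linarith [hs.1]
      nlinarith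
    gcongr
  · refine Eventually.of_forall fun p s _ => ?_
    unfold laplaceIntegrand
    have h1 : HasDerivAt (fun s : ℝ => Real.exp (-(p * s))) (Real.exp (-(p * s)) * (-p)) s := by
      simpa using (((hasDerivAt_id s).const_mul p).fun_neg).exp
    refine (h1.ofReal_comp.mul_const (f p)).congr_deriv ?_
    push_cast
    ring

theorem norm_laplace_le {f : ℝ → ℂ} {t : ℝ} {g : ℝ → ℝ}
    (hg : IntegrableOn g (Ioi 0)) (h : ∀ p, 0 < p → ‖laplaceIntegrand f t p‖ ≤ g p) :
    ‖laplace f t‖ ≤ ∫ p in Ioi (0 : ℝ), g p :=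
  norm_integral_le_of_norm_le hg ((ae_restrict_iff' measurableSet_Ioi).2 (Eventually.of_forall h))

/-- Laplace transforms of holomorphic families are holomorphic in the parameter. -/
theorem HoloFamily.laplace {f : ℂ → ℝ → ℂ} (hf : HoloFamily f) (hb : SingExpBounded sector f)
    {t : ℝ} (ht : 1 < t) : DifferentiableOn ℂ (fun a => laplace (f a) t) sector ∧
    Tendsto (fun a => laplace (f a) t) (𝓝[sector] 0) (𝓝 (laplace (f 0) t)) := by
  have hlam : 1 < (1 + t) / 2 := by linarith
  have hδ : 0 < t - (1 + t) / 2 := by linarith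
  have hbd : ∀ R : ℝ, ∃ K : ℝ, ∀ a ∈ sector, ‖a‖ ≤ R → ∀ p, 0 < p →
      ‖laplaceIntegrand (f a) t p‖ ≤
        K * (Real.exp (-((t - (1 + t) / 2) * p)) * p ^ (-(1 / 2) : ℝ)) := by
    intro R
    obtain ⟨K, hK, hb⟩ := hb R _ hlam
    exact ⟨K, fun a ha haR p hp => norm_laplaceIntegrand_le (hb a ha haR p hp p ⟨hp, le_rfl⟩)⟩
  constructor
  · intro a₀ ha₀
    obtain ⟨K, hK⟩ := hbd (‖a₀‖ + 1)
    set U : Set ℂ := sector ∩ Metric.ball 0 (‖a₀‖ + 1) with hU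
    have hUo : IsOpen U := isOpen_sector.inter Metric.isOpen_ball
    have ha₀U : a₀ ∈ U := ⟨ha₀, by simp⟩
    have hUn : ∀ a ∈ U, ‖a‖ ≤ ‖a₀‖ + 1 := fun a ha => by
      have := ha.2
      rw [mem_ball_zero_iff] at this
      exact this.le
    have key := differentiableOn_integral_of_dominated (μ := volume.restrict (Ioi (0 : ℝ))) hUo
      (F := fun a p => laplaceIntegrand (f a) t p)
      (fun a ha => laplaceIntegrand_measurable (hf.cont a ha.1) t)
      ((ae_restrict_iff' measurableSet_Ioi).2
        (Eventually.of_forall fun p hp => ((hf.holo p hp).const_mul _).mono inter_subset_left))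
      ((ae_restrict_iff' measurableSet_Ioi).2
        (Eventually.of_forall fun p hp a ha => hK a ha.1 (hUn a ha) p hp))
      ((integrableOn_exp_rpow hδ).const_mul K)
    exact ((key a₀ ha₀U).differentiableAt (hUo.mem_nhds ha₀U)).differentiableWithinAt
  · obtain ⟨K, hK⟩ := hbd 1
    have hev : ∀ᶠ a in 𝓝[sector] (0 : ℂ), a ∈ sector ∧ ‖a‖ ≤ 1 := by
      refine (eventually_mem_nhdsWithin).and (nhdsWithin_le_nhds ?_)
      filter_upwards [Metric.closedBall_mem_nhds (0 : ℂ) one_pos] with a ha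
      simpa using ha
    refine tendsto_integral_filter_of_dominated_convergence _ ?_ ?_
      ((integrableOn_exp_rpow hδ).const_mul K) ?_
    · filter_upwards [hev] with a ha using laplaceIntegrand_measurable (hf.cont a ha.1) t
    · filter_upwards [hev] with a ha
      exact (ae_restrict_iff' measurableSet_Ioi).2
        (Eventually.of_forall fun p hp => hK a ha.1 ha.2 p hp)
    · exact (ae_restrict_iff' measurableSet_Ioi).2
        (Eventually.of_forall fun p hp => (hf.lim p hp).const_mul _)

/-! ### The Laplace density of the Jost solution and the radial equation. -/

theorem SingExpBounded.laplaceAdmissible {T : Set ℂ} {f : ℂ → ℝ → ℂ} (hf : SingExpBounded T f)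
    {a : ℂ} (ha : a ∈ T) (hc : ContinuousOn (f a) (Ioi 0)) : LaplaceAdmissible (f a) := by
  refine ⟨hc, fun lam hlam => ?_⟩
  obtain ⟨K, hK, hb⟩ := hf ‖a‖ lam hlam
  exact ⟨K, hK, fun p hp => hb a ha le_rfl p hp p ⟨hp, le_rfl⟩⟩

theorem norm_legForm_le (l : ℕ) (R : ℝ) : ∃ C : ℝ, 0 < C ∧ ∀ a : ℂ, ‖a‖ ≤ R → ∀ p, 0 ≤ p →
    ‖legForm l (p : ℝ) a‖ ≤ C * (1 + p) ^ l ∧ ‖legFormD l (p : ℝ) a‖ ≤ C * (1 + p) ^ l := by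
  obtain ⟨C, hC, hup⟩ := legForm_upper l
  set D : ℝ := ∑ k ∈ Finset.range (l + 1), ‖legCoeff l k * k‖
  refine ⟨(C + D) * (1 + |R|) ^ l, by positivity, fun a haR p hp => ?_⟩
  have haR' : ‖a‖ ≤ |R| := haR.trans (le_abs_self R)
  have hR := abs_nonneg R
  have hpn : ‖(p : ℂ)‖ = p := by rw [Complex.norm_real, Real.norm_of_nonneg hp]
  have hX : (1 + |R| + p) ^ l ≤ (1 + |R|) ^ l * (1 + p) ^ l := by
    rw [← mul_pow]
    gcongr
    nlinarith
  have hp1 : ‖(p : ℂ)‖ ≤ 1 + |R| + p := by rw [hpn]; linarith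
  have ha1 : ‖a‖ ≤ 1 + |R| + p := by linarith
  have hD : 0 ≤ D := by positivity
  have hY : 0 ≤ (1 + |R|) ^ l * (1 + p) ^ l := by positivity
  constructor
  · refine (hup _ _ _ hp1 ha1).1.trans ?_
    rw [mul_assoc]
    calc _ ≤ C * ((1 + |R|) ^ l * (1 + p) ^ l) := by gcongr
      _ ≤ _ := by gcongr; linarith
  · have h1 : ‖legFormD l (p : ℝ) a‖ ≤ D * (1 + |R| + p) ^ l := by
      unfold legFormD
      rw [Finset.sum_mul]
      refine norm_sum_le_of_le _ fun k hk => ?_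
      have hk' := Finset.mem_range.1 hk
      rw [← mul_assoc, norm_mul, norm_mul, norm_pow, norm_pow, mul_assoc]
      refine mul_le_mul_of_nonneg_left ?_ (norm_nonneg _)
      calc _ ≤ (1 + |R| + p) ^ (k - 1) * (1 + |R| + p) ^ (l - k) := by gcongr
        _ = (1 + |R| + p) ^ (k - 1 + (l - k)) := by rw [← pow_add]
        _ ≤ (1 + |R| + p) ^ l := pow_le_pow_right₀ (by linarith) (by omega)
    refine h1.trans ?_
    rw [mul_assoc]
    calc _ ≤ D * ((1 + |R|) ^ l * (1 + p) ^ l) := by gcongr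
      _ ≤ _ := by gcongr; linarith

theorem SingExpBounded.legForm_mul {T : Set ℂ} {f : ℂ → ℝ → ℂ} (hf : SingExpBounded T f) (l : ℕ) :
    SingExpBounded T fun a p => legForm l p a * f a p := by
  intro R lam hlam
  obtain ⟨K, hK, hb⟩ := hf R ((1 + lam) / 2) (by linarith)
  obtain ⟨C, hC, hw⟩ := exp_mul_one_add_pow_le (by linarith : (1 + lam) / 2 < lam) l
  obtain ⟨D, hD, hl⟩ := norm_legForm_le l R
  refine ⟨D * K * C, by positivity, fun a ha haR P hP q hq => ?_⟩
  rw [norm_mul]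
  have h1 := (hl a haR q hq.1.le).1
  have h2 := hb a ha haR P hP q hq
  have h3 := hw P hP.le
  have h4 := Real.rpow_nonneg hq.1.le (-(1 / 2))
  have h5 : (1 + q) ^ l ≤ (1 + P) ^ l := by
    have := hq.1
    gcongr
    exact hq.2
  calc _ ≤ (D * (1 + P) ^ l) * (K * Real.exp ((1 + lam) / 2 * P) * q ^ (-(1 / 2) : ℝ)) := by
        refine mul_le_mul (h1.trans ?_) h2 (norm_nonneg _) (by positivity)
        gcongr
    _ = D * K * ((1 + P) ^ l * Real.exp ((1 + lam) / 2 * P)) * q ^ (-(1 / 2) : ℝ) := by ring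
    _ ≤ D * K * (C * Real.exp (lam * P)) * q ^ (-(1 / 2) : ℝ) := by gcongr
    _ = _ := by ring

theorem continuous_legForm_ofReal (l : ℕ) (a : ℂ) : Continuous fun p : ℝ => legForm l p a :=
  continuous_iff_continuousAt.2 fun p => (legForm_hasDerivAt_ofReal l p a).continuousAt

theorem HoloFamily.legForm_mul {f : ℂ → ℝ → ℂ} (hf : HoloFamily f) (l : ℕ) :
    HoloFamily fun a p => legForm l p a * f a p := by
  refine hf.mul (m := fun a p => legForm l p a)
    (fun a _ => (continuous_legForm_ofReal l a).continuousOn) (fun R P _ => ?_)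
    (fun q _ => (differentiable_legForm_right l q).differentiableOn)
    fun q _ => (differentiable_legForm_right l q 0).continuousAt.tendsto.mono_left
      nhdsWithin_le_nhds
  obtain ⟨C, hC, h⟩ := norm_legForm_le l R
  refine ⟨C * (1 + P) ^ l, fun a _ haR q hq => ((h a haR q hq.1.le).1).trans ?_⟩
  have := hq.1
  gcongr
  exact hq.2

/-- The Laplace density of the decaying solution of the radial equation. -/
noncomputable def jostDensity (l : ℕ) (a : ℂ) (p : ℝ) : ℂ := legForm l p a * radialDensity l a p

theorem jostDensity_singExpBounded (l : ℕ) : SingExpBounded closedSector (jostDensity l) :=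
  (radialDensity_expBounded l).singExpBounded.legForm_mul l

theorem jostDensity_holoFamily (l : ℕ) : HoloFamily (jostDensity l) :=
  (radialDensity_holoFamily l).legForm_mul l

theorem jostDensity_admissible (l : ℕ) {a : ℂ} (ha : a ∈ closedSector) :
    LaplaceAdmissible (jostDensity l a) :=
  (jostDensity_singExpBounded l).laplaceAdmissible ha
    ((continuous_legForm_ofReal l a).continuousOn.mul (radialDensity_continuousOn l ha))

/-- The integral entering the derivative of the Laplace density. -/
noncomputable def densityMoment (l : ℕ) (a : ℂ) : ℝ → ℂ :=
  primitive fun s => s * legForm l s a * legFormH l s a * radialDensity l a s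

theorem continuous_legFormH_ofReal (l : ℕ) (a : ℂ) : Continuous fun p : ℝ => legFormH l p a :=
  Continuous.comp (g := fun x : ℂ × ℂ => legFormH l x.1 x.2)
    (f := fun p : ℝ => ((p : ℂ), a)) (continuous_legFormH l) (by fun_prop)

theorem densityMoment_hasDerivAt (l : ℕ) {a : ℂ} (ha : a ∈ closedSector) {p : ℝ} (hp : 0 < p) :
    HasDerivAt (densityMoment l a)
      (p * legForm l p a * legFormH l p a * radialDensity l a p) p := by
  have hg : Continuous fun s : ℝ => (s : ℂ) * legForm l s a * legFormH l s a :=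
    ((Complex.continuous_ofReal).mul (continuous_legForm_ofReal l a)).mul
      (continuous_legFormH_ofReal l a)
  obtain ⟨C, hC⟩ := isCompact_Icc.exists_bound_of_continuousOn (hg.continuousOn (s := Icc 0 p))
  obtain ⟨K, hK⟩ := radialDensity_singBound l ha p hp
  refine hasDerivAt_primitive (f := fun s : ℝ => s * legForm l s a * legFormH l s a *
    radialDensity l a s) (K := C * K) (hg.continuousOn.mul (radialDensity_continuousOn l ha))
    hp fun q hq => ?_
  have h1 := hC q (Ioc_subset_Icc_self hq)
  rw [norm_mul, mul_assoc C]
  exact mul_le_mul h1 (hK q hq) (norm_nonneg _) ((norm_nonneg _).trans h1)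

/-- Substitute s = σq. In this form the derivative of the density is a multiplier term minus a
quotient of the moment by p(p+a)P². -/
theorem kernelAvg_radialDensity (l : ℕ) (a : ℂ) {q : ℝ} (hq : 0 < q) :
    kernelAvg (fun σ q => volterraKernel l σ q a) (radialDensity l a) q =
      densityMoment l a q / (q * (q + a) * legForm l q a ^ 2) := by
  set y : ℝ → ℂ := fun s => s * legForm l s a * legFormH l s a * radialDensity l a s with hy
  have h1 : ∫ σ in (0 : ℝ)..1, y (σ * q) = (q : ℂ)⁻¹ * densityMoment l a q := by
    rw [intervalIntegral.integral_comp_mul_right y hq.ne', zero_mul, one_mul]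
    simp [densityMoment, primitive, hy]
  have h2 : ∀ σ : ℝ, volterraKernel l σ q a * radialDensity l a (σ * q) =
      ((q + a) * legForm l q a ^ 2)⁻¹ * y (σ * q) := by
    intro σ
    simp only [hy, volterraKernel, Complex.ofReal_mul]
    rw [div_eq_mul_inv]
    ring
  unfold kernelAvg
  simp_rw [h2]
  rw [intervalIntegral.integral_const_mul, h1, div_eq_mul_inv, mul_assoc (q : ℂ) (q + a),
    mul_inv (q : ℂ) _]
  ring

theorem tendsto_mul_exp_neg {δ : ℝ} (hδ : 0 < δ) :
    Tendsto (fun p : ℝ => p * Real.exp (-(δ * p))) atTop (𝓝 0) := by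
  have h := (Real.tendsto_pow_mul_exp_neg_atTop_nhds_zero 1).comp (tendsto_id.const_mul_atTop hδ)
  have h2 := h.const_mul δ⁻¹
  simp only [mul_zero] at h2
  refine h2.congr fun p => ?_
  simp only [Function.comp, pow_one, id]
  field_simp

/-- The potential whose derivative is the radial equation in Laplace space. -/
noncomputable def radialFlux (l : ℕ) (a : ℂ) (t p : ℝ) : ℂ :=
  (Real.exp (-(p * t)) : ℂ) * (densityMoment l a p / legForm l p a -
    p * (p + a) * legFormD l p a * radialDensity l a p -
    t * (p * (p + a)) * (legForm l p a * radialDensity l a p))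

/-- Inserting the formula for v' makes every occurrence of the nonlocal `densityMoment` cancel, and
Legendre's equation replaces the derivative of p(p+a)P' by l(l+1)P. What remains is local, and its
coefficients are those of the radial equation. -/
theorem radialFlux_hasDerivAt (l : ℕ) {a : ℂ} (ha : a ∈ closedSector) (t : ℝ) {p : ℝ}
    (hp : 0 < p) : HasDerivAt (radialFlux l a t)
      ((Real.exp (-(p * t)) : ℂ) * (jostDensity l a p *
        ((t ^ 2 - t) * p ^ 2 + a * t ^ 2 * p - 2 * t * p - t * a + p - l * (l + 1)))) p := by
  have hpi : legForm l p a ≠ 0 := legForm_ne_zero l ha hp.le (by linarith [norm_nonneg a])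
  have hpa := add_ne_zero_of_mem ha hp
  have hp' : (p : ℂ) ≠ 0 := by exact_mod_cast hp.ne'
  have hexp : HasDerivAt (fun p : ℝ => (Real.exp (-(p * t)) : ℂ))
      ((Real.exp (-(p * t)) * (-t) : ℝ) : ℂ) p := by
    have h1 : HasDerivAt (fun p : ℝ => -(p * t)) (-t) p := by
      simpa using ((hasDerivAt_id p).mul_const t).fun_neg
    exact h1.exp.ofReal_comp
  have hid : HasDerivAt (fun p : ℝ => (p : ℂ)) 1 p := Complex.ofRealCLM.hasDerivAt (x := p)
  have hY := densityMoment_hasDerivAt l ha hp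
  have hP := legForm_hasDerivAt_ofReal l p a
  have hE : HasDerivAt (fun p : ℝ => (p : ℂ) * (p + a) * legFormD l p a)
      (l * (l + 1) * legForm l p a) p := (legForm_legendre l p a).comp_ofReal
  have hv := radialDensity_hasDerivAt l ha hp
  have hpp : HasDerivAt (fun p : ℝ => (p : ℂ) * (p + a)) (1 * (p + a) + p * 1) p :=
    hid.mul (hid.add_const a)
  have hvp : volterraIntegrand l a (radialDensity l a) p = p / (p + a) * radialDensity l a p -
      densityMoment l a p / (p * (p + a) * legForm l p a ^ 2) := by
    rw [← kernelAvg_radialDensity l a hp]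
    rfl
  have key := hexp.mul (((hY.div hP hpi).sub (hE.mul hv)).sub
    ((hpp.const_mul (t : ℂ)).mul (hP.mul hv)))
  refine key.congr_deriv ?_
  simp only [Pi.mul_apply, Pi.sub_apply, Pi.div_apply]
  rw [hvp, legFormH_eq, jostDensity]
  push_cast
  field_simp
  ring

/-- This makes the boundary terms at 0 and at ∞ vanish when the flux derivative is integrated. -/
theorem radialFlux_bound (l : ℕ) {a : ℂ} (ha : a ∈ closedSector) {t : ℝ} (ht : 1 < t) :
    ∃ C δ : ℝ, 0 < δ ∧ ∀ p, 0 < p → ‖radialFlux l a t p‖ ≤ C * (p * Real.exp (-(δ * p))) := by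
  -- This rate lies strictly between 1 and (1+t)/2; the second gap absorbs the powers of 1 + p,
  -- leaving decay of rate (t-1)/2.
  set lam : ℝ := (3 + t) / 4 with hlam
  have hlam1 : 1 < lam := by linarith
  obtain ⟨K, hK, hb⟩ := radialDensity_expBounded l ‖a‖ lam hlam1
  obtain ⟨D, hD, hw⟩ := volterraIntegrand_weight_le l ‖a‖
  obtain ⟨C, hC, hl⟩ := norm_legForm_le l ‖a‖
  obtain ⟨M, hM, hexp⟩ := exp_mul_one_add_pow_le (by linarith : lam < (1 + t) / 2) (l + 1)
  refine ⟨(1 + ‖a‖) * C * (2 * K + K * (1 + D) + K + |t| * K) * M, (t - 1) / 2, by linarith,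
    fun p hp => ?_⟩
  have hpi : legForm l p a ≠ 0 := legForm_ne_zero l ha hp.le (by linarith [norm_nonneg a])
  have hpa := add_ne_zero_of_mem ha hp
  have hp' : (p : ℂ) ≠ 0 := by exact_mod_cast hp.ne'
  set A := kernelAvg (fun σ q => volterraKernel l σ q a) (radialDensity l a) p with hA
  -- Expressing the moment through the kernel average exhibits a factor p(p+a) common to all three
  -- terms of the flux.
  have hid : densityMoment l a p / legForm l p a = p * (p + a) * (legForm l p a * A) := by
    rw [hA, kernelAvg_radialDensity l a hp]
    field_simp
  have hv := hb a ha le_rfl p hp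
  have hAn : ‖A‖ ≤ (2 * K + K * (1 + D)) * Real.exp (lam * p) := by
    have h1 : A = p / (p + a) * radialDensity l a p -
        volterraIntegrand l a (radialDensity l a) p := by
      unfold volterraIntegrand
      rw [hA]
      ring
    have h2 := hw lam 0 hlam1.le a ha le_rfl (radialDensity l a) K hK
      (fun q hq => by simpa [expWeight] using hb a ha le_rfl q hq) p hp
    simp only [expWeight, pow_zero, mul_one] at h2
    have h3 : D / (1 + p) ≤ D := div_le_self hD.le (by linarith)
    have h4 : 0 ≤ D / (1 + p) := by positivity
    rw [h1]
    calc _ ≤ ‖(p : ℂ) / (p + a) * radialDensity l a p‖ +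
          ‖volterraIntegrand l a (radialDensity l a) p‖ := norm_sub_le _ _
      _ ≤ 2 * (K * Real.exp (lam * p)) + K * ((1 + D) * Real.exp (lam * p)) := by
          rw [norm_mul]
          refine add_le_add (mul_le_mul (norm_div_add_le ha hp) hv (norm_nonneg _) zero_le_two)
            (h2.trans ?_)
          gcongr
      _ = _ := by ring
  obtain ⟨h1, h2⟩ := hl a le_rfl p hp.le
  have hna := norm_nonneg a
  have hpan : ‖(p : ℂ) + a‖ ≤ (1 + ‖a‖) * (1 + p) := by
    refine (norm_add_le _ _).trans ?_
    rw [Complex.norm_real, Real.norm_of_nonneg hp.le]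
    nlinarith
  have hfac : radialFlux l a t p = (Real.exp (-(p * t)) : ℂ) * (p * (p + a)) *
      (legForm l p a * A - legFormD l p a * radialDensity l a p -
        t * (legForm l p a * radialDensity l a p)) := by
    unfold radialFlux
    rw [hid]
    ring
  have hlast : ‖legForm l p a * A - legFormD l p a * radialDensity l a p -
        t * (legForm l p a * radialDensity l a p)‖ ≤
      C * (1 + p) ^ l * ((2 * K + K * (1 + D) + K + |t| * K) * Real.exp (lam * p)) := by
    have hX : 0 ≤ C * (1 + p) ^ l := by positivity
    have e1 := mul_le_mul h1 hAn (norm_nonneg _) hX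
    have e2 := mul_le_mul h2 hv (norm_nonneg _) hX
    have e3 := mul_le_mul h1 hv (norm_nonneg _) hX
    have e4 := mul_le_mul_of_nonneg_left e3 (abs_nonneg t)
    have n1 := norm_sub_le (legForm l p a * A - legFormD l p a * radialDensity l a p)
      (t * (legForm l p a * radialDensity l a p))
    have n2 := norm_sub_le (legForm l p a * A) (legFormD l p a * radialDensity l a p)
    have n3 : ‖(t : ℂ) * (legForm l p a * radialDensity l a p)‖ =
        |t| * (‖legForm l p a‖ * ‖radialDensity l a p‖) := by
      rw [norm_mul, norm_mul, Complex.norm_real, Real.norm_eq_abs]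
    rw [norm_mul, norm_mul] at n2
    linarith
  rw [hfac, norm_mul, norm_mul, norm_mul, Complex.norm_real, Complex.norm_real,
    Real.norm_of_nonneg (Real.exp_pos _).le, Real.norm_of_nonneg hp.le]
  have h5 := hexp p hp.le
  calc _ ≤ Real.exp (-(p * t)) * (p * ((1 + ‖a‖) * (1 + p))) * (C * (1 + p) ^ l *
        ((2 * K + K * (1 + D) + K + |t| * K) * Real.exp (lam * p))) := by gcongr
    _ = (1 + ‖a‖) * C * (2 * K + K * (1 + D) + K + |t| * K) * Real.exp (-(p * t)) * p *
        ((1 + p) ^ (l + 1) * Real.exp (lam * p)) := by ring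
    _ ≤ (1 + ‖a‖) * C * (2 * K + K * (1 + D) + K + |t| * K) * Real.exp (-(p * t)) * p *
        (M * Real.exp ((1 + t) / 2 * p)) := by gcongr
    _ = (1 + ‖a‖) * C * (2 * K + K * (1 + D) + K + |t| * K) * M *
        (p * (Real.exp (-(p * t)) * Real.exp ((1 + t) / 2 * p))) := by ring
    _ = _ := by
      rw [← Real.exp_add]
      ring_nf

/-- The radial equation satisfied by the Laplace transform of the Jost density. -/
theorem laplace_jostDensity_radial (l : ℕ) {a : ℂ} (ha : a ∈ closedSector) {t : ℝ} (ht : 1 < t) :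
    ((t : ℂ) ^ 2 - t) * laplace (fun p => p * (p * jostDensity l a p)) t +
      (a * t ^ 2 - 2 * t + 1) * laplace (fun p => p * jostDensity l a p) t -
      (t * a + l * (l + 1)) * laplace (jostDensity l a) t = 0 := by
  have hF := jostDensity_admissible l ha
  have i0 := hF.integrable ht
  have i1 := hF.mul_id.integrable ht
  have i2 := hF.mul_id.mul_id.integrable ht
  obtain ⟨C, δ, hδ, hb⟩ := radialFlux_bound l ha ht
  -- With the value at 0 set to the limit, continuity at the endpoint follows from the bound alone.
  set Z : ℝ → ℂ := Function.update (radialFlux l a t) 0 0 with hZ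
  have hZp : ∀ p, 0 < p → Z p = radialFlux l a t p := fun p hp =>
    Function.update_of_ne hp.ne' _ _
  have hZ0 : Z 0 = 0 := Function.update_self _ _ _
  have hZb : ∀ p, 0 ≤ p → ‖Z p‖ ≤ C * (p * Real.exp (-(δ * p))) := by
    intro p hp
    rcases hp.eq_or_lt with rfl | h
    · simp [hZ0]
    · rw [hZp p h]
      exact hb p h
  have hcont : ContinuousWithinAt Z (Ici 0) 0 := by
    unfold ContinuousWithinAt
    rw [hZ0]
    refine squeeze_zero_norm' (a := fun p => C * (p * Real.exp (-(δ * p)))) ?_ ?_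
    · filter_upwards [self_mem_nhdsWithin] with p hp using hZb p hp
    · refine tendsto_nhdsWithin_of_tendsto_nhds ?_
      have : Continuous fun p : ℝ => C * (p * Real.exp (-(δ * p))) := by fun_prop
      simpa using this.tendsto 0
  have htop : Tendsto Z atTop (𝓝 0) := by
    refine squeeze_zero_norm' (a := fun p => C * (p * Real.exp (-(δ * p)))) ?_ ?_
    · filter_upwards [eventually_ge_atTop 0] with p hp using hZb p hp
    · simpa using (tendsto_mul_exp_neg hδ).const_mul C
  have hder : ∀ p ∈ Ioi (0 : ℝ), HasDerivAt Z
      (((t : ℂ) ^ 2 - t) * laplaceIntegrand (fun p => p * (p * jostDensity l a p)) t p +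
      (a * t ^ 2 - 2 * t + 1) * laplaceIntegrand (fun p => p * jostDensity l a p) t p +
      (-(t * a + l * (l + 1))) * laplaceIntegrand (jostDensity l a) t p) p := by
    intro p hp
    refine ((radialFlux_hasDerivAt l ha t hp).congr_of_eventuallyEq ?_).congr_deriv ?_
    · filter_upwards [Ioi_mem_nhds hp] with q hq using hZp q hq
    · unfold laplaceIntegrand
      ring
  have j2 := i2.const_mul ((t : ℂ) ^ 2 - t)
  have j1 := i1.const_mul (a * t ^ 2 - 2 * t + 1)
  have j0 := i0.const_mul (-(t * a + l * (l + 1)))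
  have j21 : Integrable (fun p => ((t : ℂ) ^ 2 - t) *
      laplaceIntegrand (fun p => p * (p * jostDensity l a p)) t p +
      (a * t ^ 2 - 2 * t + 1) * laplaceIntegrand (fun p => p * jostDensity l a p) t p)
      (volume.restrict (Ioi 0)) := j2.add j1
  have key := integral_Ioi_of_hasDerivAt_of_tendsto hcont hder (j21.add j0) htop
  rw [integral_add j21 j0, integral_add j2 j1, integral_const_mul, integral_const_mul,
    integral_const_mul, hZ0] at key
  unfold laplace
  linear_combination key

/-! ### Behaviour of the Laplace transforms for large t. -/

theorem laplace_const (c : ℂ) {t : ℝ} (ht : 0 < t) : laplace (fun _ => c) t = c / t := by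
  unfold laplace laplaceIntegrand
  rw [integral_mul_const, integral_complex_ofReal]
  have h := integral_exp_mul_Ioi (a := -t) (by linarith) 0
  have h2 : (fun p : ℝ => Real.exp (-(p * t))) = fun p => Real.exp (-t * p) := by
    funext p
    ring_nf
  rw [h2, h]
  simp
  ring

theorem integrableOn_laplaceIntegrand_const (c : ℂ) {t : ℝ} (ht : 0 < t) :
    IntegrableOn (laplaceIntegrand (fun _ => c) t) (Ioi 0) := by
  have h := integrableOn_exp_mul_Ioi (a := -t) (by linarith) 0
  have h2 : (fun p : ℝ => Real.exp (-(p * t))) = fun p => Real.exp (-t * p) := by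
    funext p
    ring_nf
  unfold laplaceIntegrand
  rw [← h2] at h
  exact (Integrable.ofReal h).mul_const c

/-- A density that is O(p) at the origin has a transform of order (t-λ)^{-2}, so the factor t is
harmless. -/
theorem tendsto_mul_laplace_zero {f : ℝ → ℂ} {K lam : ℝ} (hK : 0 ≤ K)
    (hf : ∀ p, 0 < p → ‖f p‖ ≤ K * (p * Real.exp (lam * p))) :
    Tendsto (fun t : ℝ => (t : ℂ) * laplace f t) atTop (𝓝 0) := by
  have hlim : Tendsto (fun s : ℝ => 4 * K * ((s + lam) / s ^ 2)) atTop (𝓝 0) := by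
    have h1 : Tendsto (fun s : ℝ => s⁻¹ + lam * (s⁻¹ * s⁻¹)) atTop (𝓝 (0 + lam * (0 * 0))) :=
      tendsto_inv_atTop_zero.add
        ((tendsto_inv_atTop_zero.mul tendsto_inv_atTop_zero).const_mul lam)
    have h2 := h1.const_mul (4 * K)
    simp only [mul_zero, add_zero] at h2
    refine h2.congr' ?_
    filter_upwards [eventually_gt_atTop 0] with s hs
    field_simp
  have hlim' := hlim.comp (tendsto_atTop_add_const_right atTop (-lam) tendsto_id)
  refine squeeze_zero_norm' ?_ hlim'
  filter_upwards [eventually_gt_atTop (max 0 lam)] with t ht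
  have ht0 : 0 < t := (le_max_left _ _).trans_lt ht
  have hs : 0 < t - lam := by linarith [(le_max_right 0 lam).trans_lt ht]
  set s := t - lam with hsdef
  have hg := integrableOn_exp_mul_Ioi (a := -(s / 2)) (by linarith) 0
  have h1 := norm_laplace_le (f := f) (t := t) (hg.const_mul (K * (2 / s))) fun p hp => by
    unfold laplaceIntegrand
    rw [norm_mul, Complex.norm_real, Real.norm_of_nonneg (Real.exp_pos _).le]
    -- The factor p is traded for half of the available decay s = t - λ.
    have h2 : p ≤ 2 / s * Real.exp (s / 2 * p) := by
      have := (Real.add_one_le_exp (s / 2 * p))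
      calc p = 2 / s * (s / 2 * p) := by field_simp
        _ ≤ _ := by
          gcongr
          linarith
    calc _ ≤ Real.exp (-(p * t)) * (K * ((2 / s * Real.exp (s / 2 * p)) *
          Real.exp (lam * p))) := by
          gcongr
          exact (hf p hp).trans (by gcongr)
      _ = K * (2 / s) * (Real.exp (-(p * t)) * Real.exp (s / 2 * p) * Real.exp (lam * p)) := by
          ring
      _ = _ := by
          rw [← Real.exp_add, ← Real.exp_add, hsdef]
          ring_nf
  rw [integral_const_mul, integral_exp_mul_Ioi (a := -(s / 2)) (by linarith) 0] at h1
  rw [norm_mul, Complex.norm_real, Real.norm_of_nonneg ht0.le]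
  simp only [mul_zero, Real.exp_zero] at h1
  simp only [Function.comp, id]
  calc _ ≤ t * (K * (2 / s) * (-1 / -(s / 2))) := by gcongr
    _ = 4 * K * (t / s ^ 2) := by
      field_simp
      ring
    _ = _ := by
      rw [hsdef]
      ring_nf

theorem norm_jostDensity_sub_le (l : ℕ) {a : ℂ} (ha : a ∈ closedSector) :
    ∃ K : ℝ, 0 ≤ K ∧ ∀ p, 0 < p → ‖jostDensity l a p - a ^ l‖ ≤ K * (p * Real.exp (2 * p)) := by
  obtain ⟨K, hK, hv⟩ := norm_radialDensity_sub_one_le l ha (by norm_num : (1 : ℝ) < 3 / 2)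
  obtain ⟨C, hC, hl⟩ := norm_legForm_le l ‖a‖
  obtain ⟨M, hM, hexp⟩ := exp_mul_one_add_pow_le (by norm_num : (3 / 2 : ℝ) < 2) l
  refine ⟨C * K * M + C * M, by positivity, fun p hp => ?_⟩
  have h1 : jostDensity l a p - a ^ l =
      legForm l p a * (radialDensity l a p - 1) + (legForm l p a - legForm l (0 : ℝ) a) := by
    rw [jostDensity, Complex.ofReal_zero, legForm_zero_left]
    ring
  have h2 : ‖legForm l p a - legForm l (0 : ℝ) a‖ ≤ C * (1 + p) ^ l * (p - 0) := by
    refine norm_image_sub_le_of_norm_deriv_le_segment' (f := fun q : ℝ => legForm l q a)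
      (fun q _ => (legForm_hasDerivAt_ofReal l q a).hasDerivWithinAt) (fun q hq => ?_) p
      (right_mem_Icc.2 hp.le)
    refine (hl a le_rfl q hq.1).2.trans ?_
    have h0 : (0 : ℝ) ≤ q := hq.1
    have h3 := hq.2.le
    gcongr
  have h3 := hexp p hp.le
  have h4 : (1 + p) ^ l ≤ M * Real.exp (2 * p) := by
    refine le_trans ?_ h3
    exact le_mul_of_one_le_right (by positivity) (Real.one_le_exp (by positivity))
  rw [h1]
  calc _ ≤ ‖legForm l p a‖ * ‖radialDensity l a p - 1‖ + _ :=
        (norm_add_le _ _).trans (by rw [norm_mul])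
    _ ≤ (C * (1 + p) ^ l) * (K * p * Real.exp (3 / 2 * p)) + C * (1 + p) ^ l * (p - 0) := by
        gcongr
        · exact (hl a le_rfl p hp.le).1
        · exact hv p hp
    _ = C * K * p * ((1 + p) ^ l * Real.exp (3 / 2 * p)) + C * p * (1 + p) ^ l := by ring
    _ ≤ C * K * p * (M * Real.exp (2 * p)) + C * p * (M * Real.exp (2 * p)) := by gcongr
    _ = _ := by ring

/-- An Abelian statement: the limit is the value of the density at p = 0+, where P = a^l and v = 1.
It fixes the normalization a^{-l} of the Jost solution. -/
theorem tendsto_mul_laplace_jostDensity (l : ℕ) {a : ℂ} (ha : a ∈ closedSector) :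
    Tendsto (fun t : ℝ => (t : ℂ) * laplace (jostDensity l a) t) atTop (𝓝 (a ^ l)) := by
  obtain ⟨K, hK, hb⟩ := norm_jostDensity_sub_le l ha
  have h := (tendsto_mul_laplace_zero hK hb).add_const (a ^ l)
  rw [zero_add] at h
  refine h.congr' ?_
  filter_upwards [eventually_gt_atTop 1] with t ht
  have ht0 : (t : ℂ) ≠ 0 := by exact_mod_cast (by linarith : t ≠ 0)
  have h1 : laplace (fun p => jostDensity l a p - a ^ l) t =
      laplace (jostDensity l a) t - a ^ l / t := by
    rw [← laplace_const _ (by linarith)]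
    unfold laplace
    rw [← integral_sub ((jostDensity_admissible l ha).integrable ht)
      (integrableOn_laplaceIntegrand_const _ (by linarith))]
    simp only [laplaceIntegrand, mul_sub]
  rw [h1]
  field_simp
  ring

/-- The expression is the derivative of t times the transform, as needed for the second Jost
condition. -/
theorem tendsto_laplace_jostDensity_sub (l : ℕ) {a : ℂ} (ha : a ∈ closedSector) :
    Tendsto (fun t : ℝ => laplace (jostDensity l a) t -
      t * laplace (fun p => p * jostDensity l a p) t) atTop (𝓝 0) := by
  obtain ⟨K, hK, hb⟩ := norm_jostDensity_sub_le l ha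
  have hinv : Tendsto (fun t : ℝ => ((t⁻¹ : ℝ) : ℂ)) atTop (𝓝 0) := by
    exact_mod_cast (Complex.continuous_ofReal.tendsto 0).comp tendsto_inv_atTop_zero
  have h1 := hinv.mul (tendsto_mul_laplace_jostDensity l ha)
  have h2 : Tendsto (fun t : ℝ => (t : ℂ) * laplace (fun p => p * jostDensity l a p) t) atTop
      (𝓝 0) := by
    refine tendsto_mul_laplace_zero (K := ‖a ^ l‖ + K) (lam := 3) (by positivity) fun p hp => ?_
    have h3 : ‖jostDensity l a p‖ ≤ ‖a ^ l‖ + K * (p * Real.exp (2 * p)) := by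
      have := norm_add_le (a ^ l) (jostDensity l a p - a ^ l)
      rw [add_sub_cancel] at this
      exact this.trans (by gcongr; exact hb p hp)
    rw [norm_mul, Complex.norm_real, Real.norm_of_nonneg hp.le]
    have h4 : p * Real.exp (2 * p) ≤ Real.exp (3 * p) := by
      have : p ≤ Real.exp p := by linarith [Real.add_one_le_exp p]
      calc _ ≤ Real.exp p * Real.exp (2 * p) := by gcongr
        _ = _ := by
          rw [← Real.exp_add]
          ring_nf
    have h5 : 1 ≤ Real.exp (3 * p) := Real.one_le_exp (by positivity)
    calc _ ≤ p * (‖a ^ l‖ + K * (p * Real.exp (2 * p))) := by gcongr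
      _ ≤ p * (‖a ^ l‖ * Real.exp (3 * p) + K * Real.exp (3 * p)) := by
          gcongr
          exact le_mul_of_one_le_right (norm_nonneg _) h5
      _ = _ := by ring
  have h6 := h1.sub h2
  simp only [zero_mul, sub_zero] at h6
  refine h6.congr' ?_
  filter_upwards [eventually_gt_atTop 0] with t ht
  have ht0 : (t : ℂ) ≠ 0 := by exact_mod_cast ht.ne'
  push_cast
  field_simp

/-! ### The Schwarzschild radius and the potential. -/

theorem reggeWheelerCoord_hasDerivAt {M r : ℝ} (hM : 0 < M) (hr : 2 * M < r) :
    HasDerivAt (reggeWheelerCoord M) (r / (r - 2 * M)) r := by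
  have h1 : r / (2 * M) - 1 ≠ 0 := by
    have := (one_lt_div (by positivity : 0 < 2 * M)).2 hr
    linarith
  have h2 := (((hasDerivAt_id r).div_const (2 * M)).sub_const 1).log h1
  have h3 := (hasDerivAt_id r).add (h2.const_mul (2 * M))
  refine h3.congr_deriv ?_
  have h4 : r - 2 * M ≠ 0 := by linarith
  have h5 : r / (2 * M) - 1 = (r - 2 * M) / (2 * M) := by field_simp
  simp only [id]
  rw [h5]
  field_simp
  ring

theorem schwarzschildRadius_reggeWheelerCoord {M r : ℝ} (hM : 0 < M) (hr : 2 * M < r) :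
    schwarzschildRadius M (reggeWheelerCoord M r) = r :=
  (reggeWheelerCoord_bijOn hM).injOn (schwarzschildRadius_gt hM _) hr
    (reggeWheelerCoord_schwarzschildRadius hM _)

theorem schwarzschildRadius_strictMono {M : ℝ} (hM : 0 < M) :
    StrictMono (schwarzschildRadius M) := by
  intro u v huv
  by_contra! h
  have hv := schwarzschildRadius_gt hM v
  have h2 : 0 < 2 * M := by positivity
  have h3 : 0 < schwarzschildRadius M v / (2 * M) - 1 := by
    have := (one_lt_div h2).2 hv
    linarith
  have h4 := Real.log_le_log h3
    (sub_le_sub_right (div_le_div_of_nonneg_right h h2.le) 1)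
  have h5 : reggeWheelerCoord M (schwarzschildRadius M v) ≤
      reggeWheelerCoord M (schwarzschildRadius M u) := by
    unfold reggeWheelerCoord
    gcongr
  rw [reggeWheelerCoord_schwarzschildRadius hM, reggeWheelerCoord_schwarzschildRadius hM] at h5
  linarith

theorem schwarzschildRadius_hasDerivAt {M : ℝ} (hM : 0 < M) (u : ℝ) :
    HasDerivAt (schwarzschildRadius M) (1 - 2 * M / schwarzschildRadius M u) u := by
  have hr := schwarzschildRadius_gt hM u
  have hcont : ContinuousAt (schwarzschildRadius M) u := by
    refine ((schwarzschildRadius_strictMono hM).strictMonoOn univ).continuousAt_of_image_mem_nhds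
      univ_mem ?_
    filter_upwards [Ioi_mem_nhds hr] with r hr
    exact ⟨_, mem_univ _, schwarzschildRadius_reggeWheelerCoord hM hr⟩
  have h0 : schwarzschildRadius M u ≠ 0 := by linarith
  have h1 : schwarzschildRadius M u - 2 * M ≠ 0 := by linarith
  refine (HasDerivAt.of_local_left_inverse hcont (reggeWheelerCoord_hasDerivAt hM hr)
    (div_ne_zero h0 h1)
    (Eventually.of_forall (reggeWheelerCoord_schwarzschildRadius hM))).congr_deriv ?_
  field_simp

theorem schwarzschildRadius_tendsto {M : ℝ} (hM : 0 < M) :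
    Tendsto (schwarzschildRadius M) atTop atTop := by
  refine tendsto_atTop_atTop_of_monotone (schwarzschildRadius_strictMono hM).monotone fun b => ?_
  refine ⟨reggeWheelerCoord M (max b (2 * M) + 1), ?_⟩
  rw [schwarzschildRadius_reggeWheelerCoord hM (by linarith [le_max_right b (2 * M)])]
  linarith [le_max_left b (2 * M)]

/-- The Schwarzschild radius in units of the horizon radius. -/
noncomputable def radiusRatio (M u : ℝ) : ℝ := schwarzschildRadius M u / (2 * M)

theorem one_lt_radiusRatio {M : ℝ} (hM : 0 < M) (u : ℝ) : 1 < radiusRatio M u :=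
  (one_lt_div (by positivity)).2 (schwarzschildRadius_gt hM u)

theorem radiusRatio_hasDerivAt {M : ℝ} (hM : 0 < M) (u : ℝ) :
    HasDerivAt (radiusRatio M) ((1 - (radiusRatio M u)⁻¹) / (2 * M)) u := by
  refine ((schwarzschildRadius_hasDerivAt hM u).div_const (2 * M)).congr_deriv ?_
  rw [radiusRatio, inv_div]

theorem radiusRatio_tendsto {M : ℝ} (hM : 0 < M) : Tendsto (radiusRatio M) atTop atTop :=
  (schwarzschildRadius_tendsto hM).atTop_div_const (by positivity)

theorem potential_eq {M : ℝ} (hM : 0 < M) (l : ℕ) (u : ℝ) : potential M l u =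
    (1 - (radiusRatio M u)⁻¹) * ((radiusRatio M u)⁻¹ ^ 3 + l * (l + 1) * (radiusRatio M u)⁻¹ ^ 2) /
      (2 * M) ^ 2 := by
  have hr := schwarzschildRadius_gt hM u
  have h0 : schwarzschildRadius M u ≠ 0 := by linarith
  unfold potential radiusRatio
  field_simp

theorem continuous_radiusRatio {M : ℝ} (hM : 0 < M) : Continuous (radiusRatio M) :=
  continuous_iff_continuousAt.2 fun u => (radiusRatio_hasDerivAt hM u).continuousAt

theorem continuous_potential {M : ℝ} (hM : 0 < M) (l : ℕ) : Continuous (potential M l) := by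
  have h : Continuous fun u => (radiusRatio M u)⁻¹ :=
    (continuous_radiusRatio hM).inv₀ fun u => by linarith [one_lt_radiusRatio hM u]
  rw [show potential M l = _ from funext (potential_eq hM l)]
  fun_prop

/-- Uniform boundedness makes the first order system globally Lipschitz in the uniqueness proof. -/
theorem abs_potential_le {M : ℝ} (hM : 0 < M) (l : ℕ) (u : ℝ) :
    |potential M l u| ≤ (1 + l * (l + 1)) / (2 * M) ^ 2 := by
  have ht := one_lt_radiusRatio hM u
  have h1 : (radiusRatio M u)⁻¹ ≤ 1 := inv_le_one_of_one_le₀ ht.le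
  have h0 : 0 ≤ (radiusRatio M u)⁻¹ := by positivity
  rw [potential_eq hM]
  set x := (radiusRatio M u)⁻¹
  have hx : 0 ≤ 1 - x := by linarith
  rw [abs_of_nonneg (by positivity)]
  have h2 : x ^ 3 ≤ 1 := pow_le_one₀ h0 h1
  have h3 : x ^ 2 ≤ 1 := pow_le_one₀ h0 h1
  have hl : (0 : ℝ) ≤ l * (l + 1) := by positivity
  gcongr
  calc (1 - x) * (x ^ 3 + l * (l + 1) * x ^ 2) ≤ 1 * (1 + l * (l + 1) * 1) := by
        gcongr
        linarith
    _ = _ := by ring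

theorem contDiff_two_of_hasDerivAt {f f' f'' : ℝ → ℂ} (h : ∀ u, HasDerivAt f (f' u) u)
    (h' : ∀ u, HasDerivAt f' (f'' u) u) (hc : Continuous f'') : ContDiff ℝ 2 f := by
  have e1 : deriv f = f' := funext fun u => (h u).deriv
  have e2 : deriv f' = f'' := funext fun u => (h' u).deriv
  have h1 : ContDiff ℝ 1 f' := contDiff_one_iff_deriv.2
    ⟨fun u => (h' u).differentiableAt, by rwa [e2]⟩
  rw [show (2 : WithTop ℕ∞) = 1 + 1 by norm_num]
  refine contDiff_succ_iff_deriv.2 ⟨fun u => (h u).differentiableAt, by simp, ?_⟩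
  rwa [e1]

/-! ### Existence: the Jost solution as a Laplace transform. -/

/-- The Laplace parameter of the frequency `ω`. -/
noncomputable def jostParam (M : ℝ) (ω : ℂ) : ℂ := 4 * Complex.I * M * ω

theorem jostParam_ne_zero {M : ℝ} (hM : 0 < M) {ω : ℂ} (h0 : ω ≠ 0) : jostParam M ω ≠ 0 := by
  have : (M : ℂ) ≠ 0 := by exact_mod_cast hM.ne'
  unfold jostParam
  simp [this, h0]

/-- Re a = -4M Im ω, so the closed lower half plane of frequencies maps to the closed right half
plane of parameters. -/
theorem jostParam_mem_sector {M : ℝ} (hM : 0 < M) {ω : ℂ} (h : ω.im ≤ 0) (h0 : ω ≠ 0) :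
    jostParam M ω ∈ sector := by
  refine mem_sector_of_re_nonneg ?_ (jostParam_ne_zero hM h0)
  have : (jostParam M ω).re = -(4 * M * ω.im) := by
    simp [jostParam]
  rw [this]
  nlinarith

/-- The Jost solution as a Laplace transform. -/
noncomputable def laplaceJost (M : ℝ) (l : ℕ) (ω : ℂ) (u : ℝ) : ℂ :=
  Complex.exp (-(Complex.I * ω * u)) * ((jostParam M ω ^ l)⁻¹ *
    (radiusRatio M u * laplace (jostDensity l (jostParam M ω)) (radiusRatio M u)))

/-- With dt/du = (1 - 1/t)/(2M), differentiating e^{-iωu} t n(t) twice reduces the Schrödinger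
equation to the radial equation for n. The two asymptotic conditions are the large-t limits of t
n(t) and of its derivative. -/
theorem isJostSolution_laplaceJost {M : ℝ} (hM : 0 < M) (l : ℕ) {ω : ℂ} (h : ω.im ≤ 0)
    (h0 : ω ≠ 0) : IsJostSolution M l ω (laplaceJost M l ω) := by
  have hMc : (M : ℂ) ≠ 0 := by exact_mod_cast hM.ne'
  have ha := sector_subset (jostParam_mem_sector hM h h0)
  have ha0 := jostParam_ne_zero hM h0
  have hai : jostParam M ω = 4 * Complex.I * M * ω := rfl
  set a := jostParam M ω with had
  set τ := radiusRatio M with hτ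
  set n0 : ℝ → ℂ := fun u => laplace (jostDensity l a) (τ u) with hn0
  set n1 : ℝ → ℂ := fun u => laplace (fun p => p * jostDensity l a p) (τ u) with hn1
  set n2 : ℝ → ℂ := fun u => laplace (fun p => p * (p * jostDensity l a p)) (τ u) with hn2
  have hτ1 := one_lt_radiusRatio hM
  have hτ0 : ∀ u, (τ u : ℂ) ≠ 0 := fun u => by exact_mod_cast (by linarith [hτ1 u] : τ u ≠ 0)
  set κ : ℝ → ℂ := fun u => (1 - (τ u : ℂ)⁻¹) / (2 * M) with hκ
  have dτ : ∀ u, HasDerivAt (fun u => (τ u : ℂ)) (κ u) u := fun u =>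
    ((radiusRatio_hasDerivAt hM u).ofReal_comp).congr_deriv (by simp [hκ, hτ])
  have hF := jostDensity_admissible l ha
  have d0 : ∀ u, HasDerivAt n0 (-(κ u * n1 u)) u := fun u =>
    ((hF.hasDerivAt (hτ1 u)).scomp u (radiusRatio_hasDerivAt hM u)).congr_deriv (by
      simp [hκ, hτ, hn1])
  have d1 : ∀ u, HasDerivAt n1 (-(κ u * n2 u)) u := fun u =>
    ((hF.mul_id.hasDerivAt (hτ1 u)).scomp u (radiusRatio_hasDerivAt hM u)).congr_deriv (by
      simp [hκ, hτ, hn2])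
  have dκ : ∀ u, HasDerivAt κ (κ u / ((τ u : ℂ) ^ 2) / (2 * M)) u := fun u => by
    refine ((((dτ u).fun_inv (hτ0 u)).const_sub 1).div_const (2 * (M : ℂ))).congr_deriv ?_
    ring
  have dE : ∀ u : ℝ, HasDerivAt (fun u : ℝ => Complex.exp (-(Complex.I * ω * u)))
      (Complex.exp (-(Complex.I * ω * u)) * (-(Complex.I * ω))) u := fun u => by
    have h1 : HasDerivAt (fun u : ℝ => (u : ℂ)) 1 u := Complex.ofRealCLM.hasDerivAt (x := u)
    simpa using ((h1.const_mul (Complex.I * ω)).fun_neg).cexp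
  set q : ℝ → ℂ := fun u => n0 u - τ u * n1 u with hq
  have dm : ∀ u, HasDerivAt (fun u => (τ u : ℂ) * n0 u) (κ u * q u) u := fun u =>
    ((dτ u).mul (d0 u)).congr_deriv (by simp only [hq]; ring)
  have dq : ∀ u, HasDerivAt q (κ u * (τ u * n2 u - 2 * n1 u)) u := fun u =>
    ((d0 u).sub ((dτ u).mul (d1 u))).congr_deriv (by ring)
  have dφ : ∀ u : ℝ, HasDerivAt (laplaceJost M l ω) (Complex.exp (-(Complex.I * ω * u)) *
      ((a ^ l)⁻¹ * (κ u * q u - Complex.I * ω * (τ u * n0 u)))) u := fun u =>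
    ((dE u).mul ((dm u).const_mul (a ^ l)⁻¹)).congr_deriv (by ring)
  have dφ' : ∀ u : ℝ, HasDerivAt (fun u : ℝ => Complex.exp (-(Complex.I * ω * u)) *
      ((a ^ l)⁻¹ * (κ u * q u - Complex.I * ω * (τ u * n0 u))))
      ((-ω ^ 2 + (potential M l u : ℂ)) * laplaceJost M l ω u) u := fun u => by
    refine ((dE u).mul ((((dκ u).mul (dq u)).sub
      ((dm u).const_mul (Complex.I * ω))).const_mul (a ^ l)⁻¹)).congr_deriv ?_
    have hrad := laplace_jostDensity_radial l ha (hτ1 u)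
    change ((τ u : ℂ) ^ 2 - τ u) * n2 u + (a * (τ u : ℂ) ^ 2 - 2 * τ u + 1) * n1 u -
      (τ u * a + l * (l + 1)) * n0 u = 0 at hrad
    rw [hai] at hrad
    have hV : (potential M l u : ℂ) = κ u / (2 * M) / τ u ^ 2 * ((τ u : ℂ)⁻¹ + l * (l + 1)) := by
      rw [potential_eq hM]
      push_cast
      simp only [hκ]
      have := hτ0 u
      change (1 - (τ u : ℂ)⁻¹) * ((τ u : ℂ)⁻¹ ^ 3 + l * (l + 1) * (τ u : ℂ)⁻¹ ^ 2) /
        (2 * M) ^ 2 = _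
      field_simp
    rw [hV]
    have hl : laplaceJost M l ω u = Complex.exp (-(Complex.I * ω * u)) *
      ((a ^ l)⁻¹ * (τ u * n0 u)) := rfl
    rw [hl]
    set E := Complex.exp (-(Complex.I * ω * u))
    have hκu : κ u = (τ u - 1) / (2 * M * τ u) := by
      simp only [hκ]
      have := hτ0 u
      field_simp
    have hI : Complex.I ^ 2 = -1 := Complex.I_sq
    simp only [Pi.mul_apply, Pi.sub_apply, hq]
    have ht := hτ0 u
    generalize (τ u : ℂ) = t at *
    generalize hAl : (a ^ l)⁻¹ = A
    -- One factor dt/du is rewritten as (t-1)/(2Mt), so that the difference of the two sides becomes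
    -- a common factor times the radial expression.
    have hpoly : κ u * t * (2 * M) = t - 1 := by
      rw [hκu]
      field_simp
    rw [← sub_eq_zero]
    have hm : κ u * (κ u * (t * n2 u - 2 * n1 u)) =
        κ u / (2 * M * t) * ((t - 1) * (t * n2 u - 2 * n1 u)) := by
      rw [← hpoly]
      field_simp
    rw [hm]
    have key : κ u / (2 * M * t) * E * A * (((t : ℂ) ^ 2 - t) * n2 u +
        (4 * Complex.I * M * ω * t ^ 2 - 2 * t + 1) * n1 u -
        (t * (4 * Complex.I * M * ω) + l * (l + 1)) * n0 u) = 0 := by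
      rw [hrad, mul_zero]
    rw [← key]
    field_simp
    ring_nf
    rw [hI]
    ring
  have hd : deriv (laplaceJost M l ω) = fun u : ℝ => Complex.exp (-(Complex.I * ω * u)) *
      ((a ^ l)⁻¹ * (κ u * q u - Complex.I * ω * (τ u * n0 u))) :=
    funext fun u => (dφ u).deriv
  have hcφ : Continuous (laplaceJost M l ω) :=
    continuous_iff_continuousAt.2 fun u => (dφ u).continuousAt
  have hmul : (fun u : ℝ => Complex.exp (Complex.I * ω * u) * laplaceJost M l ω u) =
      fun u => (a ^ l)⁻¹ * (τ u * n0 u) := by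
    funext u
    have h1 : Complex.exp (Complex.I * ω * u) * Complex.exp (-(Complex.I * ω * u)) = 1 := by
      rw [← Complex.exp_add, add_neg_cancel, Complex.exp_zero]
    change Complex.exp (Complex.I * ω * u) * (Complex.exp (-(Complex.I * ω * u)) *
      ((a ^ l)⁻¹ * (τ u * n0 u))) = _
    rw [← mul_assoc, h1, one_mul]
  have hτt := radiusRatio_tendsto hM
  refine ⟨contDiff_two_of_hasDerivAt dφ dφ' ?_, fun u => ?_, ?_, ?_⟩
  · exact (continuous_const.add (Complex.continuous_ofReal.comp (continuous_potential hM l))).mul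
      hcφ
  · rw [hd, (dφ' u).deriv]
    ring
  · rw [hmul]
    have h1 := ((tendsto_mul_laplace_jostDensity l ha).comp hτt).const_mul (a ^ l)⁻¹
    rw [inv_mul_cancel₀ (pow_ne_zero l ha0)] at h1
    exact h1
  · rw [hmul, show deriv (fun u => (a ^ l)⁻¹ * ((τ u : ℂ) * n0 u)) =
      fun u => (a ^ l)⁻¹ * (κ u * q u) from funext fun u => ((dm u).const_mul _).deriv]
    have h1 := (tendsto_laplace_jostDensity_sub l ha).comp hτt
    have h2 : Tendsto κ atTop (𝓝 ((1 - 0) / (2 * M))) := by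
      have h3 : Tendsto (fun u => ((τ u)⁻¹ : ℂ)) atTop (𝓝 0) := by
        have h4 := (Complex.continuous_ofReal.tendsto 0).comp (tendsto_inv_atTop_zero.comp hτt)
        refine (by simpa using h4 : Tendsto _ _ (𝓝 (0 : ℂ))).congr fun u => ?_
        simp [hτ]
      exact (h3.const_sub 1).div_const _
    have h3 := (h2.mul h1).const_mul (a ^ l)⁻¹
    simp only [mul_zero] at h3
    exact h3

/-! ### Uniqueness of the Jost solution. -/

section Uniqueness

variable {M : ℝ} {l : ℕ} {ω : ℂ} {φ ψ : ℝ → ℂ}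

theorem IsJostSolution.hasDerivAt (h : IsJostSolution M l ω φ) (u : ℝ) :
    HasDerivAt φ (deriv φ u) u :=
  (h.contDiff.differentiable (by norm_num) u).hasDerivAt

theorem IsJostSolution.hasDerivAt_deriv (h : IsJostSolution M l ω φ) (u : ℝ) :
    HasDerivAt (deriv φ) ((-ω ^ 2 + (potential M l u : ℂ)) * φ u) u := by
  have h1 : ContDiff ℝ (1 + 1) φ := by
    rw [show (1 + 1 : WithTop ℕ∞) = 2 by norm_num]
    exact h.contDiff
  have h2 := (contDiff_succ_iff_deriv.1 h1).2.2
  refine (h2.differentiable (by norm_num) u).hasDerivAt.congr_deriv ?_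
  linear_combination -(h.schrodinger u)

theorem hasDerivAt_exp_mul (ω : ℂ) {f : ℝ → ℂ} {f' : ℂ} {u : ℝ} (hf : HasDerivAt f f' u) :
    HasDerivAt (fun u : ℝ => Complex.exp (Complex.I * ω * u) * f u)
      (Complex.I * ω * (Complex.exp (Complex.I * ω * u) * f u) +
        Complex.exp (Complex.I * ω * u) * f') u := by
  have h1 : HasDerivAt (fun u : ℝ => (u : ℂ)) 1 u := Complex.ofRealCLM.hasDerivAt (x := u)
  have h2 : HasDerivAt (fun u : ℝ => Complex.exp (Complex.I * ω * u))
      (Complex.exp (Complex.I * ω * u) * (Complex.I * ω)) u := by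
    simpa using (h1.const_mul (Complex.I * ω)).cexp
  exact (h2.mul hf).congr_deriv (by ring)

theorem IsJostSolution.tendsto_exp_mul_deriv (h : IsJostSolution M l ω φ) :
    Tendsto (fun u : ℝ => Complex.exp (Complex.I * ω * u) * deriv φ u) atTop
      (𝓝 (-(Complex.I * ω))) := by
  have h1 := h.tendsto_deriv.sub (h.tendsto_one.const_mul (Complex.I * ω))
  rw [mul_one, zero_sub] at h1
  refine h1.congr fun u => ?_
  rw [(hasDerivAt_exp_mul ω (h.hasDerivAt u)).deriv]
  ring

/-- The Wronskian W is constant, and e^{2iωv} W tends to -iω + iω = 0 by the Jost conditions. Since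
Im ω ≤ 0, the exponential has modulus at least 1 for v ≥ 0, so W = 0. -/
theorem IsJostSolution.wronskian_eq_zero (hω : ω.im ≤ 0) (h : IsJostSolution M l ω φ)
    (h' : IsJostSolution M l ω ψ) (u : ℝ) : φ u * deriv ψ u - deriv φ u * ψ u = 0 := by
  set W : ℝ → ℂ := fun u => φ u * deriv ψ u - deriv φ u * ψ u with hW
  have hder : ∀ u, HasDerivAt W 0 u := fun u =>
    (((h.hasDerivAt u).mul (h'.hasDerivAt_deriv u)).sub
      ((h.hasDerivAt_deriv u).mul (h'.hasDerivAt u))).congr_deriv (by ring)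
  have hconst : ∀ v, W v = W u := fun v =>
    is_const_of_deriv_eq_zero (fun x => (hder x).differentiableAt) (fun x => (hder x).deriv) v u
  have hlim : Tendsto (fun v : ℝ => Complex.exp (Complex.I * ω * v) ^ 2 * W u) atTop (𝓝 0) := by
    have h1 := (h.tendsto_one.mul h'.tendsto_exp_mul_deriv).sub
      (h.tendsto_exp_mul_deriv.mul h'.tendsto_one)
    rw [one_mul, mul_one, sub_self] at h1
    refine h1.congr fun v => ?_
    rw [← hconst v]
    simp only [hW]
    ring
  have hle : ‖W u‖ ≤ 0 := by
    refine le_of_tendsto_of_tendsto tendsto_const_nhds (by simpa using hlim.norm) ?_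
    filter_upwards [eventually_ge_atTop 0] with v hv
    refine le_mul_of_one_le_left (norm_nonneg _) (one_le_pow₀ ?_)
    rw [Complex.norm_exp]
    refine Real.one_le_exp ?_
    have : (Complex.I * ω * v).re = -(ω.im * v) := by simp
    rw [this]
    nlinarith
  exact norm_le_zero_iff.1 hle

/-- Near +∞ the function ψ has no zeros, so the vanishing Wronskian makes φ/ψ constant there, and
the normalization makes the constant 1. -/
theorem IsJostSolution.eventually_eq (hω : ω.im ≤ 0) (h : IsJostSolution M l ω φ)
    (h' : IsJostSolution M l ω ψ) : ∀ᶠ u in atTop, φ u = ψ u := by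
  have hev : ∀ᶠ u : ℝ in atTop, ψ u ≠ 0 := by
    filter_upwards [h'.tendsto_one.eventually_ne one_ne_zero] with u hu h0
    simp [h0] at hu
  obtain ⟨U, hU⟩ := eventually_atTop.1 hev
  have hder : ∀ u ∈ Ioi U, HasDerivAt (fun u => φ u / ψ u) 0 u := fun u hu => by
    refine ((h.hasDerivAt u).div (h'.hasDerivAt u) (hU u (le_of_lt hu))).congr_deriv ?_
    rw [div_eq_zero_iff]
    left
    linear_combination -(h.wronskian_eq_zero hω h' u)
  have hconst : ∀ u ∈ Ioi U, ∀ v ∈ Ioi U, φ u / ψ u = φ v / ψ v := fun u hu v hv =>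
    isOpen_Ioi.is_const_of_deriv_eq_zero isPreconnected_Ioi
      (fun x hx => (hder x hx).differentiableAt.differentiableWithinAt)
      (fun x hx => (hder x hx).deriv) hu hv
  have hlim : Tendsto (fun u => φ u / ψ u) atTop (𝓝 1) := by
    have h1 := h.tendsto_one.div h'.tendsto_one one_ne_zero
    rw [div_one] at h1
    refine h1.congr fun u => ?_
    simp only [Pi.div_apply]
    rw [mul_div_mul_left _ _ (Complex.exp_ne_zero _)]
  filter_upwards [eventually_gt_atTop U] with u hu
  have h2 : φ u / ψ u = 1 := by
    refine tendsto_nhds_unique ?_ hlim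
    refine Tendsto.congr' ?_ tendsto_const_nhds
    filter_upwards [eventually_gt_atTop U] with v hv using hconst u hu v hv
  rwa [div_eq_one_iff_eq (hU u hu.le)] at h2

theorem IsJostSolution.unique (hM : 0 < M) (hω : ω.im ≤ 0) (h : IsJostSolution M l ω φ)
    (h' : IsJostSolution M l ω ψ) : φ = ψ := by
  obtain ⟨U, hU⟩ := eventually_atTop.1 (h.eventually_eq hω h')
  set B : ℝ := (1 + l * (l + 1)) / (2 * M) ^ 2
  have hB : 0 ≤ B := by positivity
  set K : NNReal := ⟨1 + (‖ω‖ ^ 2 + B), by positivity⟩ with hK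
  set v : ℝ → ℂ × ℂ → ℂ × ℂ := fun u x => (x.2, (-ω ^ 2 + (potential M l u : ℂ)) * x.1) with hv
  have hlip : ∀ u, LipschitzOnWith K (v u) univ := fun u => by
    refine LipschitzOnWith.of_dist_le_mul fun x _ y _ => ?_
    rw [dist_eq_norm, dist_eq_norm]
    have h1 : ‖-ω ^ 2 + (potential M l u : ℂ)‖ ≤ ‖ω‖ ^ 2 + B := by
      refine (norm_add_le _ _).trans ?_
      rw [norm_neg, norm_pow, Complex.norm_real, Real.norm_eq_abs]
      gcongr
      exact abs_potential_le hM l u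
    have h2 : v u x - v u y = ((x - y).2, (-ω ^ 2 + (potential M l u : ℂ)) * (x - y).1) := by
      simp only [hv, Prod.mk_sub_mk, Prod.fst_sub, Prod.snd_sub]
      rw [mul_sub]
    rw [h2, Prod.norm_mk, norm_mul]
    have h3 := norm_fst_le (x - y)
    have h4 := norm_snd_le (x - y)
    have h5 : (K : ℝ) = 1 + (‖ω‖ ^ 2 + B) := rfl
    rw [h5]
    refine max_le ?_ ?_
    · refine h4.trans (le_mul_of_one_le_left (norm_nonneg _) ?_)
      linarith [sq_nonneg ‖ω‖]
    · refine mul_le_mul (h1.trans (by linarith)) h3 (norm_nonneg _) (by positivity)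
  have hsol : ∀ χ : ℝ → ℂ, IsJostSolution M l ω χ → ∀ u,
      HasDerivAt (fun u => (χ u, deriv χ u)) (v u (χ u, deriv χ u)) u ∧
        (χ u, deriv χ u) ∈ (univ : Set (ℂ × ℂ)) := fun χ hχ u =>
    ⟨(hχ.hasDerivAt u).prodMk (hχ.hasDerivAt_deriv u), mem_univ _⟩
  have hloc : φ =ᶠ[𝓝 (U + 1)] ψ := by
    filter_upwards [Ioi_mem_nhds (lt_add_one U)] with u hu using hU u (le_of_lt hu)
  -- At U + 1 the two solutions agree on a whole neighbourhood, hence so do the initial values and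
  -- derivatives.
  have key := ODE_solution_unique_univ (s := fun _ => univ) (t₀ := U + 1) hlip (hsol φ h)
    (hsol ψ h') (by
      rw [hloc.deriv_eq, hloc.eq_of_nhds])
  funext u
  exact (Prod.ext_iff.1 (congrFun key u)).1

theorem existsUnique_isJostSolution (hM : 0 < M) (l : ℕ) (hω : ω.im ≤ 0) (h0 : ω ≠ 0) :
    ∃! φ : ℝ → ℂ, IsJostSolution M l ω φ :=
  ⟨laplaceJost M l ω, isJostSolution_laplaceJost hM l hω h0, fun _ h =>
    h.unique hM hω (isJostSolution_laplaceJost hM l hω h0)⟩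

theorem jostSolution_eq (hM : 0 < M) (l : ℕ) (hω : ω.im ≤ 0) (h0 : ω ≠ 0) :
    jostSolution M l ω = laplaceJost M l ω := by
  have h := isJostSolution_laplaceJost hM l hω h0
  have h1 : IsJostSolution M l ω (jostSolution M l ω) :=
    Classical.epsilon_spec (p := IsJostSolution M l ω) ⟨_, h⟩
  exact h1.unique hM hω h

end Uniqueness

/-! ### The renormalized Jost solution and its boundary values. -/

/-- As a = 4iMω, the factor ω^l cancels the singular normalization a^{-l} and leaves a constant. -/
theorem pow_mul_jostSolution_eq {M : ℝ} (hM : 0 < M) (l : ℕ) {ω : ℂ} (hω : ω.im ≤ 0) (h0 : ω ≠ 0)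
    (u : ℝ) : ω ^ l * jostSolution M l ω u = Complex.exp (-(Complex.I * ω * u)) *
      (((4 * Complex.I * M) ^ l)⁻¹ * (radiusRatio M u *
        laplace (jostDensity l (jostParam M ω)) (radiusRatio M u))) := by
  rw [jostSolution_eq hM l hω h0, laplaceJost]
  have h1 : ω ^ l * (jostParam M ω ^ l)⁻¹ = ((4 * Complex.I * M) ^ l)⁻¹ := by
    rw [jostParam, mul_pow, mul_inv, mul_left_comm, mul_inv_cancel₀ (pow_ne_zero l h0), mul_one]
  rw [← h1]
  ring

theorem continuous_jostParam (M : ℝ) : Continuous (jostParam M) := by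
  unfold jostParam
  fun_prop

/-- The open sector contains the punctured imaginary axis, so the transform is holomorphic in a
around the parameter of a real ω ≠ 0, and continuity there gives the limit. -/
theorem tendsto_jostSolution {M : ℝ} (hM : 0 < M) (l : ℕ) {ω : ℝ} (h0 : ω ≠ 0) (u : ℝ) :
    Tendsto (fun z : ℂ => z ^ l * jostSolution M l z u) (𝓝[{z : ℂ | z.im < 0}] (ω : ℂ))
      (𝓝 ((ω : ℂ) ^ l * jostSolution M l ω u)) := by
  have h0' : (ω : ℂ) ≠ 0 := by exact_mod_cast h0
  have hmem := jostParam_mem_sector hM (ω := ω) (by simp) h0'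
  have hF : ContinuousAt (fun a => laplace (jostDensity l a) (radiusRatio M u))
      (jostParam M ω) :=
    (((jostDensity_holoFamily l).laplace
      (fun R lam hlam => by
        obtain ⟨K, hK, h⟩ := jostDensity_singExpBounded l R lam hlam
        exact ⟨K, hK, fun a ha => h a (sector_subset ha)⟩)
      (one_lt_radiusRatio hM u)).1.differentiableAt (isOpen_sector.mem_nhds hmem)).continuousAt
  have hG : ContinuousAt (fun z : ℂ => Complex.exp (-(Complex.I * z * u)) *
      (((4 * Complex.I * M) ^ l)⁻¹ * (radiusRatio M u *
        laplace (jostDensity l (jostParam M z)) (radiusRatio M u)))) ω := by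
    have h1 : ContinuousAt (fun z => laplace (jostDensity l (jostParam M z)) (radiusRatio M u))
        (ω : ℂ) := ContinuousAt.comp (g := fun a => laplace (jostDensity l a) (radiusRatio M u))
      (f := jostParam M) hF (continuous_jostParam M).continuousAt
    have h2 : ContinuousAt (fun z : ℂ => Complex.exp (-(Complex.I * z * u))) (ω : ℂ) :=
      Continuous.continuousAt (by fun_prop)
    exact h2.mul (continuousAt_const.mul (continuousAt_const.mul h1))
  rw [pow_mul_jostSolution_eq hM l (by simp) h0' u]
  refine (hG.tendsto.mono_left nhdsWithin_le_nhds).congr' ?_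
  filter_upwards [self_mem_nhdsWithin] with z hz
  have hz' : z.im < 0 := hz
  refine (pow_mul_jostSolution_eq hM l hz'.le (fun h => ?_) u).symm
  simp [h] at hz'

/-! ### Differentiability at zero frequency. -/

/-- Such z has Re z ≥ -|a|/4 and |z| ≥ 3|a|/4. The sector is wide enough to hold discs of radius
proportional to |a| around imaginary a, as Cauchy's estimate requires. -/
theorem mem_sector_of_dist_le {a z : ℂ} (ha : 0 ≤ a.re) (h0 : a ≠ 0) (hz : ‖z - a‖ ≤ ‖a‖ / 4) :
    z ∈ sector := by
  have h1 : 0 < ‖a‖ := norm_pos_iff.2 h0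
  have h2 := (Complex.abs_re_le_norm (z - a)).trans hz
  rw [Complex.sub_re, abs_le] at h2
  have h3 := norm_sub_norm_le a z
  rw [norm_sub_rev] at h3
  change -(‖z‖ / 2) < z.re
  linarith [h2.1]

/-- Cauchy's estimate at points of the closed right half plane. -/
theorem tendsto_mul_deriv_zero {h : ℂ → ℂ} (hd : DifferentiableOn ℂ h sector)
    (hl : Tendsto h (𝓝[sector] 0) (𝓝 (h 0))) :
    Tendsto (fun a => a * deriv h a) (𝓝[{a | 0 ≤ a.re}] 0) (𝓝 0) := by
  rw [Metric.tendsto_nhdsWithin_nhds]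
  intro ε hε
  obtain ⟨δ, hδ, hb⟩ := Metric.tendsto_nhdsWithin_nhds.1 hl (ε / 8) (by positivity)
  refine ⟨δ / 2, by positivity, fun a ha had => ?_⟩
  rw [dist_zero_right] at had ⊢
  rcases eq_or_ne a 0 with rfl | h0
  · simpa using hε
  have h1 : 0 < ‖a‖ := norm_pos_iff.2 h0
  have hmem : ∀ z, ‖z - a‖ ≤ ‖a‖ / 4 → z ∈ sector := fun z hz => mem_sector_of_dist_le ha h0 hz
  -- Subtracting the limit value leaves a function at most ε/8 on a circle of radius |a|/4, so |a
  -- h'(a)| ≤ ε/2.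
  have key := Complex.norm_deriv_le_of_forall_mem_sphere_norm_le (f := fun z => h z - h 0) (c := a)
    (R := ‖a‖ / 4) (C := ε / 8) (by positivity)
    (DifferentiableOn.diffContOnCl_ball (U := sector) (hd.sub_const _) fun z hz => by
      rw [Metric.mem_closedBall, dist_eq_norm] at hz
      exact hmem z hz)
    fun z hz => by
      rw [mem_sphere_iff_norm] at hz
      have h2 : ‖z‖ ≤ ‖z - a‖ + ‖a‖ := by
        simpa using norm_add_le (z - a) a
      have h3 := hb (hmem z hz.le) (by
        rw [dist_zero_right]
        linarith)
      rw [dist_eq_norm] at h3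
      exact h3.le
  rw [deriv_sub_const, le_div_iff₀ (by positivity)] at key
  rw [norm_mul]
  linarith

theorem hasDerivAt_jostParam (M ω : ℝ) :
    HasDerivAt (fun ω : ℝ => jostParam M ω) (4 * Complex.I * M) ω := by
  have h1 : HasDerivAt (fun u : ℝ => (u : ℂ)) 1 ω := Complex.ofRealCLM.hasDerivAt (x := ω)
  simpa [jostParam] using h1.const_mul (4 * Complex.I * (M : ℂ))

/-- Multiplication by the parameter makes a function holomorphic in the sector and continuous at
the vertex continuously differentiable along the real frequencies. -/
theorem contDiff_jostParam_mul {M : ℝ} (hM : 0 < M) {h : ℂ → ℂ} (hd : DifferentiableOn ℂ h sector)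
    (hl : Tendsto h (𝓝[sector] 0) (𝓝 (h 0))) :
    ContDiff ℝ 1 fun ω : ℝ => jostParam M ω * h (jostParam M ω) := by
  set b : ℂ := 4 * Complex.I * M with hb
  set A : ℝ → ℂ := fun ω => jostParam M ω with hA
  have hA0 : A 0 = 0 := by simp [hA, jostParam]
  have hmem : ∀ ω : ℝ, ω ≠ 0 → A ω ∈ sector := fun ω h0 =>
    jostParam_mem_sector hM (by simp) (by exact_mod_cast h0)
  have hAd : ∀ ω, HasDerivAt A b ω := hasDerivAt_jostParam M
  have hAc : Continuous A := continuous_iff_continuousAt.2 fun ω => (hAd ω).continuousAt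
  have hre : ∀ ω, 0 ≤ (A ω).re := fun ω => by simp [hA, jostParam]
  have hh : ContinuousAt (fun ω => h (A ω)) 0 := by
    rw [continuousAt_iff_punctured_nhds, hA0]
    refine hl.comp (tendsto_nhdsWithin_iff.2 ⟨?_, ?_⟩)
    · rw [← hA0]
      exact hAc.continuousAt.tendsto.mono_left nhdsWithin_le_nhds
    · filter_upwards [self_mem_nhdsWithin] with ω hω using hmem ω hω
  have hA00 : Tendsto A (𝓝 0) (𝓝[{a | 0 ≤ a.re}] 0) := by
    refine tendsto_nhdsWithin_iff.2 ⟨?_, Eventually.of_forall hre⟩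
    rw [← hA0]
    exact hAc.continuousAt.tendsto
  set g : ℝ → ℂ := fun ω => b * h (A ω) + b * (A ω * deriv h (A ω)) with hg
  have hdiff : ∀ ω, ω ≠ 0 → HasDerivAt (fun ω => A ω * h (A ω)) (g ω) ω := fun ω h0 => by
    have h1 := (hd.differentiableAt (isOpen_sector.mem_nhds (hmem ω h0))).hasDerivAt
    refine ((hAd ω).mul (h1.comp ω (hAd ω))).congr_deriv ?_
    simp only [hg, Function.comp]
    ring
  have hg0 : ContinuousAt g 0 := by
    refine (continuousAt_const.mul hh).add (continuousAt_const.mul ?_)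
    unfold ContinuousAt
    dsimp only
    rw [hA0, zero_mul]
    exact (tendsto_mul_deriv_zero hd hl).comp hA00
  -- A continuous function whose derivative away from 0 extends continuously to 0 is differentiable
  -- there with that value.
  have hall := hasDerivAt_of_hasDerivAt_of_ne' hdiff (hAc.continuousAt.mul hh) hg0
  have hderiv : deriv (fun ω => A ω * h (A ω)) = g := funext fun ω => (hall ω).deriv
  refine contDiff_one_iff_deriv.2 ⟨fun ω => (hall ω).differentiableAt, ?_⟩
  rw [hderiv]
  refine continuous_iff_continuousAt.2 fun ω => ?_
  rcases eq_or_ne ω 0 with rfl | h0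
  · exact hg0
  · have hn := isOpen_sector.mem_nhds (hmem ω h0)
    have h1 : ContinuousAt (fun ω => h (A ω)) ω :=
      ContinuousAt.comp (g := h) (f := A) (hd.differentiableAt hn).continuousAt hAc.continuousAt
    have h2 : ContinuousAt (fun ω => deriv h (A ω)) ω :=
      ContinuousAt.comp (g := deriv h) (f := A)
        ((hd.deriv isOpen_sector).differentiableAt hn).continuousAt hAc.continuousAt
    exact (continuousAt_const.mul h1).add (continuousAt_const.mul (hAc.continuousAt.mul h2))

/-! ### The low frequency expansion. -/

theorem LaplaceAdmissible.pow_mul {f : ℝ → ℂ} (hf : LaplaceAdmissible f) (k : ℕ) :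
    LaplaceAdmissible fun p => (p : ℂ) ^ k * f p := by
  induction k with
  | zero => simpa using hf
  | succ k ih =>
    convert ih.mul_id using 2 with p
    ring

theorem radialDensity_admissible (l : ℕ) {a : ℂ} (ha : a ∈ closedSector) :
    LaplaceAdmissible (radialDensity l a) :=
  (radialDensity_expBounded l).singExpBounded.laplaceAdmissible ha (radialDensity_continuousOn l ha)

/-- The part of the low frequency expansion that is polynomial in the Laplace parameter. -/
noncomputable def laplaceMain (l : ℕ) (t : ℝ) (a : ℂ) : ℂ :=
  laplace (fun p => legForm l p a * radialDensity l 0 p) t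

/-- The limit density does not depend on a, so a enters only through the powers in the Legendre
form. -/
theorem laplaceMain_eq (l : ℕ) {t : ℝ} (ht : 1 < t) (a : ℂ) : laplaceMain l t a =
    ∑ k ∈ Finset.range (l + 1),
      laplace (fun p => (p : ℂ) ^ k * radialDensity l 0 p) t * (legCoeff l k * a ^ (l - k)) := by
  have hv := radialDensity_admissible l zero_mem_closedSector
  unfold laplaceMain laplace
  simp_rw [← integral_mul_const]
  rw [← integral_finsetSum _ fun k _ => ((hv.pow_mul k).integrable ht).mul_const _]
  refine integral_congr_ae (Eventually.of_forall fun p => ?_)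
  simp only [laplaceIntegrand, legForm, Finset.mul_sum, Finset.sum_mul]
  exact Finset.sum_congr rfl fun k _ => by ring

/-- The part of the low frequency expansion that is merely continuous at the vertex. -/
noncomputable def laplaceCorrection (l : ℕ) (t : ℝ) (a : ℂ) : ℂ :=
  laplace (fun p => legForm l p a * densityCorrection l a p) t

/-- The logarithmic factor in `radialDensity_expansion` is independent of p and passes through the
Laplace integral. -/
theorem laplace_jostDensity_expansion (l : ℕ) {a : ℂ} (ha : a ∈ sector) {t : ℝ} (ht : 1 < t) :
    (1 - 1 / 2 * a * Complex.log a) * laplace (jostDensity l a) t =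
      laplaceMain l t a + a * laplaceCorrection l t a := by
  have hf : HoloFamily fun a p => legForm l p a * densityCorrection l a p :=
    (densityCorrection_holoFamily l).legForm_mul l
  have h1 : IntegrableOn (laplaceIntegrand (fun p => legForm l p a * densityCorrection l a p) t)
      (Ioi 0) :=
    (((densityCorrection_singExpBounded l).legForm_mul l).laplaceAdmissible ha
      (hf.cont a ha)).integrable ht
  have h0 : IntegrableOn (laplaceIntegrand (fun p => legForm l p a * radialDensity l 0 p) t)
      (Ioi 0) := by
    have h2 : SingExpBounded univ fun a p => legForm l p a * radialDensity l 0 p := by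
      refine SingExpBounded.legForm_mul (f := fun _ => radialDensity l 0) (fun R lam hlam => ?_) l
      obtain ⟨K, hK, hb⟩ := (radialDensity_expBounded l).singExpBounded |R| lam hlam
      exact ⟨K, hK, fun _ _ _ => hb 0 zero_mem_closedSector (by simp)⟩
    exact (h2.laplaceAdmissible (mem_univ a) ((continuous_legForm_ofReal l a).continuousOn.mul
      (radialDensity_continuousOn l zero_mem_closedSector))).integrable ht
  unfold laplaceMain laplaceCorrection laplace
  rw [← integral_const_mul, ← integral_const_mul, ← integral_add h0 (h1.const_mul a)]
  refine setIntegral_congr_fun measurableSet_Ioi fun p hp => ?_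
  have h3 := radialDensity_expansion l ha hp
  simp only [laplaceIntegrand, jostDensity]
  linear_combination (Real.exp (-(p * t)) : ℂ) * legForm l p a * h3

theorem differentiableOn_laplace_jostDensity (l : ℕ) {t : ℝ} (ht : 1 < t) :
    DifferentiableOn ℂ (fun a => laplace (jostDensity l a) t) sector ∧
    Tendsto (fun a => laplace (jostDensity l a) t) (𝓝[sector] 0)
      (𝓝 (laplace (jostDensity l 0) t)) :=
  (jostDensity_holoFamily l).laplace (fun R lam hlam => by
    obtain ⟨K, hK, h⟩ := jostDensity_singExpBounded l R lam hlam
    exact ⟨K, hK, fun a ha => h a (sector_subset ha)⟩) ht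

theorem differentiableOn_laplaceCorrection (l : ℕ) {t : ℝ} (ht : 1 < t) :
    DifferentiableOn ℂ (laplaceCorrection l t) sector ∧
    Tendsto (laplaceCorrection l t) (𝓝[sector] 0) (𝓝 (laplaceCorrection l t 0)) :=
  ((densityCorrection_holoFamily l).legForm_mul l).laplace
    ((densityCorrection_singExpBounded l).legForm_mul l) ht

theorem contDiff_ofReal : ContDiff ℝ 1 fun ω : ℝ => (ω : ℂ) := Complex.ofRealCLM.contDiff

/-- The prefactor relating the Jost solution to the Laplace transform. -/
noncomputable def jostPrefactor (M : ℝ) (l : ℕ) (ω u : ℝ) : ℂ :=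
  Complex.exp (-(Complex.I * ω * u)) * (((4 * Complex.I * M) ^ l)⁻¹ * radiusRatio M u)

theorem contDiff_jostPrefactor (M : ℝ) (l : ℕ) (u : ℝ) :
    ContDiff ℝ 1 fun ω => jostPrefactor M l ω u :=
  (((contDiff_const.mul contDiff_ofReal).mul contDiff_const).neg.cexp).mul contDiff_const

/-- The regular part of the Jost solution at low frequencies. -/
noncomputable def jostRegular (M : ℝ) (l : ℕ) (ω u : ℝ) : ℂ :=
  jostPrefactor M l ω u * (laplaceMain l (radiusRatio M u) (jostParam M ω) +
    jostParam M ω * laplaceCorrection l (radiusRatio M u) (jostParam M ω))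

theorem contDiff_jostRegular {M : ℝ} (hM : 0 < M) (l : ℕ) (u : ℝ) :
    ContDiff ℝ 1 fun ω => jostRegular M l ω u := by
  have ht := one_lt_radiusRatio hM u
  have hG := differentiableOn_laplaceCorrection l ht
  refine (contDiff_jostPrefactor M l u).mul (ContDiff.add ?_ (contDiff_jostParam_mul hM hG.1 hG.2))
  simp_rw [laplaceMain_eq l ht]
  refine ContDiff.sum fun k _ => contDiff_const.mul (contDiff_const.mul (ContDiff.pow ?_ _))
  exact contDiff_const.mul contDiff_ofReal

/-- The Jost solution multiplied by `ω ^ (l + 1)`, up to a constant. -/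
noncomputable def jostRemainder (M : ℝ) (l : ℕ) (ω u : ℝ) : ℂ :=
  jostPrefactor M l ω u *
    (jostParam M ω * laplace (jostDensity l (jostParam M ω)) (radiusRatio M u))

theorem contDiff_jostRemainder {M : ℝ} (hM : 0 < M) (l : ℕ) (u : ℝ) :
    ContDiff ℝ 1 fun ω => jostRemainder M l ω u := by
  have hN := differentiableOn_laplace_jostDensity l (one_lt_radiusRatio hM u)
  exact (contDiff_jostPrefactor M l u).mul (contDiff_jostParam_mul hM hN.1 hN.2)

/-- With L = log a and R = (1 - aL/2) N one has N = R + (aL/2) R + (a²L²/4) N. The second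
substitution is made because N is only known to be continuous at a = 0, whereas aN is C¹. The
constants come from a = 2M · 2iω and L = log(2M) + log(2iω), valid since 2M > 0. -/
theorem pow_mul_jostSolution_expansion {M : ℝ} (hM : 0 < M) (l : ℕ) {ω : ℝ} (h0 : ω ≠ 0) (u : ℝ) :
    (ω : ℂ) ^ l * jostSolution M l ω u = jostRegular M l ω u +
      2 * Complex.I * ω * Complex.log (2 * Complex.I * ω) ^ 2 * (M / 2 * jostRemainder M l ω u) +
      2 * Complex.I * ω * Complex.log (2 * Complex.I * ω) *
        (M * jostRegular M l ω u + M * Real.log (2 * M) * jostRemainder M l ω u) +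
      2 * Complex.I * ω * (M * Real.log (2 * M) * jostRegular M l ω u +
        M / 2 * Real.log (2 * M) ^ 2 * jostRemainder M l ω u) := by
  have h0' : (ω : ℂ) ≠ 0 := by exact_mod_cast h0
  have ha : jostParam M ω = (2 * M : ℝ) * (2 * Complex.I * ω) := by
    rw [jostParam]
    push_cast
    ring
  have hlog : Complex.log (jostParam M ω) =
      Real.log (2 * M) + Complex.log (2 * Complex.I * ω) := by
    rw [ha, Complex.log_ofReal_mul (by positivity) (by simp [h0])]
  have key := laplace_jostDensity_expansion l (jostParam_mem_sector hM (ω := ω) (by simp) h0')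
    (one_lt_radiusRatio hM u)
  rw [pow_mul_jostSolution_eq hM l (by simp) h0' u]
  unfold jostRemainder jostRegular
  rw [← key, hlog]
  unfold jostPrefactor
  generalize laplace (jostDensity l (jostParam M ω)) (radiusRatio M u) = N
  rw [ha]
  push_cast
  ring

/-- The extension of `initialFunction` to zero frequency. -/
theorem exists_contDiff_initialFunction (l : ℕ) (u : ℝ) : ∃ f : ℝ → ℂ, ContDiff ℝ 1 f ∧
    ∀ ω : ℝ, ω ≠ 0 → f ω = initialFunction l ω u := by
  refine ⟨fun ω => Complex.exp (-(Complex.I * ω * u)) * ∑ k ∈ Finset.range (l + 1),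
    hankelSymbol l k / (2 * Complex.I * u) ^ k * (ω : ℂ) ^ (l - k), ?_, fun ω h0 => ?_⟩
  · exact (((contDiff_const.mul contDiff_ofReal).mul contDiff_const).neg.cexp).mul
      (ContDiff.sum (s := Finset.range (l + 1)) fun k _ =>
        contDiff_const.mul (contDiff_ofReal.pow _))
  · have h0' : (ω : ℂ) ≠ 0 := by exact_mod_cast h0
    dsimp only
    rw [initialFunction, mul_comm ((ω : ℂ) ^ l), mul_assoc (Complex.exp _),
      Finset.mul_sum (a := (ω : ℂ) ^ l)]
    congr 1
    refine Finset.sum_congr rfl fun k hk => ?_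
    rw [pow_sub₀ _ h0' (Nat.lt_succ_iff.1 (Finset.mem_range.1 hk)),
      show 2 * Complex.I * (ω : ℂ) * u = 2 * Complex.I * u * ω by ring,
      mul_pow (2 * Complex.I * (u : ℂ)), div_eq_mul_inv, div_eq_mul_inv, mul_inv]
    ring

theorem mainTheorem7 (M : ℝ) (hM : 0 < M) (l : ℕ) (hl : 1 ≤ l) :
    -- the Jost solutions are well defined for `ω ≠ 0` in the closed lower half plane
    (∀ ω : ℂ, ω.im ≤ 0 → ω ≠ 0 → ∃! φ : ℝ → ℂ, IsJostSolution M l ω φ) ∧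
    -- on the real axis they are the continuous extension from the open lower half plane
    (∀ ω : ℝ, ω ≠ 0 → ∀ u : ℝ,
      Tendsto (fun z : ℂ => z ^ l * jostSolution M l z u) (𝓝[{z : ℂ | z.im < 0}] (ω : ℂ))
        (𝓝 ((ω : ℂ) ^ l * jostSolution M l ω u))) ∧
    -- the expansion
    ∃ g₃ g₄ g₅ g₆ : ℝ → ℝ → ℂ, ∀ u : ℝ, 0 < u →
      ContDiff ℝ 1 (fun ω : ℝ => g₃ ω u) ∧
      ContDiff ℝ 1 (fun ω : ℝ => g₄ ω u) ∧
      ContDiff ℝ 1 (fun ω : ℝ => g₅ ω u) ∧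
      ContDiff ℝ 1 (fun ω : ℝ => g₆ ω u) ∧
      ∀ ω : ℝ, ω ≠ 0 →
        (ω : ℂ) ^ l * jostSolution M l ω u =
          initialFunction l ω u + g₃ ω u +
            2 * Complex.I * ω * Complex.log (2 * Complex.I * ω) ^ 2 * g₄ ω u +
            2 * Complex.I * ω * Complex.log (2 * Complex.I * ω) * g₅ ω u +
            2 * Complex.I * ω * g₆ ω u := by
  refine ⟨fun ω hω h0 => existsUnique_isJostSolution hM l hω h0,
    fun ω h0 u => tendsto_jostSolution hM l h0 u, ?_⟩
  -- Away from ω = 0 the Hankel term agrees with a C¹ function; this extension, rather than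
  -- `initialFunction` itself, is subtracted in g₃ to keep regularity at ω = 0.
  choose f hf hfi using exists_contDiff_initialFunction l
  refine ⟨fun ω u => jostRegular M l ω u - f u ω, fun ω u => M / 2 * jostRemainder M l ω u,
    fun ω u => M * jostRegular M l ω u + M * Real.log (2 * M) * jostRemainder M l ω u,
    fun ω u => M * Real.log (2 * M) * jostRegular M l ω u +
      M / 2 * Real.log (2 * M) ^ 2 * jostRemainder M l ω u, fun u _ => ?_⟩
  have hR := contDiff_jostRegular hM l u
  have hS := contDiff_jostRemainder hM l u
  refine ⟨hR.sub (hf u), contDiff_const.mul hS, (contDiff_const.mul hR).add (contDiff_const.mul hS),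
    (contDiff_const.mul hR).add (contDiff_const.mul hS), fun ω h0 => ?_⟩
  dsimp only
  rw [pow_mul_jostSolution_expansion hM l h0 u, hfi u ω h0]
  ring
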